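/- Let $0<\alpha<1$, let $n\ge 2$ be an integer, and let $k_n=(-1)^{q+1}$ if $n=2q$ is even, $k_n\in\{1,-1\}$ if $n$ is odd. For $x\in\mathbb R$, $t>0$ let $$p_n(x,t)=\frac1{2\pi}\int_{-\infty}^{+\infty}e^{ixz+k_nt(iz)^n}\,dz$$ (a convergent improper integral). For $u>0$ let $\overline p_\alpha(\cdot\,;u)$ be a probability density of the stable law $S_\alpha(\sigma,1,0)$ with $\sigma=(u\cos(\pi\alpha/2))^{1/\alpha}$; here $S_\alpha(\sigma,\beta,\mu)$ is the law with characteristic function $$s\mapsto\exp\left\{-\sigma^\alpha|s|^\alpha\left(1-i\beta\,\mathrm{sign}(s)\tan\tfrac{\pi\alpha}2\right)+i\mu s\right\},$$ and such densities exist. For $t>0$ let $I_{1-\alpha}[f](t)=\frac1{\Gamma(1-\alpha)}\int_0^t(t-w)^{-\alpha}f(w)\,dw$ be the Riemann–Liouville fractional integral, and let $D^\alpha f(t)=\frac1{\Gamma(1-\alpha)}\int_0^t(t-z)^{-\alpha}f'(z)\,dz$ be the Dzherbashyan–Caputo derivative. A function $v:\mathbb R\times(0,\infty)\to\mathbb C$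 is called a fundamental solution of $$\frac{\partial^\alpha v}{\partial t^\alpha}=k_n\frac{\partial^nv}{\partial x^n}\quad(x\in\mathbb R,\ t>0),\qquad v(x,0)=\delta(x),$$ if $v(\cdot,t)$ is continuous and bounded for every $t>0$ and if, for every Schwartz function $\varphi:\mathbb R\to\mathbb C$, the function $F_\varphi(t)=\int_{\mathbb R}v(x,t)\varphi(x)\,dx$ is $C^1$ on $(0,\infty)$, tends to $\varphi(0)$ as $t\to0^+$, the integral defining $D^\alpha F_\varphi(t)$ converges absolutely for every $t>0$, and $D^\alpha F_\varphi(t)=(-1)^nk_n\int_{\mathbb R}v(x,t)\varphi^{(n)}(x)\,dx$ for every $t>0$. Then this problem has exactly one fundamental solution $u_\alpha$, and it is given by $$u_\alpha(x,t)=\int_0^\infty p_n(x,u)\,I_{1-\alpha}\left[\overline p_\alpha(\cdot\,;u)\right](t)\,du,\qquad x\in\mathbb R,\ t>0,$$ where the integral over $u$ and the integral defining $I_{1-\alpha}$ converge absolutely. -/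

import Mathlib

open Filter Topology MeasureTheory

open scoped SchwartzMap

noncomputable section

/-- The admissible coefficients `k` of the `n`-th order heat-type equation: `k = (-1)^(q+1)` when
`n = 2q`, and `k = ±1` when `n` is odd. -/
def IsHeatCoeff (n : ℕ) (k : ℝ) : Prop :=
  (∀ q : ℕ, n = 2 * q → k = (-1) ^ (q + 1)) ∧ (Odd n → k = 1 ∨ k = -1)

/-- The integral `(1 / 2π) ∫_a^b exp (i x z + k t (i z)^n) dz` over a bounded interval. -/
def heatKernelTrunc (n : ℕ) (k x t : ℝ) (a b : ℝ) : ℂ :=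
  (1 / (2 * Real.pi) : ℂ) *
    ∫ z in a..b, Complex.exp (Complex.I * x * z + k * t * (Complex.I * z) ^ n)

/-- The kernel `p_n(x,t) = (1 / 2π) ∫_{-∞}^{+∞} exp (i x z + k t (i z)^n) dz` of
`∂p/∂t = k ∂ⁿp/∂xⁿ`. It is an improper integral, since for odd `n` the integrand has modulus one. -/
def heatKernel (n : ℕ) (k x t : ℝ) : ℂ :=
  limUnder (atBot ×ˢ atTop) fun R : ℝ × ℝ => heatKernelTrunc n k x t R.1 R.2

/-- The characteristic function of the stable law `S_α(σ, β, μ)`, `α ≠ 1`. -/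
def stableCharFun (α σ β μ s : ℝ) : ℂ :=
  Complex.exp (-((σ ^ α * |s| ^ α : ℝ) : ℂ) *
      (1 - Complex.I * β * (Real.sign s : ℝ) * (Real.tan (Real.pi * α / 2) : ℝ)) +
    Complex.I * μ * s)

/-- `p` is a probability density of the stable law `S_α(σ, β, μ)`, `α ≠ 1`. -/
structure IsStableDensity (α σ β μ : ℝ) (p : ℝ → ℝ) : Prop where
  measurable : Measurable p
  nonneg : ∀ w, 0 ≤ p w
  isProbabilityMeasure : IsProbabilityMeasure (volume.withDensity fun w => ENNReal.ofReal (p w))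
  charFun_eq : ∀ s : ℝ,
    charFun (volume.withDensity fun w => ENNReal.ofReal (p w)) s = stableCharFun α σ β μ s

/-- The Riemann–Liouville fractional integral of order `γ > 0`. -/
def rlIntegral (γ : ℝ) (f : ℝ → ℝ) (t : ℝ) : ℝ :=
  1 / Real.Gamma γ * ∫ w in (0 : ℝ)..t, (t - w) ^ (γ - 1) * f w

/-- The Dzherbashyan–Caputo derivative of order `0 < α < 1`. -/
def caputoDeriv (α : ℝ) (f : ℝ → ℂ) (t : ℝ) : ℂ :=
  (1 / Real.Gamma (1 - α) : ℝ) * ∫ z in (0 : ℝ)..t, ((t - z) ^ (-α) : ℝ) * deriv f z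

/-- The pairing `t ↦ ∫ v(x,t) φ(x) dx` of `v(·,t)` with a test function. -/
def pairing (v : ℝ → ℝ → ℂ) (φ : ℝ → ℂ) (t : ℝ) : ℂ :=
  ∫ x, v x t * φ x

/-- `v` is a fundamental solution of `∂^α v/∂t^α = k ∂ⁿv/∂xⁿ` on `ℝ × (0,∞)`, `v(·,0) = δ`, with the
Caputo derivative of order `0 < α < 1` in time: each `v(·,t)` is continuous and bounded, and the
equation and the initial condition hold in the sense of tempered distributions in `x`. (The equation
cannot hold pointwise at `x = 0`, where `∂ⁿ⁻¹v/∂xⁿ⁻¹` has a jump.) -/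
structure IsFundamentalSolution (α : ℝ) (n : ℕ) (k : ℝ) (v : ℝ → ℝ → ℂ) : Prop where
  continuous : ∀ t, 0 < t → Continuous fun x => v x t
  bounded : ∀ t, 0 < t → ∃ C : ℝ, ∀ x, ‖v x t‖ ≤ C
  initial : ∀ φ : 𝓢(ℝ, ℂ), Tendsto (pairing v φ) (𝓝[>] 0) (𝓝 (φ 0))
  contDiffOn : ∀ φ : 𝓢(ℝ, ℂ), ContDiffOn ℝ 1 (pairing v φ) (Set.Ioi 0)
  integrable : ∀ φ : 𝓢(ℝ, ℂ), ∀ t, 0 < t →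
    IntervalIntegrable (fun z => ((t - z) ^ (-α) : ℝ) * deriv (pairing v φ) z) volume 0 t
  equation : ∀ φ : 𝓢(ℝ, ℂ), ∀ t, 0 < t →
    caputoDeriv α (pairing v φ) t = k * pairing v (fun x => (-1) ^ n * iteratedDeriv n φ x) t

/-- The scale `σ = (u cos (πα/2))^(1/α)`. -/
def stableScale (α u : ℝ) : ℝ :=
  (u * Real.cos (Real.pi * α / 2)) ^ (1 / α)

/-- `u_α(x,t) = ∫_0^∞ p_n(x,u) I_{1-α}[p̄(·;u)](t) du`, for a family `pbar u = p̄(·;u)`. -/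
def subordinatedKernel (α : ℝ) (n : ℕ) (k : ℝ) (pbar : ℝ → ℝ → ℝ) (x t : ℝ) : ℂ :=
  ∫ u in Set.Ioi (0 : ℝ), heatKernel n k x u * (rlIntegral (1 - α) (pbar u) t : ℝ)

end

/-! On the Fourier side the equation decouples: frequency `z` evolves by `D^α y = c(z) y`, `y(0) =
1`, with symbol `c(z) = k (iz)^n`, so `y(t) = E_α(c(z) t^α)` with `E_α` the Mittag-Leffler function.
The admissible coefficients are those with `Re c ≤ 0`.

Existence. The weight `I_{1-α}[p̄(·;u)](t)` is, as a function of `u`, the density of the inverse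
stable subordinator at time `t`. Its moments are `Γ(q+1) t^(αq) / Γ(αq+1)` for every real `q > -1`
(`lintegral_rpow_invLaw`). Summing the integer moments gives `∫ e^(wu) = E_α(w t^α)`. Hence mixing
`p_n(·,u)`, whose transform is `e^(c(z)u)`, against this law produces exactly `E_α(c(z) t^α)`. The
moment of order `-1/n` makes the mixture absolutely convergent, since `|p_n(x,u)| ≤ C u^(-1/n)`
uniformly in `x`: for even `n` by absolute integrability, for odd `n` by van der Corput. Because
`E_α` is the moment generating function of a law on `(0,∞)`, it and its derivative are bounded on
`Re w ≤ 0`. This justifies differentiating and exchanging integrals, and the Caputo equation is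
checked term by term with Beta integrals.

The stable laws are constructed as limits: `1 - (1-w)^α` has nonnegative Taylor coefficients of sum
one, so it generates a law on the integers, and rescaled `N`-fold convolutions have Laplace
transforms tending to `e^(-z^α)`. Integrability of the limiting characteristic function yields a
bounded density.

Uniqueness. Two solutions are compared on a test function `φ` whose transform `g` has compact
support. Let `A q` be the symbol of the adjoint operator, with `A` so large that `|q| < 1` on that
support, and let `φ_m` have transform `g q^m`. The differences `b_m` of the pairings with `φ_m`
satisfy `D^α b_m = A b_{m+1}` with zero initial value. Banach–Steinhaus over `ℓ¹` bounds them
uniformly in `m` and in `t ≤ T` (`exists_bound_pairing`). Iterating Abel's inversion of `D^α` gives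
`|b_0(t)| ≤ C (A t^α)^j / Γ(αj+1)` for every `j`, so `b_0 = 0`. Band-limited functions contain
approximate identities at every point, which recovers the continuous function `v(·,t)`. -/

/-! ### Oscillatory integrals -/

/-- Integration by parts for `∫ exp ψ` away from the critical points of `ψ`. -/
theorem norm_integral_exp_le {ψ ψ' ψ'' : ℝ → ℂ} {M M' : ℝ → ℝ} {a b : ℝ} (hab : a ≤ b)
    (hψ : ∀ z ∈ Set.Icc a b, HasDerivAt ψ (ψ' z) z)
    (hψ' : ∀ z ∈ Set.Icc a b, HasDerivAt ψ' (ψ'' z) z)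
    (hψ'' : ContinuousOn ψ'' (Set.Icc a b))
    (hne : ∀ z ∈ Set.Icc a b, ψ' z ≠ 0)
    (hre : ∀ z ∈ Set.Icc a b, (ψ z).re ≤ 0)
    (hM : ∀ z ∈ Set.Icc a b, HasDerivAt M (M' z) z)
    (hM' : ContinuousOn M' (Set.Icc a b))
    (hle : ∀ z ∈ Set.Icc a b, ‖ψ'' z / ψ' z ^ 2‖ ≤ M' z) :
    ‖∫ z in a..b, Complex.exp (ψ z)‖ ≤ 1 / ‖ψ' a‖ + 1 / ‖ψ' b‖ + (M b - M a) := by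
  have hu : Set.uIcc a b = Set.Icc a b := Set.uIcc_of_le hab
  have cψ : ContinuousOn ψ (Set.Icc a b) := fun z hz => (hψ z hz).continuousAt.continuousWithinAt
  have cψ' : ContinuousOn ψ' (Set.Icc a b) :=
    fun z hz => (hψ' z hz).continuousAt.continuousWithinAt
  have cexp : ContinuousOn (fun z => Complex.exp (ψ z)) (Set.Icc a b) := cψ.cexp
  have cq : ContinuousOn (fun z => Complex.exp (ψ z) * (ψ'' z / ψ' z ^ 2)) (Set.Icc a b) :=
    cexp.mul (hψ''.div (cψ'.pow 2) fun z hz => pow_ne_zero 2 (hne z hz))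
  have i1 : IntervalIntegrable (fun z => Complex.exp (ψ z)) volume a b :=
    ContinuousOn.intervalIntegrable (by rwa [hu])
  have i2 : IntervalIntegrable (fun z => Complex.exp (ψ z) * (ψ'' z / ψ' z ^ 2)) volume a b :=
    ContinuousOn.intervalIntegrable (by rwa [hu])
  have i3 : IntervalIntegrable M' volume a b :=
    ContinuousOn.intervalIntegrable (by rwa [hu])
  have key : ∫ z in a..b, (Complex.exp (ψ z) - Complex.exp (ψ z) * (ψ'' z / ψ' z ^ 2)) =
      Complex.exp (ψ b) / ψ' b - Complex.exp (ψ a) / ψ' a := by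
    refine intervalIntegral.integral_eq_sub_of_hasDerivAt
      (f := fun z => Complex.exp (ψ z) / ψ' z) (fun z hz => ?_) (i1.sub i2)
    rw [hu] at hz
    have h0 := hne z hz
    refine ((hψ z hz).cexp.div (hψ' z hz) h0).congr_deriv ?_
    field_simp
  have hE : ∀ z ∈ Set.Icc a b, ‖Complex.exp (ψ z)‖ ≤ 1 := fun z hz => by
    rw [Complex.norm_exp]; exact Real.exp_le_one_iff.2 (hre z hz)
  have key2 : ‖∫ z in a..b, Complex.exp (ψ z) * (ψ'' z / ψ' z ^ 2)‖ ≤ M b - M a := by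
    rw [← intervalIntegral.integral_eq_sub_of_hasDerivAt (fun z hz => hM z (hu ▸ hz)) i3]
    refine intervalIntegral.norm_integral_le_of_norm_le hab (ae_of_all _ fun z hz => ?_) i3
    have hz' := Set.Ioc_subset_Icc_self hz
    rw [norm_mul]
    calc _ ≤ 1 * M' z := mul_le_mul (hE z hz') (hle z hz') (norm_nonneg _) zero_le_one
      _ = _ := one_mul _
  rw [intervalIntegral.integral_sub i1 i2] at key
  have hd : ∀ z ∈ Set.Icc a b, ‖Complex.exp (ψ z) / ψ' z‖ ≤ 1 / ‖ψ' z‖ := fun z hz => by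
    rw [norm_div]; gcongr; exact hE z hz
  have ha := hd a (Set.left_mem_Icc.2 hab)
  have hb := hd b (Set.right_mem_Icc.2 hab)
  calc ‖∫ z in a..b, Complex.exp (ψ z)‖
      = ‖Complex.exp (ψ b) / ψ' b - Complex.exp (ψ a) / ψ' a +
          ∫ z in a..b, Complex.exp (ψ z) * (ψ'' z / ψ' z ^ 2)‖ := by rw [← key]; congr 1; ring
    _ ≤ ‖Complex.exp (ψ b) / ψ' b‖ + ‖Complex.exp (ψ a) / ψ' a‖ +
          ‖∫ z in a..b, Complex.exp (ψ z) * (ψ'' z / ψ' z ^ 2)‖ :=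
        (norm_add_le _ _).trans (by gcongr; exact norm_sub_le _ _)
    _ ≤ _ := by linarith

/-! ### The symbol and the phase. -/

theorem IsHeatCoeff.abs_eq_one {n : ℕ} {k : ℝ} (hk : IsHeatCoeff n k) : |k| = 1 := by
  rcases Nat.even_or_odd' n with ⟨q, hq | hq⟩
  · rw [hk.1 q hq]; simp
  · rcases hk.2 ⟨q, hq⟩ with h | h <;> simp [h]

/-- For odd order the symbol is `i κ u zⁿ` with `κ = ±1`. -/
theorem IsHeatCoeff.exists_of_odd {n : ℕ} {k : ℝ} (hk : IsHeatCoeff n k) (hn : Odd n) :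
    ∃ κ : ℝ, |κ| = 1 ∧ (k : ℂ) * Complex.I ^ n = Complex.I * κ := by
  obtain ⟨q, rfl⟩ := hn
  refine ⟨k * (-1) ^ q, by simp [abs_mul, hk.abs_eq_one], ?_⟩
  rw [pow_succ, pow_mul, Complex.I_sq]; push_cast; ring

theorem IsHeatCoeff.of_even {n : ℕ} {k : ℝ} (hk : IsHeatCoeff n k) (hn : Even n) :
    (k : ℂ) * Complex.I ^ n = -1 := by
  obtain ⟨q, hq⟩ := hn
  have hq : n = 2 * q := by omega
  rw [hk.1 q hq, hq, pow_mul, Complex.I_sq]; push_cast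
  rw [← pow_add, show q + 1 + q = 2 * q + 1 by ring, pow_succ, pow_mul]; simp

/-- The symbol is `-z^n` for even `n` and purely imaginary for odd `n`. This sign bounds the
exponentials by one and later keeps the argument of the Mittag-Leffler function in the closed left
half-plane. -/
theorem IsHeatCoeff.re_nonpos {n : ℕ} {k : ℝ} (hk : IsHeatCoeff n k) (z : ℝ) :
    ((k : ℂ) * (Complex.I * z) ^ n).re ≤ 0 := by
  rw [mul_pow, ← mul_assoc]
  rcases Nat.even_or_odd n with hn | hn
  · rw [hk.of_even hn, ← Complex.ofReal_pow, neg_one_mul, Complex.neg_re, Complex.ofReal_re]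
    exact neg_nonpos.2 (hn.pow_nonneg z)
  · obtain ⟨κ, -, h⟩ := hk.exists_of_odd hn
    rw [h, ← Complex.ofReal_pow, mul_assoc, ← Complex.ofReal_mul, Complex.I_mul_re,
      Complex.ofReal_im, neg_zero]

/-- The reflection `z ↦ -z` turns the negative half-line into the positive one and replaces `k` by
this coefficient, so all estimates need only be proved on `[0, ∞)`. -/
theorem IsHeatCoeff.neg {n : ℕ} {k : ℝ} (hk : IsHeatCoeff n k) : IsHeatCoeff n ((-1) ^ n * k) := by
  refine ⟨fun q hq => ?_, fun hn => ?_⟩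
  · rw [hq, pow_mul]; simpa using hk.1 q hq
  · rw [hn.neg_one_pow]; rcases hk.2 hn with h | h <;> simp [h]

/-- The exponent `i x z + k t (i z)ⁿ` in the definition of the heat kernel. -/
noncomputable def heatPhase (n : ℕ) (k x t z : ℝ) : ℂ :=
  Complex.I * x * z + k * t * (Complex.I * z) ^ n

theorem heatPhase_re_nonpos {n : ℕ} {k : ℝ} (hk : IsHeatCoeff n k) (x : ℝ) {t : ℝ} (ht : 0 ≤ t)
    (z : ℝ) : (heatPhase n k x t z).re ≤ 0 := by
  have h := mul_nonpos_of_nonneg_of_nonpos ht (hk.re_nonpos z)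
  have h2 : (k : ℂ) * t * (Complex.I * z) ^ n = (t : ℂ) * (k * (Complex.I * z) ^ n) := by ring
  rw [heatPhase, h2, Complex.add_re, Complex.re_ofReal_mul]
  simpa using h

theorem norm_exp_heatPhase_le {n : ℕ} {k : ℝ} (hk : IsHeatCoeff n k) (x : ℝ) {t : ℝ} (ht : 0 ≤ t)
    (z : ℝ) : ‖Complex.exp (heatPhase n k x t z)‖ ≤ 1 := by
  rw [Complex.norm_exp]; exact Real.exp_le_one_iff.2 (heatPhase_re_nonpos hk x ht z)

theorem hasDerivAt_heatPhase (m : ℕ) (k x t z : ℝ) :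
    HasDerivAt (heatPhase (m + 2) k x t)
      (Complex.I * x + k * t * (m + 2) * Complex.I * (Complex.I * z) ^ (m + 1)) z := by
  have h1 : HasDerivAt (fun z : ℝ => Complex.I * (z : ℂ)) Complex.I z := by
    simpa using (Complex.ofRealCLM.hasDerivAt (x := z)).const_mul Complex.I
  have h2 := ((Complex.ofRealCLM.hasDerivAt (x := z)).const_mul (Complex.I * x)).add
    ((h1.pow (m + 2)).const_mul (k * t : ℂ))
  refine h2.congr_deriv ?_
  simp; ring

theorem hasDerivAt_heatPhase_deriv (m : ℕ) (k x t z : ℝ) :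
    HasDerivAt (fun z : ℝ => Complex.I * x + k * t * (m + 2) * Complex.I *
      (Complex.I * z) ^ (m + 1) : ℝ → ℂ)
      (-(k * t * (m + 2) * (m + 1) * (Complex.I * z) ^ m)) z := by
  have h1 : HasDerivAt (fun z : ℝ => Complex.I * (z : ℂ)) Complex.I z := by
    simpa using (Complex.ofRealCLM.hasDerivAt (x := z)).const_mul Complex.I
  have h2 := ((h1.pow (m + 1)).const_mul (k * t * (m + 2) * Complex.I : ℂ)).const_add
    (Complex.I * x)
  refine h2.congr_deriv ?_
  simp only [Nat.cast_add, Nat.cast_one, Nat.add_sub_cancel]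
  linear_combination (k * t * (m + 2) * (m + 1) * (Complex.I * z) ^ m : ℂ) * Complex.I_sq

/-- The tails of the integral defining the heat kernel, locally uniformly in `x`. -/
theorem norm_integral_heatPhase_tail_le {m : ℕ} {k : ℝ} (hk : IsHeatCoeff (m + 2) k) {x t R : ℝ}
    (ht : 0 < t) (hR : 0 < R) (hx : 2 * |x| ≤ t * (m + 2) * R ^ (m + 1)) {a b : ℝ} (ha : R ≤ a)
    (hab : a ≤ b) :
    ‖∫ z in a..b, Complex.exp (heatPhase (m + 2) k x t z)‖ ≤ 8 / (t * (m + 2) * R ^ (m + 1)) := by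
  have hk1 := hk.abs_eq_one
  have hT : 0 < t * (m + 2) := by positivity
  have hlow : ∀ z, R ≤ z → t * (m + 2) * z ^ (m + 1) / 2 ≤
      ‖(Complex.I * x + k * t * (m + 2) * Complex.I * (Complex.I * z) ^ (m + 1) : ℂ)‖ := by
    intro z hz
    have hz0 : 0 < z := hR.trans_le hz
    have h1 : ‖(k * t * (m + 2) * Complex.I * (Complex.I * z) ^ (m + 1) : ℂ)‖ =
        t * (m + 2) * z ^ (m + 1) := by
      have : ‖(m + 2 : ℂ)‖ = m + 2 := by
        rw [show (m + 2 : ℂ) = ((m + 2 : ℕ) : ℂ) by push_cast; ring, Complex.norm_natCast]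
        push_cast; ring
      simp [abs_of_pos ht, abs_of_pos hz0, hk1, this]
    have h2 : ‖(Complex.I * x : ℂ)‖ = |x| := by simp
    have h3 : t * (m + 2) * R ^ (m + 1) ≤ t * (m + 2) * z ^ (m + 1) := by gcongr
    have h4 := norm_sub_norm_le (k * t * (m + 2) * Complex.I * (Complex.I * z) ^ (m + 1) : ℂ)
      (-(Complex.I * x))
    rw [h1, norm_neg, h2, sub_neg_eq_add, add_comm _ (Complex.I * (x : ℂ))] at h4
    linarith
  have hpos : ∀ z, R ≤ z → 0 < t * (m + 2) * z ^ (m + 1) / 2 := fun z hz => by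
    have hz0 : 0 < z := hR.trans_le hz
    positivity
  have main := norm_integral_exp_le (ψ := heatPhase (m + 2) k x t)
    -- From `|ψ'| ≥ t (m+2) z^(m+1) / 2` one gets `|ψ''/ψ'^2| ≤ 4 (m+1) / (t (m+2) z^(m+2))`; this
    -- `M` is an antiderivative of the right-hand side.
    (M := fun z => -(4 / (t * (m + 2))) * (z ^ (m + 1))⁻¹)
    (M' := fun z => (4 * (m + 1) / (t * (m + 2))) * (z ^ (m + 2))⁻¹)
    hab (fun z _ => hasDerivAt_heatPhase m k x t z)
    (fun z _ => hasDerivAt_heatPhase_deriv m k x t z) (by fun_prop)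
    (fun z hz => norm_pos_iff.1 ((hpos z (ha.trans hz.1)).trans_le (hlow z (ha.trans hz.1))))
    (fun z _ => heatPhase_re_nonpos hk x ht.le z) (fun z hz => ?_) ?_ (fun z hz => ?_)
  · have ha0 : 0 < a := hR.trans_le ha
    have e1 : ∀ z, R ≤ z → 1 / ‖(Complex.I * x + k * t * (m + 2) * Complex.I *
        (Complex.I * z) ^ (m + 1) : ℂ)‖ ≤ 2 / (t * (m + 2) * R ^ (m + 1)) := fun z hz => by
      refine (one_div_le_one_div_of_le (hpos R le_rfl) (le_trans ?_ (hlow z hz))).trans_eq ?_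
      · gcongr
      · field_simp
    have e2 : (4 / (t * (m + 2))) * (a ^ (m + 1))⁻¹ ≤ 4 / (t * (m + 2) * R ^ (m + 1)) := by
      rw [← div_eq_mul_inv, div_div]; gcongr
    have e3 : 0 ≤ (4 / (t * (m + 2))) * (b ^ (m + 1))⁻¹ := by
      have : 0 < b := ha0.trans_le hab
      positivity
    have e4 : 2 / (t * (m + 2) * R ^ (m + 1)) + 2 / (t * (m + 2) * R ^ (m + 1)) +
      4 / (t * (m + 2) * R ^ (m + 1)) = 8 / (t * (m + 2) * R ^ (m + 1)) := by ring
    have := e1 a ha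
    have := e1 b (ha.trans hab)
    linarith
  · have hz0 : 0 < z := hR.trans_le (ha.trans hz.1)
    have := ((hasDerivAt_pow (m + 1) z).inv (by positivity)).const_mul (-(4 / (t * (m + 2))))
    refine this.congr_deriv ?_
    push_cast
    field_simp
    ring
  · refine ContinuousOn.mul continuousOn_const (ContinuousOn.inv₀ (by fun_prop) fun z hz => ?_)
    have hz0 : 0 < z := hR.trans_le (ha.trans hz.1)
    positivity
  · have hz0 : 0 < z := hR.trans_le (ha.trans hz.1)
    have h1 : ‖(-(k * t * (m + 2) * (m + 1) * (Complex.I * z) ^ m) : ℂ)‖ =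
        t * (m + 2) * (m + 1) * z ^ m := by
      have : ‖(m + 2 : ℂ)‖ = m + 2 := by
        rw [show (m + 2 : ℂ) = ((m + 2 : ℕ) : ℂ) by push_cast; ring, Complex.norm_natCast]
        push_cast; ring
      have h' : ‖(m + 1 : ℂ)‖ = m + 1 := by
        rw [show (m + 1 : ℂ) = ((m + 1 : ℕ) : ℂ) by push_cast; ring, Complex.norm_natCast]
        push_cast; ring
      simp [abs_of_pos ht, abs_of_pos hz0, hk1, this, h']
    rw [norm_div, norm_pow, h1]
    have h2 := hlow z (ha.trans hz.1)
    have h3 := hpos z (ha.trans hz.1)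
    calc _ ≤ t * (m + 2) * (m + 1) * z ^ m / (t * (m + 2) * z ^ (m + 1) / 2) ^ 2 := by gcongr
      _ = _ := by field_simp; ring

/-- First-derivative test of van der Corput for the odd order phases. -/
theorem norm_integral_heatPhase_le_of_le_abs {m : ℕ} {k : ℝ} (hk : IsHeatCoeff (m + 2) k)
    {κ : ℝ} (hκ : |κ| = 1) (hkκ : (k : ℂ) * Complex.I ^ (m + 2) = Complex.I * κ)
    {x t l : ℝ} (ht : 0 < t) (hl : 0 < l) {a b : ℝ} (ha : 0 ≤ a) (hab : a ≤ b)
    (h : (∀ z ∈ Set.Icc a b, l ≤ κ * x + t * (m + 2) * z ^ (m + 1)) ∨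
      ∀ z ∈ Set.Icc a b, κ * x + t * (m + 2) * z ^ (m + 1) ≤ -l) :
    ‖∫ z in a..b, Complex.exp (heatPhase (m + 2) k x t z)‖ ≤ 3 / l := by
  have hκ2 : κ * κ = 1 := by rw [← abs_mul_abs_self, hκ, one_mul]
  set D : ℝ → ℝ := fun z => κ * x + t * (m + 2) * z ^ (m + 1) with hD
  have hDabs : ∀ z ∈ Set.Icc a b, l ≤ |D z| := fun z hz => by
    rcases h with h | h
    · exact (h z hz).trans (le_abs_self _)
    · exact le_abs.2 (Or.inr (by have := h z hz; simp only [hD]; linarith))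
  have hDne : ∀ z ∈ Set.Icc a b, D z ≠ 0 := fun z hz =>
    abs_pos.1 (hl.trans_le (hDabs z hz))
  have hψ' : ∀ z : ℝ, (Complex.I * x + k * t * (m + 2) * Complex.I * (Complex.I * z) ^ (m + 1) : ℂ)
      = Complex.I * κ * (D z : ℝ) := fun z => by
    have hκ2' : (κ : ℂ) * κ = 1 := by exact_mod_cast hκ2
    simp only [hD]; push_cast
    linear_combination (t * (m + 2) * (z : ℂ) ^ (m + 1)) * hkκ - (Complex.I * x) * hκ2'
  have hnorm : ∀ z : ℝ, ‖(Complex.I * x + k * t * (m + 2) * Complex.I *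
      (Complex.I * z) ^ (m + 1) : ℂ)‖ = |D z| := fun z => by
    rw [hψ']; simp [hκ]
  have hDd : ∀ z : ℝ, HasDerivAt D (t * (m + 2) * ((m + 1) * z ^ m)) z := fun z => by
    have := ((hasDerivAt_pow (m + 1) z).const_mul (t * (m + 2))).const_add (κ * x)
    refine this.congr_deriv ?_
    push_cast; ring
  have hk1 := hk.abs_eq_one
  have main := norm_integral_exp_le (ψ := heatPhase (m + 2) k x t)
    -- `D` is increasing on `[0, ∞)` and keeps its sign, so `|ψ''/ψ'^2| = D'/D^2` is exactly the
    -- derivative of `-1/D` and its integral telescopes.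
    (M := fun z => -(D z)⁻¹)
    (M' := fun z => t * (m + 2) * ((m + 1) * z ^ m) / D z ^ 2)
    hab (fun z _ => hasDerivAt_heatPhase m k x t z)
    (fun z _ => hasDerivAt_heatPhase_deriv m k x t z) (by fun_prop)
    (fun z hz => norm_pos_iff.1 (by rw [hnorm]; exact hl.trans_le (hDabs z hz)))
    (fun z _ => heatPhase_re_nonpos hk x ht.le z) (fun z hz => ?_) ?_ (fun z hz => ?_)
  · have am := Set.left_mem_Icc.2 hab
    have bm := Set.right_mem_Icc.2 hab
    rw [hnorm, hnorm] at main
    have e1 := one_div_le_one_div_of_le hl (hDabs a am)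
    have e2 := one_div_le_one_div_of_le hl (hDabs b bm)
    have e3 : -(D b)⁻¹ - -(D a)⁻¹ ≤ 1 / l := by
      rcases h with h | h
      · have h1 : l ≤ D a := h a am
        have h2 : l ≤ D b := h b bm
        have h3 : (D a)⁻¹ ≤ l⁻¹ := inv_anti₀ hl h1
        have h4 : 0 ≤ (D b)⁻¹ := inv_nonneg.2 (hl.le.trans h2)
        rw [one_div]; linarith
      · have h1 : l ≤ -D a := by have := h a am; simp only [hD]; linarith
        have h2 : l ≤ -D b := by have := h b bm; simp only [hD]; linarith
        have h3 : (-D b)⁻¹ ≤ l⁻¹ := inv_anti₀ hl h2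
        have h4 : 0 ≤ (-D a)⁻¹ := inv_nonneg.2 (hl.le.trans h1)
        rw [inv_neg] at h3 h4
        rw [one_div]; linarith
    have e4 : 3 / l = 1 / l + 1 / l + 1 / l := by ring
    linarith
  · refine ((hDd z).inv (hDne z hz)).neg.congr_deriv ?_
    ring
  · refine ContinuousOn.div (by fun_prop) (by fun_prop) fun z hz => pow_ne_zero 2 (hDne z hz)
  · have hz0 : 0 ≤ z := ha.trans hz.1
    have h1 : ‖(-(k * t * (m + 2) * (m + 1) * (Complex.I * z) ^ m) : ℂ)‖ =
        t * (m + 2) * ((m + 1) * z ^ m) := by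
      have : ‖(m + 2 : ℂ)‖ = m + 2 := by
        rw [show (m + 2 : ℂ) = ((m + 2 : ℕ) : ℂ) by push_cast; ring, Complex.norm_natCast]
        push_cast; ring
      have h' : ‖(m + 1 : ℂ)‖ = m + 1 := by
        rw [show (m + 1 : ℂ) = ((m + 1 : ℕ) : ℂ) by push_cast; ring, Complex.norm_natCast]
        push_cast; ring
      simp [abs_of_pos ht, abs_of_nonneg hz0, hk1, this, h', mul_assoc]
    rw [norm_div, norm_pow, h1, hnorm, sq_abs]

theorem intervalIntegrable_exp_heatPhase (n : ℕ) (k x t a b : ℝ) :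
    IntervalIntegrable (fun z => Complex.exp (heatPhase n k x t z)) volume a b := by
  refine Continuous.intervalIntegrable ?_ a b
  unfold heatPhase; fun_prop

/-- The phase has derivative `iκD` with `D(z) = κx + t n z^(n-1)` increasing. With `l = t^(1/n)`,
the first-derivative test gives `3/l` on each of the two intervals where `|D| ≥ l`. The interval
between them has length at most `1/l` and an integrand of modulus at most one; hence `7 = 3 + 1 +
3`. -/
theorem norm_integral_heatPhase_le_of_odd {m : ℕ} {k : ℝ} (hk : IsHeatCoeff (m + 2) k)
    (hn : Odd (m + 2)) (x : ℝ) {t b : ℝ} (ht : 0 < t) (hb : 0 ≤ b) :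
    ‖∫ z in (0 : ℝ)..b, Complex.exp (heatPhase (m + 2) k x t z)‖ ≤
      7 * t ^ (-(1 / ((m + 2 : ℕ) : ℝ))) := by
  obtain ⟨κ, hκ, hkκ⟩ := hk.exists_of_odd hn
  set N : ℝ := ((m + 2 : ℕ) : ℝ) with hN
  have hN' : N = m + 2 := by rw [hN]; push_cast; ring
  set l : ℝ := t ^ (1 / N) with hl
  have hl0 : 0 < l := Real.rpow_pos_of_pos ht _
  have hli : t ^ (-(1 / N)) = 1 / l := by rw [Real.rpow_neg ht.le, one_div l]
  set T : ℝ := t * (m + 2) with hT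
  have hT0 : 0 < T := by positivity
  have hm : (m + 1 : ℝ) ≠ 0 := by positivity
  have root : ∀ y : ℝ, 0 ≤ y → (y ^ (1 / (m + 1 : ℝ))) ^ (m + 1) = y := fun y hy => by
    rw [← Real.rpow_natCast, ← Real.rpow_mul hy]; push_cast; field_simp; simp
  -- `c` and `d` solve `D = -l` and `D = l`, and are set to `0` when the solution would be negative.
  set c : ℝ := (max 0 ((-(κ * x) - l) / T)) ^ (1 / (m + 1 : ℝ)) with hc
  set d : ℝ := (max 0 ((-(κ * x) + l) / T)) ^ (1 / (m + 1 : ℝ)) with hd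
  have hc0 : 0 ≤ c := Real.rpow_nonneg (le_max_left _ _) _
  have hcd : c ≤ d := by
    refine Real.rpow_le_rpow (le_max_left _ _) (max_le_max le_rfl ?_) (by positivity)
    gcongr; linarith
  have hcp : c ^ (m + 1) = max 0 ((-(κ * x) - l) / T) := root _ (le_max_left _ _)
  have hdp : d ^ (m + 1) = max 0 ((-(κ * x) + l) / T) := root _ (le_max_left _ _)
  have hlen : d - c ≤ 1 / l := by
    -- Superadditivity of powers: `(d-c)^(m+1) ≤ d^(m+1) - c^(m+1)`. Since `T = (m+2) l^(m+2)` and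
    -- `m + 2 ≥ 2`, the bound `2l/T` is at most `l^(-(m+1))`.
    have h1 : (d - c) ^ (m + 1) ≤ 2 * l / T := by
      have h2 : c ^ (m + 1) + (d - c) ^ (m + 1) ≤ d ^ (m + 1) := by
        have := pow_add_pow_le hc0 (sub_nonneg.2 hcd) (Nat.succ_ne_zero m)
        simpa using this
      rw [hcp, hdp] at h2
      have h3 : max 0 ((-(κ * x) + l) / T) ≤ max 0 ((-(κ * x) - l) / T) + 2 * l / T := by
        refine max_le ?_ ?_
        · have := le_max_left 0 ((-(κ * x) - l) / T); positivity
        · have := le_max_right 0 ((-(κ * x) - l) / T)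
          have e : (-(κ * x) + l) / T = (-(κ * x) - l) / T + 2 * l / T := by ring
          linarith
      linarith
    have h4 : 2 * l / T ≤ (1 / l) ^ (m + 1) := by
      have e1 : l ^ (m + 2) = t := by
        rw [hl, ← Real.rpow_natCast, ← Real.rpow_mul ht.le, ← hN]
        rw [one_div_mul_cancel (by rw [hN']; positivity), Real.rpow_one]
      rw [div_le_iff₀ hT0, one_div, inv_pow, inv_mul_eq_div, le_div_iff₀ (by positivity), hT, ← e1]
      have : (0 : ℝ) ≤ m := Nat.cast_nonneg m
      have h5 : 0 < l ^ (m + 2) := by positivity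
      calc 2 * l * l ^ (m + 1) = l ^ (m + 2) * 2 := by ring
        _ ≤ _ := by gcongr; linarith
    exact le_of_pow_le_pow_left₀ (Nat.succ_ne_zero m) (by positivity) (h1.trans h4)
  have I := intervalIntegrable_exp_heatPhase (m + 2) k x t
  have split : ∫ z in (0 : ℝ)..b, Complex.exp (heatPhase (m + 2) k x t z) =
      (∫ z in (0 : ℝ)..min c b, Complex.exp (heatPhase (m + 2) k x t z)) +
      (∫ z in (min c b)..(min d b), Complex.exp (heatPhase (m + 2) k x t z)) +
      ∫ z in (min d b)..b, Complex.exp (heatPhase (m + 2) k x t z) := by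
    rw [intervalIntegral.integral_add_adjacent_intervals (I _ _) (I _ _),
      intervalIntegral.integral_add_adjacent_intervals (I _ _) (I _ _)]
  have b1 : ‖∫ z in (0 : ℝ)..min c b, Complex.exp (heatPhase (m + 2) k x t z)‖ ≤ 3 / l := by
    rcases hc0.eq_or_lt with h0 | h0
    · rw [← h0, min_eq_left hb, intervalIntegral.integral_same, norm_zero]; positivity
    · refine norm_integral_heatPhase_le_of_le_abs hk hκ hkκ ht hl0 le_rfl (le_min hc0 hb)
        (Or.inr fun z hz => ?_)
      have h1 : z ^ (m + 1) ≤ c ^ (m + 1) :=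
        pow_le_pow_left₀ hz.1 (hz.2.trans (min_le_left _ _)) _
      have h2 : 0 < c ^ (m + 1) := by positivity
      rw [hcp] at h1 h2
      have h3 : max 0 ((-(κ * x) - l) / T) = (-(κ * x) - l) / T :=
        max_eq_right (not_lt.1 fun h => by rw [max_eq_left h.le] at h2; exact lt_irrefl _ h2)
      rw [h3, le_div_iff₀ hT0] at h1
      linarith
  have b2 : ‖∫ z in (min c b)..(min d b), Complex.exp (heatPhase (m + 2) k x t z)‖ ≤ 1 / l := by
    have h1 := intervalIntegral.norm_integral_le_of_norm_le_const (a := min c b) (b := min d b)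
      (f := fun z => Complex.exp (heatPhase (m + 2) k x t z)) (C := 1)
      (fun z _ => norm_exp_heatPhase_le hk x ht.le z)
    refine h1.trans ?_
    rw [one_mul, abs_of_nonneg (sub_nonneg.2 (min_le_min_right b hcd))]
    refine le_trans ?_ hlen
    rcases le_total c b with h | h
    · rw [min_eq_left h]; linarith [min_le_left d b]
    · rw [min_eq_right h]; linarith [min_le_right d b]
  have b3 : ‖∫ z in (min d b)..b, Complex.exp (heatPhase (m + 2) k x t z)‖ ≤ 3 / l := by
    rcases le_total b d with h | h
    · rw [min_eq_right h, intervalIntegral.integral_same, norm_zero]; positivity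
    · rw [min_eq_left h]
      refine norm_integral_heatPhase_le_of_le_abs hk hκ hkκ ht hl0 (hc0.trans hcd) h
        (Or.inl fun z hz => ?_)
      have h1 : d ^ (m + 1) ≤ z ^ (m + 1) := pow_le_pow_left₀ (hc0.trans hcd) hz.1 _
      rw [hdp] at h1
      have h3 := (le_max_right 0 ((-(κ * x) + l) / T)).trans h1
      rw [div_le_iff₀ hT0] at h3
      linarith
  rw [split, hli]
  refine (norm_add₃_le).trans ?_
  have : 7 * (1 / l) = 3 / l + 1 / l + 3 / l := by ring
  linarith

/-- No cancellation is needed: the integrand has modulus `exp(-t z^n)`. -/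
theorem norm_integral_heatPhase_le_of_even {n : ℕ} (hn0 : 0 < n) {k : ℝ} (hk : IsHeatCoeff n k)
    (hn : Even n) (x : ℝ) {t b : ℝ} (ht : 0 < t) (hb : 0 ≤ b) :
    ‖∫ z in (0 : ℝ)..b, Complex.exp (heatPhase n k x t z)‖ ≤
      Real.Gamma (1 / (n : ℝ) + 1) * t ^ (-(1 / (n : ℝ))) := by
  have hn0' : (0 : ℝ) < n := by exact_mod_cast hn0
  have hnorm : ∀ z : ℝ, ‖Complex.exp (heatPhase n k x t z)‖ = Real.exp (-t * z ^ (n : ℝ)) := by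
    intro z
    have h : heatPhase n k x t z = ((x * z : ℝ) : ℂ) * Complex.I + ((-t * z ^ n : ℝ) : ℂ) := by
      rw [heatPhase, mul_pow]; push_cast
      linear_combination (t * (z : ℂ) ^ n) * hk.of_even hn
    rw [Complex.norm_exp, h, Complex.add_re, Complex.re_ofReal_mul, Real.rpow_natCast]
    simp only [Complex.I_re, mul_zero, zero_add, Complex.ofReal_re]
  have hint : IntegrableOn (fun z : ℝ => Real.exp (-t * z ^ (n : ℝ))) (Set.Ioi 0) := by
    have := integrableOn_rpow_mul_exp_neg_mul_rpow (s := 0) (p := n) (b := t) (by norm_num)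
      hn0' ht
    simpa using this
  have hI := integral_exp_neg_mul_rpow (p := n) (b := t) hn0' ht
  calc _ ≤ ∫ z in (0 : ℝ)..b, ‖Complex.exp (heatPhase n k x t z)‖ :=
        intervalIntegral.norm_integral_le_integral_norm hb
    _ = ∫ z in Set.Ioc 0 b, Real.exp (-t * z ^ (n : ℝ)) := by
        rw [intervalIntegral.integral_of_le hb]; simp only [hnorm]
    _ ≤ ∫ z in Set.Ioi 0, Real.exp (-t * z ^ (n : ℝ)) :=
        setIntegral_mono_set hint (ae_of_all _ fun z => (Real.exp_pos _).le)
          (Set.Ioc_subset_Ioi_self.eventuallyLE)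
    _ = _ := by rw [hI]; rw [mul_comm]; congr 2; ring

/-- The integral over a half-line is bounded by `C t^(-1/n)`, uniformly in `x`. -/
theorem exists_norm_integral_heatPhase_le {n : ℕ} (hn : 2 ≤ n) :
    ∃ C : ℝ, 0 ≤ C ∧ ∀ k, IsHeatCoeff n k → ∀ x t b : ℝ, 0 < t → 0 ≤ b →
      ‖∫ z in (0 : ℝ)..b, Complex.exp (heatPhase n k x t z)‖ ≤ C * t ^ (-(1 / (n : ℝ))) := by
  obtain ⟨m, rfl⟩ := Nat.exists_eq_add_of_le' hn
  rcases Nat.even_or_odd (m + 2) with h | h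
  · exact ⟨_, (Real.Gamma_pos_of_pos (by positivity)).le, fun k hk x t b ht hb =>
      norm_integral_heatPhase_le_of_even (by omega) hk h x ht hb⟩
  · exact ⟨7, by norm_num, fun k hk x t b ht hb => norm_integral_heatPhase_le_of_odd hk h x ht hb⟩

/-! ### The heat kernel as an improper integral. -/

theorem integral_heatPhase_neg (n : ℕ) (k x t a b : ℝ) :
    ∫ z in (-b)..(-a), Complex.exp (heatPhase n k x t z) =
      ∫ z in a..b, Complex.exp (heatPhase n ((-1) ^ n * k) (-x) t z) := by
  rw [← intervalIntegral.integral_comp_neg]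
  congr 1; ext z
  congr 1
  simp only [heatPhase]; push_cast
  rw [show Complex.I * -(z : ℂ) = (-1) * (Complex.I * z) by ring, mul_pow (-1 : ℂ)]
  ring

/-- `∫_0^∞ exp (i x z + k t (i z)ⁿ) dz`, as an improper integral. -/
noncomputable def halfHeatKernel (n : ℕ) (k x t : ℝ) : ℂ :=
  limUnder atTop fun b : ℝ => ∫ z in (0 : ℝ)..b, Complex.exp (heatPhase n k x t z)

theorem heatKernelTrunc_eq (n : ℕ) (k x t a b : ℝ) :
    heatKernelTrunc n k x t a b = (1 / (2 * Real.pi) : ℂ) *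
      ((∫ z in (0 : ℝ)..b, Complex.exp (heatPhase n k x t z)) +
        ∫ z in (0 : ℝ)..(-a), Complex.exp (heatPhase n ((-1) ^ n * k) (-x) t z)) := by
  rw [← integral_heatPhase_neg, neg_neg, neg_zero, add_comm,
    intervalIntegral.integral_add_adjacent_intervals (intervalIntegrable_exp_heatPhase ..)
      (intervalIntegrable_exp_heatPhase ..)]
  rfl

theorem tendsto_heatPhase_tail {m : ℕ} {t : ℝ} (ht : 0 < t) :
    Tendsto (fun R : ℝ => t * (m + 2) * R ^ (m + 1)) atTop atTop :=
  (tendsto_pow_atTop (Nat.succ_ne_zero m)).const_mul_atTop (by positivity)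

theorem tendsto_halfHeatKernel {n : ℕ} (hn : 2 ≤ n) {k : ℝ} (hk : IsHeatCoeff n k) (x : ℝ) {t : ℝ}
    (ht : 0 < t) :
    Tendsto (fun b : ℝ => ∫ z in (0 : ℝ)..b, Complex.exp (heatPhase n k x t z)) atTop
      (𝓝 (halfHeatKernel n k x t)) := by
  obtain ⟨m, rfl⟩ := Nat.exists_eq_add_of_le' hn
  refine tendsto_nhds_limUnder (cauchy_map_iff_exists_tendsto.1 ?_)
  refine Metric.cauchy_iff.2 ⟨inferInstance, fun ε hε => ?_⟩
  have h1 := (tendsto_heatPhase_tail (m := m) ht).eventually_ge_atTop (2 * |x|)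
  have h2 : ∀ᶠ R : ℝ in atTop, 8 / (t * (m + 2) * R ^ (m + 1)) < ε / 2 :=
    ((tendsto_heatPhase_tail (m := m) ht).const_div_atTop 8).eventually (gt_mem_nhds (half_pos hε))
  obtain ⟨R, ⟨h1, h2⟩, hR⟩ := ((h1.and h2).and (eventually_gt_atTop 0)).exists
  refine ⟨_, image_mem_map (Ici_mem_atTop R), ?_⟩
  rintro _ ⟨b, hb, rfl⟩ _ ⟨c, hc, rfl⟩
  have key : ∀ b, R ≤ b → ‖(∫ z in (0 : ℝ)..b, Complex.exp (heatPhase (m + 2) k x t z)) -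
      ∫ z in (0 : ℝ)..R, Complex.exp (heatPhase (m + 2) k x t z)‖ < ε / 2 := fun b hb => by
    rw [intervalIntegral.integral_interval_sub_left (intervalIntegrable_exp_heatPhase ..)
      (intervalIntegrable_exp_heatPhase ..)]
    exact (norm_integral_heatPhase_tail_le hk ht hR h1 le_rfl hb).trans_lt h2
  have e1 := key b hb
  have e2 := key c hc
  rw [← dist_eq_norm] at e1 e2
  linarith [dist_triangle_right (∫ z in (0 : ℝ)..b, Complex.exp (heatPhase (m + 2) k x t z))
    (∫ z in (0 : ℝ)..c, Complex.exp (heatPhase (m + 2) k x t z))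
    (∫ z in (0 : ℝ)..R, Complex.exp (heatPhase (m + 2) k x t z))]

theorem tendsto_heatKernelTrunc_halfHeatKernel {n : ℕ} (hn : 2 ≤ n) {k : ℝ} (hk : IsHeatCoeff n k)
    (x : ℝ) {t : ℝ} (ht : 0 < t) :
    Tendsto (fun R : ℝ × ℝ => heatKernelTrunc n k x t R.1 R.2) (atBot ×ˢ atTop)
      (𝓝 ((1 / (2 * Real.pi) : ℂ) *
        (halfHeatKernel n k x t + halfHeatKernel n ((-1) ^ n * k) (-x) t))) := by
  simp only [heatKernelTrunc_eq]
  refine Tendsto.const_mul _ (Tendsto.add ?_ ?_)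
  · exact (tendsto_halfHeatKernel hn hk x ht).comp tendsto_snd
  · exact (tendsto_halfHeatKernel hn hk.neg (-x) ht).comp
      (tendsto_neg_atBot_atTop.comp tendsto_fst)

theorem tendsto_heatKernelTrunc {n : ℕ} (hn : 2 ≤ n) {k : ℝ} (hk : IsHeatCoeff n k)
    (x : ℝ) {t : ℝ} (ht : 0 < t) :
    Tendsto (fun R : ℝ × ℝ => heatKernelTrunc n k x t R.1 R.2) (atBot ×ˢ atTop)
      (𝓝 (heatKernel n k x t)) :=
  tendsto_nhds_limUnder ⟨_, tendsto_heatKernelTrunc_halfHeatKernel hn hk x ht⟩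

theorem heatKernel_eq_halfHeatKernel {n : ℕ} (hn : 2 ≤ n) {k : ℝ} (hk : IsHeatCoeff n k)
    (x : ℝ) {t : ℝ} (ht : 0 < t) :
    heatKernel n k x t = (1 / (2 * Real.pi) : ℂ) *
        (halfHeatKernel n k x t + halfHeatKernel n ((-1) ^ n * k) (-x) t) :=
  tendsto_nhds_unique (tendsto_heatKernelTrunc hn hk x ht)
    (tendsto_heatKernelTrunc_halfHeatKernel hn hk x ht)

theorem tendsto_heatKernelTrunc_nat {n : ℕ} (hn : 2 ≤ n) {k : ℝ} (hk : IsHeatCoeff n k)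
    (x : ℝ) {t : ℝ} (ht : 0 < t) :
    Tendsto (fun N : ℕ => heatKernelTrunc n k x t (-N) N) atTop (𝓝 (heatKernel n k x t)) := by
  have h1 : Tendsto (fun N : ℕ => (N : ℝ)) atTop atTop := tendsto_natCast_atTop_atTop
  have h2 : Tendsto (fun N : ℕ => ((-N : ℝ), (N : ℝ))) atTop (atBot ×ˢ atTop) :=
    (tendsto_neg_atTop_atBot.comp h1).prodMk h1
  have h3 := (tendsto_heatKernelTrunc hn hk x ht).comp h2
  simpa only [Function.comp_def] using h3

/-- For large `R` the tail bound holds simultaneously for all points of a unit ball, so the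
truncations converge locally uniformly. Domination is not available for odd `n`, where the integrand
has modulus one. -/
theorem continuous_halfHeatKernel {n : ℕ} (hn : 2 ≤ n) {k : ℝ} (hk : IsHeatCoeff n k) {t : ℝ}
    (ht : 0 < t) : Continuous fun x => halfHeatKernel n k x t := by
  obtain ⟨m, rfl⟩ := Nat.exists_eq_add_of_le' hn
  have hu : TendstoLocallyUniformly
      (fun (b : ℝ) x => ∫ z in (0 : ℝ)..b, Complex.exp (heatPhase (m + 2) k x t z))
      (fun x => halfHeatKernel (m + 2) k x t) atTop := by
    refine Metric.tendstoLocallyUniformly_iff.2 fun ε hε x => ?_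
    refine ⟨Metric.ball x 1, Metric.ball_mem_nhds _ one_pos, ?_⟩
    have h1 := (tendsto_heatPhase_tail (m := m) ht).eventually_ge_atTop (2 * (|x| + 1))
    have h2 : ∀ᶠ R : ℝ in atTop, 8 / (t * (m + 2) * R ^ (m + 1)) < ε :=
      ((tendsto_heatPhase_tail (m := m) ht).const_div_atTop 8).eventually (gt_mem_nhds hε)
    filter_upwards [h1, h2, eventually_gt_atTop 0] with R h1 h2 hR y hy
    have hy' : 2 * |y| ≤ t * (m + 2) * R ^ (m + 1) := by
      have : |y| - |x| ≤ |y - x| := abs_sub_abs_le_abs_sub _ _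
      rw [Metric.mem_ball, Real.dist_eq] at hy
      linarith
    refine lt_of_le_of_lt ?_ h2
    have hlim := ((tendsto_halfHeatKernel hn hk y ht).sub_const
      (∫ z in (0 : ℝ)..R, Complex.exp (heatPhase (m + 2) k y t z))).norm
    rw [dist_eq_norm]
    refine le_of_tendsto hlim ((eventually_ge_atTop R).mono fun b hb => ?_)
    rw [intervalIntegral.integral_interval_sub_left (intervalIntegrable_exp_heatPhase ..)
      (intervalIntegrable_exp_heatPhase ..)]
    exact norm_integral_heatPhase_tail_le hk ht hR hy' le_rfl hb
  refine hu.continuous (Frequently.of_forall fun b => ?_)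
  refine intervalIntegral.continuous_parametric_intervalIntegral_of_continuous' ?_ _ _
  simp only [Function.uncurry_def, heatPhase]; fun_prop

theorem continuous_heatKernel {n : ℕ} (hn : 2 ≤ n) {k : ℝ} (hk : IsHeatCoeff n k) {t : ℝ}
    (ht : 0 < t) : Continuous fun x => heatKernel n k x t := by
  simp only [heatKernel_eq_halfHeatKernel hn hk _ ht]
  exact continuous_const.mul ((continuous_halfHeatKernel hn hk ht).add
    ((continuous_halfHeatKernel hn hk.neg ht).comp continuous_neg))

/-- The bound on truncations serves dominated convergence in `x`; the bound on the limit serves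
integrability in `u`. -/
theorem exists_norm_heatKernelTrunc_le {n : ℕ} (hn : 2 ≤ n) {k : ℝ} (hk : IsHeatCoeff n k) :
    ∃ C : ℝ, 0 ≤ C ∧ (∀ x t a b : ℝ, 0 < t → a ≤ 0 → 0 ≤ b →
      ‖heatKernelTrunc n k x t a b‖ ≤ C * t ^ (-(1 / (n : ℝ)))) ∧
      ∀ x t : ℝ, 0 < t → ‖heatKernel n k x t‖ ≤ C * t ^ (-(1 / (n : ℝ))) := by
  obtain ⟨C, hC, h⟩ := exists_norm_integral_heatPhase_le hn
  have key : ∀ x t a b : ℝ, 0 < t → a ≤ 0 → 0 ≤ b →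
      ‖heatKernelTrunc n k x t a b‖ ≤ 2 * C * t ^ (-(1 / (n : ℝ))) := by
    intro x t a b ht ha hb
    have h1 := h k hk x t b ht hb
    have h2 := h _ hk.neg (-x) t (-a) ht (by linarith)
    have h3 : ‖(1 / (2 * Real.pi) : ℂ)‖ ≤ 1 := by
      rw [show (1 / (2 * Real.pi) : ℂ) = ((1 / (2 * Real.pi) : ℝ) : ℂ) by push_cast; ring,
        Complex.norm_real, Real.norm_of_nonneg (by positivity), div_le_one (by positivity)]
      linarith [Real.pi_gt_three]
    rw [heatKernelTrunc_eq, norm_mul]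
    refine (mul_le_of_le_one_left (norm_nonneg _) h3).trans ((norm_add_le _ _).trans ?_)
    linarith
  refine ⟨2 * C, by positivity, key, fun x t ht => ?_⟩
  exact le_of_tendsto (tendsto_heatKernelTrunc_nat hn hk x ht).norm
    (Eventually.of_forall fun N => key x t _ _ ht (by simp) (by simp))

theorem continuous_heatKernelTrunc (n : ℕ) (k a b : ℝ) :
    Continuous fun p : ℝ × ℝ => heatKernelTrunc n k p.1 p.2 a b := by
  refine continuous_const.mul ?_
  refine intervalIntegral.continuous_parametric_intervalIntegral_of_continuous' ?_ _ _
  simp only [Function.uncurry_def]; fun_prop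

theorem aestronglyMeasurable_heatKernel {n : ℕ} (hn : 2 ≤ n) {k : ℝ} (hk : IsHeatCoeff n k)
    (μ : Measure ℝ) [SFinite μ] :
    AEStronglyMeasurable (fun p : ℝ × ℝ => heatKernel n k p.1 p.2)
      (μ.prod (volume.restrict (Set.Ioi 0))) := by
  refine aestronglyMeasurable_of_tendsto_ae atTop
    (f := fun (N : ℕ) (p : ℝ × ℝ) => heatKernelTrunc n k p.1 p.2 (-N) N)
    (fun N => (continuous_heatKernelTrunc n k _ _).aestronglyMeasurable) ?_
  have : ∀ᵐ p : ℝ × ℝ ∂(μ.prod (volume.restrict (Set.Ioi 0))), 0 < p.2 :=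
    Measure.quasiMeasurePreserving_snd.ae (ae_restrict_mem measurableSet_Ioi)
  filter_upwards [this] with p hp
  exact tendsto_heatKernelTrunc_nat hn hk p.1 hp

theorem aestronglyMeasurable_heatKernel_right {n : ℕ} (hn : 2 ≤ n) {k : ℝ} (hk : IsHeatCoeff n k)
    (x : ℝ) :
    AEStronglyMeasurable (fun u : ℝ => heatKernel n k x u) (volume.restrict (Set.Ioi 0)) := by
  refine aestronglyMeasurable_of_tendsto_ae atTop
    (f := fun (N : ℕ) (u : ℝ) => heatKernelTrunc n k x u (-N) N)
    (fun N => ((continuous_heatKernelTrunc n k _ _).comp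
      (by fun_prop : Continuous fun u : ℝ => (x, u))).aestronglyMeasurable) ?_
  filter_upwards [ae_restrict_mem measurableSet_Ioi] with u hu
  exact tendsto_heatKernelTrunc_nat hn hk x hu

/-- The Fourier transform `∫ exp (i x z) φ(x) dx`. -/
noncomputable def fourierPlus (φ : ℝ → ℂ) (z : ℝ) : ℂ :=
  ∫ x : ℝ, Complex.exp (Complex.I * x * z) * φ x

theorem fourierPlus_eq (φ : ℝ → ℂ) (z : ℝ) :
    fourierPlus φ z = FourierTransform.fourier φ (-(z / (2 * Real.pi))) := by
  rw [Real.fourier_real_eq_integral_exp_smul]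
  refine integral_congr_ae (ae_of_all _ fun x => ?_)
  simp only [smul_eq_mul]
  congr 2
  push_cast
  have : (Real.pi : ℂ) ≠ 0 := by exact_mod_cast Real.pi_ne_zero
  field_simp

/-- Fubini is applied on `ℝ × (-N, N]`, where `|φ|` is an integrable majorant. Then `N → ∞`: on the
left by the uniform bound on truncations, on the right by integrability of the transform. -/
theorem integral_heatKernel_mul {n : ℕ} (hn : 2 ≤ n) {k : ℝ} (hk : IsHeatCoeff n k) {φ : ℝ → ℂ}
    (hφ : Integrable φ) (hφ' : Integrable (fourierPlus φ)) {u : ℝ} (hu : 0 < u) :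
    ∫ x, heatKernel n k x u * φ x = (1 / (2 * Real.pi) : ℂ) *
      ∫ z : ℝ, Complex.exp (k * u * (Complex.I * z) ^ n) * fourierPlus φ z := by
  obtain ⟨C, hC, hb, -⟩ := exists_norm_heatKernelTrunc_le hn hk
  have lim1 : Tendsto (fun N : ℕ => ∫ x, heatKernelTrunc n k x u (-N) N * φ x) atTop
      (𝓝 (∫ x, heatKernel n k x u * φ x)) := by
    refine tendsto_integral_of_dominated_convergence
      (fun x => C * u ^ (-(1 / (n : ℝ))) * ‖φ x‖) (fun N => ?_) (hφ.norm.const_mul _)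
      (fun N => ae_of_all _ fun x => ?_) (ae_of_all _ fun x => ?_)
    · exact ((continuous_heatKernelTrunc n k _ _).comp
        (by fun_prop : Continuous fun x : ℝ => (x, u))).aestronglyMeasurable.mul
        hφ.aestronglyMeasurable
    · rw [norm_mul]
      gcongr
      exact hb x u _ _ hu (by simp) (by simp)
    · exact (tendsto_heatKernelTrunc_nat hn hk x hu).mul_const _
  have hE : ∀ z : ℝ, ‖Complex.exp (k * u * (Complex.I * z) ^ n)‖ ≤ 1 := fun z => by
    simpa [heatPhase] using norm_exp_heatPhase_le hk 0 hu.le z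
  have hint : Integrable fun z : ℝ =>
      Complex.exp (k * u * (Complex.I * z) ^ n) * fourierPlus φ z := by
    refine hφ'.bdd_mul (c := 1) ?_ (ae_of_all _ hE)
    exact Continuous.aestronglyMeasurable (by fun_prop)
  have eq : ∀ N : ℕ, ∫ x, heatKernelTrunc n k x u (-N) N * φ x = (1 / (2 * Real.pi) : ℂ) *
      ∫ z in (-N : ℝ)..N, Complex.exp (k * u * (Complex.I * z) ^ n) * fourierPlus φ z := by
    intro N
    have hle : (-N : ℝ) ≤ N := by linarith [Nat.cast_nonneg (α := ℝ) N]
    simp only [heatKernelTrunc, mul_assoc (1 / (2 * Real.pi) : ℂ)]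
    rw [integral_const_mul]
    congr 1
    simp only [intervalIntegral.integral_of_le hle, fourierPlus, ← integral_const_mul,
      ← integral_mul_const]
    rw [integral_integral_swap]
    · refine integral_congr_ae (ae_of_all _ fun z => integral_congr_ae (ae_of_all _ fun x => ?_))
      simp only [Complex.exp_add]; ring
    · have h1 : Integrable (fun p : ℝ × ℝ => φ p.1 * 1)
          (volume.prod (volume.restrict (Set.Ioc (-N : ℝ) N))) :=
        hφ.mul_prod (g := fun _ : ℝ => (1 : ℂ)) (integrable_const _)
      have h2 : Integrable (fun p : ℝ × ℝ => Complex.exp (heatPhase n k p.1 u p.2) * (φ p.1 * 1))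
          (volume.prod (volume.restrict (Set.Ioc (-N : ℝ) N))) :=
        h1.bdd_mul (c := 1) (Continuous.aestronglyMeasurable (by unfold heatPhase; fun_prop))
          (ae_of_all _ fun p => norm_exp_heatPhase_le hk _ hu.le _)
      refine h2.congr (ae_of_all _ fun p => ?_)
      simp [Function.uncurry_def, heatPhase]
  simp only [eq] at lim1
  refine tendsto_nhds_unique lim1 (Tendsto.const_mul _ ?_)
  exact intervalIntegral_tendsto_integral hint
    (tendsto_neg_atTop_atBot.comp tendsto_natCast_atTop_atTop) tendsto_natCast_atTop_atTop

/-! ### One-sided stable laws -/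

theorem Ring.choose_succ_eq_mul (a : ℝ) (k : ℕ) :
    Ring.choose a (k + 1) = Ring.choose a k * ((a - k) / (k + 1)) := by
  rw [Ring.choose_eq_smul, Ring.choose_eq_smul, descPochhammer_succ_right, Polynomial.smeval_mul,
    Polynomial.smeval_sub, Polynomial.smeval_X, Polynomial.smeval_natCast, Nat.factorial_succ]
  simp only [smul_eq_mul, pow_one, pow_zero, nsmul_eq_mul, mul_one]
  push_cast
  have h : (k.factorial : ℝ) ≠ 0 := by positivity
  field_simp

/-- The weights of the Sibuya distribution: `1 - (1 - w)^α = ∑ sibuya α k * w^k`. -/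
noncomputable def sibuya (α : ℝ) (k : ℕ) : ℝ :=
  if k = 0 then 0 else (-1) ^ (k + 1) * Ring.choose α k

/-- The weight at `1` is `α`, and the ratio of the weights at `j + 1` and `j` is `(j - α)/(j + 1)`
for `j ≥ 1`. -/
theorem sibuya_nonneg {α : ℝ} (h0 : 0 < α) (h1 : α < 1) (k : ℕ) : 0 ≤ sibuya α k := by
  rcases k with _ | k
  · simp [sibuya]
  · induction k with
    | zero => simp [sibuya, h0.le]
    | succ k ih =>
      have h : sibuya α (k + 1 + 1) = sibuya α (k + 1) * ((k + 1 - α) / (k + 2)) := by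
        simp only [sibuya, Nat.succ_ne_zero, if_false]
        rw [Ring.choose_succ_eq_mul α (k + 1)]
        push_cast
        ring
      rw [h]
      have : (0 : ℝ) ≤ k := Nat.cast_nonneg k
      exact mul_nonneg ih (div_nonneg (by linarith) (by linarith))

theorem hasSum_sibuya_of_norm_lt {α : ℝ} {w : ℂ} (hw : ‖w‖ < 1) :
    HasSum (fun k => (sibuya α k : ℂ) * w ^ k) (1 - (1 - w) ^ (α : ℂ)) := by
  have h := (Complex.one_add_cpow_hasFPowerSeriesOnBall_zero (a := (α : ℂ))).hasSum (y := -w)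
    (by simpa [enorm_eq_nnnorm, ← NNReal.coe_lt_coe] using hw)
  simp only [zero_add, binomialSeries_apply, List.ofFn_const, List.prod_replicate,
    smul_eq_mul] at h
  have h1 : HasSum (fun k : ℕ => if k = 0 then (1 : ℂ) else 0) 1 := by
    simpa using hasSum_ite_eq (0 : ℕ) (1 : ℂ)
  rw [← sub_eq_add_neg] at h
  refine (h1.sub h).congr_fun fun k => ?_
  have hc : Ring.choose (α : ℂ) k = ((Ring.choose α k : ℝ) : ℂ) :=
    (Ring.map_choose Complex.ofRealHom α k).symm
  rcases k with _ | k
  · simp [sibuya]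
  · rw [hc]
    simp only [sibuya, Nat.succ_ne_zero, if_false]
    rw [neg_pow w]
    push_cast
    ring

/-- For `0 ≤ r < 1` a partial sum at `r` is at most `1 - (1-r)^α ≤ 1`; let `r → 1` in the finite
sum. -/
theorem summable_sibuya {α : ℝ} (h0 : 0 < α) (h1 : α < 1) : Summable (sibuya α) := by
  refine summable_of_sum_range_le (c := 1) (sibuya_nonneg h0 h1) fun K => ?_
  have hr : ∀ r : ℝ, 0 ≤ r → r < 1 → ∑ k ∈ Finset.range K, sibuya α k * r ^ k ≤ 1 := by
    intro r hr0 hr1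
    have h := hasSum_sibuya_of_norm_lt (α := α) (w := r)
      (by rwa [Complex.norm_real, Real.norm_of_nonneg hr0])
    have h2 : HasSum (fun k => sibuya α k * r ^ k) (1 - (1 - r) ^ α) := by
      rw [← Complex.hasSum_ofReal]
      convert h using 1
      · simp
      · rw [Complex.ofReal_sub, Complex.ofReal_cpow (by linarith)]; simp
    refine (sum_le_hasSum _ (fun k _ => mul_nonneg (sibuya_nonneg h0 h1 k) (by positivity))
      h2).trans ?_
    linarith [Real.rpow_nonneg (by linarith : 0 ≤ 1 - r) α]
  have hcont : Tendsto (fun r : ℝ => ∑ k ∈ Finset.range K, sibuya α k * r ^ k) (𝓝[<] 1)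
      (𝓝 (∑ k ∈ Finset.range K, sibuya α k * 1 ^ k)) :=
    (Continuous.tendsto (by fun_prop) 1).mono_left nhdsWithin_le_nhds
  simp only [one_pow, mul_one] at hcont
  refine le_of_tendsto hcont ?_
  filter_upwards [Ioo_mem_nhdsLT (zero_lt_one' ℝ)] with r hr'
  exact hr r hr'.1.le hr'.2

/-- Abel's limit along `r w`, `r → 1`. The boundary circle is essential: `w = e^(-zh)` lies on it
for imaginary `z`, the case of characteristic functions. -/
theorem hasSum_sibuya {α : ℝ} (h0 : 0 < α) (h1 : α < 1) {w : ℂ} (hw : ‖w‖ ≤ 1) :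
    HasSum (fun k => (sibuya α k : ℂ) * w ^ k) (1 - (1 - w) ^ (α : ℂ)) := by
  have hs := summable_sibuya h0 h1
  have hb : ∀ r : ℝ, 0 ≤ r → r ≤ 1 → ∀ k, ‖(sibuya α k : ℂ) * (r * w) ^ k‖ ≤ sibuya α k := by
    intro r hr0 hr1 k
    rw [norm_mul, Complex.norm_real, Real.norm_of_nonneg (sibuya_nonneg h0 h1 k), norm_pow]
    refine mul_le_of_le_one_right (sibuya_nonneg h0 h1 k) (pow_le_one₀ (norm_nonneg _) ?_)
    rw [norm_mul, Complex.norm_real, Real.norm_of_nonneg hr0]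
    exact mul_le_one₀ hr1 (norm_nonneg _) hw
  have hsw : Summable (fun k => (sibuya α k : ℂ) * w ^ k) :=
    Summable.of_norm_bounded hs (by simpa using hb 1 zero_le_one le_rfl)
  have l1 : Tendsto (fun r : ℝ => ∑' k, (sibuya α k : ℂ) * (r * w) ^ k) (𝓝[<] 1)
      (𝓝 (∑' k, (sibuya α k : ℂ) * w ^ k)) := by
    refine tendsto_tsum_of_dominated_convergence hs (fun k => ?_) ?_
    · have : Continuous fun r : ℝ => (sibuya α k : ℂ) * (r * w) ^ k := by fun_prop
      have h := (this.tendsto 1).mono_left (nhdsWithin_le_nhds (s := Set.Iio 1))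
      simpa using h
    · filter_upwards [Ioo_mem_nhdsLT (zero_lt_one' ℝ)] with r hr
      exact hb r hr.1.le hr.2.le
  have l2 : Tendsto (fun r : ℝ => 1 - (1 - r * w) ^ (α : ℂ)) (𝓝[<] 1)
      (𝓝 (1 - (1 - w) ^ (α : ℂ))) := by
    refine tendsto_const_nhds.sub ?_
    have hc : ContinuousAt (fun x : ℂ => x ^ (α : ℂ)) (1 - w) :=
      Complex.continuousAt_cpow_const_of_re_pos (Or.inl (by
        have := Complex.re_le_norm w
        simp; linarith)) (by simpa)
    have h2 : Tendsto (fun r : ℝ => 1 - (r : ℂ) * w) (𝓝[<] 1) (𝓝 (1 - w)) := by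
      have : Continuous fun r : ℝ => 1 - (r : ℂ) * w := by fun_prop
      have h := (this.tendsto 1).mono_left (nhdsWithin_le_nhds (s := Set.Iio 1))
      simpa using h
    exact hc.tendsto.comp h2
  have heq : (fun r : ℝ => ∑' k, (sibuya α k : ℂ) * (r * w) ^ k) =ᶠ[𝓝[<] 1]
      fun r : ℝ => 1 - (1 - r * w) ^ (α : ℂ) := by
    filter_upwards [Ioo_mem_nhdsLT (zero_lt_one' ℝ)] with r hr
    refine (hasSum_sibuya_of_norm_lt ?_).tsum_eq
    rw [norm_mul, Complex.norm_real, Real.norm_of_nonneg hr.1.le]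
    calc r * ‖w‖ ≤ r * 1 := by gcongr; exact hr.1.le
      _ < 1 := by linarith [hr.2]
  rw [← tendsto_nhds_unique (l1.congr' heq) l2]
  exact hsw.hasSum

/-- `μ` is a probability measure on `[0, ∞)` whose Laplace transform on the closed right half-plane
is `L`. -/
structure HasLaplaceTransform (μ : Measure ℝ) (L : ℂ → ℂ) : Prop where
  isProbabilityMeasure : IsProbabilityMeasure μ
  nonneg : ∀ᵐ x ∂μ, 0 ≤ x
  integral_eq : ∀ z : ℂ, 0 ≤ z.re → ∫ x, Complex.exp (-(z * x)) ∂μ = L z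

theorem HasLaplaceTransform.conv {μ ν : Measure ℝ} {L K : ℂ → ℂ} (hμ : HasLaplaceTransform μ L)
    (hν : HasLaplaceTransform ν K) :
    HasLaplaceTransform (μ.conv ν) (fun z => L z * K z) := by
  have := hμ.isProbabilityMeasure
  have := hν.isProbabilityMeasure
  refine ⟨inferInstance, ?_, fun z hz => ?_⟩
  · rw [Measure.conv, ae_map_iff (by fun_prop) measurableSet_Ici]
    filter_upwards [Measure.quasiMeasurePreserving_fst.ae hμ.nonneg,
      Measure.quasiMeasurePreserving_snd.ae hν.nonneg] with p h1 h2
    exact add_nonneg h1 h2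
  · rw [Measure.conv, integral_map (by fun_prop) (Continuous.aestronglyMeasurable (by fun_prop)),
      ← hμ.integral_eq z hz, ← hν.integral_eq z hz, ← integral_prod_mul]
    refine integral_congr_ae (ae_of_all _ fun p => ?_)
    simp only
    rw [← Complex.exp_add]; push_cast; ring_nf

theorem exists_hasLaplaceTransform_pow {μ : Measure ℝ} {L : ℂ → ℂ} (hμ : HasLaplaceTransform μ L)
    (N : ℕ) : ∃ ν : Measure ℝ, HasLaplaceTransform ν fun z => L z ^ N := by
  induction N with
  | zero =>
    refine ⟨Measure.dirac 0, inferInstance, ?_, fun z _ => by simp⟩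
    rw [ae_dirac_iff measurableSet_Ici]
  | succ N ih =>
    obtain ⟨ν, hν⟩ := ih
    exact ⟨_, by simpa only [pow_succ] using hν.conv hμ⟩

theorem exists_hasLaplaceTransform_sibuya {α : ℝ} (h0 : 0 < α) (h1 : α < 1) {h : ℝ} (hh : 0 ≤ h) :
    ∃ μ : Measure ℝ, HasLaplaceTransform μ fun z => 1 - (1 - Complex.exp (-(z * h))) ^ (α : ℂ) := by
  have hsum : HasSum (sibuya α) 1 := by
    have h := hasSum_sibuya h0 h1 (w := 1) (by simp)
    simp only [one_pow, mul_one, sub_self] at h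
    rw [Complex.zero_cpow (by exact_mod_cast h0.ne'), sub_zero] at h
    rw [← Complex.hasSum_ofReal]
    simpa using h
  let p : PMF ℕ := ⟨fun k => ENNReal.ofReal (sibuya α k), by
    have := ENNReal.ofReal_tsum_of_nonneg (sibuya_nonneg h0 h1) hsum.summable
    rw [hsum.tsum_eq, ENNReal.ofReal_one] at this
    rw [this]
    exact ENNReal.summable.hasSum⟩
  refine ⟨p.toMeasure.map fun k : ℕ => (k : ℝ) * h,
    Measure.isProbabilityMeasure_map (by fun_prop), ?_, fun z hz => ?_⟩
  · rw [ae_map_iff (by fun_prop) measurableSet_Ici]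
    exact ae_of_all _ fun k => mul_nonneg (Nat.cast_nonneg k) hh
  · have hw : ‖Complex.exp (-(z * h))‖ ≤ 1 := by
      rw [Complex.norm_exp, Real.exp_le_one_iff, Complex.neg_re, Complex.re_mul_ofReal]
      nlinarith
    have he : ∀ k : ℕ, Complex.exp (-(z * ((k * h : ℝ) : ℂ))) = Complex.exp (-(z * h)) ^ k := by
      intro k
      rw [← Complex.exp_nat_mul]; push_cast; ring_nf
    rw [integral_map (by fun_prop) (Continuous.aestronglyMeasurable (by fun_prop))]
    simp only [he]
    rw [PMF.integral_eq_tsum, ← (hasSum_sibuya h0 h1 hw).tsum_eq]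
    · refine tsum_congr fun k => ?_
      rw [Complex.real_smul]
      congr 2
      exact ENNReal.toReal_ofReal (sibuya_nonneg h0 h1 k)
    · refine Integrable.of_bound (C := 1) (Measurable.aestronglyMeasurable (by fun_prop))
        (ae_of_all _ fun k => ?_)
      rw [norm_pow]
      exact pow_le_one₀ (norm_nonneg _) hw

theorem Complex.ofReal_mul_cpow {r : ℝ} (hr : 0 < r) (w : ℂ) {a : ℂ} (ha : a ≠ 0) :
    ((r : ℂ) * w) ^ a = (r : ℂ) ^ a * w ^ a := by
  rcases eq_or_ne w 0 with rfl | hw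
  · simp [Complex.zero_cpow ha]
  · have hr' : (r : ℂ) ≠ 0 := by exact_mod_cast hr.ne'
    rw [Complex.cpow_def_of_ne_zero (mul_ne_zero hr' hw), Complex.cpow_def_of_ne_zero hr',
      Complex.cpow_def_of_ne_zero hw, Complex.log_ofReal_mul hr hw, ← Complex.exp_add,
      Complex.ofReal_log hr.le]
    ring_nf

/-- With `h = N^(-1/α)` one has `N = h^(-α)`, so `N (1 - e^(-zh))^α = ((1 - e^(-zh))/h)^α`, which
tends to `z^α` as a difference quotient. -/
theorem tendsto_sibuya_pow {α : ℝ} (h0 : 0 < α) {z : ℂ} (hz : 0 ≤ z.re) :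
    Tendsto (fun N : ℕ => (1 - (1 - Complex.exp (-(z * ((N : ℝ) ^ (-(1 / α)) : ℝ)))) ^ (α : ℂ)) ^ N)
      atTop (𝓝 (Complex.exp (-z ^ (α : ℂ)))) := by
  have hα : (α : ℂ) ≠ 0 := by exact_mod_cast h0.ne'
  simp only [sub_eq_add_neg (1 : ℂ) ((_ : ℂ) ^ (α : ℂ))]
  refine Complex.tendsto_one_add_pow_exp_of_tendsto ?_
  have hlim0 : Tendsto (fun N : ℕ => (N : ℝ) ^ (-(1 / α))) atTop (𝓝[≠] 0) := by
    refine tendsto_nhdsWithin_iff.2 ⟨(tendsto_rpow_neg_atTop (by positivity)).comp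
      tendsto_natCast_atTop_atTop, ?_⟩
    filter_upwards [eventually_gt_atTop 0] with N hN
    have : (0 : ℝ) < N := by exact_mod_cast hN
    exact (Real.rpow_pos_of_pos this _).ne'
  have hd : HasDerivAt (fun h : ℝ => 1 - Complex.exp (-(z * h))) z 0 := by
    have h1 : HasDerivAt (fun h : ℝ => -(z * (h : ℂ))) (-z) 0 := by
      simpa [neg_mul] using (Complex.ofRealCLM.hasDerivAt (x := (0 : ℝ))).const_mul (-z)
    have h2 := h1.cexp.const_sub 1
    simpa using h2
  have hs := (hasDerivAt_iff_tendsto_slope.1 hd).comp hlim0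
  have hc : ContinuousAt (fun x : ℂ => x ^ (α : ℂ)) z :=
    Complex.continuousAt_cpow_const_of_re_pos (Or.inl hz) (by simpa)
  refine ((hc.tendsto.comp hs).neg).congr' ?_
  filter_upwards [eventually_gt_atTop 0] with N hN
  have hN : (0 : ℝ) < N := by exact_mod_cast hN
  have hp : (0 : ℝ) < (N : ℝ) ^ (1 / α) := Real.rpow_pos_of_pos hN _
  simp only [Function.comp_apply, slope_def_module, sub_zero, Complex.ofReal_zero, mul_zero,
    neg_zero, Complex.exp_zero, sub_self, Complex.real_smul]
  rw [← Real.rpow_neg_one, ← Real.rpow_mul hN.le, neg_mul_neg, mul_one, Complex.ofReal_mul_cpow hp _ hα,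
    ← Complex.ofReal_cpow hp.le, ← Real.rpow_mul hN.le, one_div_mul_cancel h0.ne', Real.rpow_one,
    Complex.ofReal_natCast, mul_neg]

/-- The one-sided stable law with Laplace transform `exp (-z^α)`. -/
theorem exists_hasLaplaceTransform_stable {α : ℝ} (h0 : 0 < α) (h1 : α < 1) :
    ∃ μ : Measure ℝ, HasLaplaceTransform μ fun z => Complex.exp (-z ^ (α : ℂ)) := by
  have hα : (α : ℂ) ≠ 0 := by exact_mod_cast h0.ne'
  have hex : ∀ N : ℕ, ∃ μ : Measure ℝ, HasLaplaceTransform μ fun z =>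
      (1 - (1 - Complex.exp (-(z * ((N : ℝ) ^ (-(1 / α)) : ℝ)))) ^ (α : ℂ)) ^ N := fun N => by
    obtain ⟨μ, hμ⟩ := exists_hasLaplaceTransform_sibuya h0 h1
      (Real.rpow_nonneg (Nat.cast_nonneg N) (-(1 / α)))
    exact exists_hasLaplaceTransform_pow hμ N
  choose μ hμ using hex
  have hp : ∀ N, IsProbabilityMeasure (μ N) := fun N => (hμ N).isProbabilityMeasure
  have hchar : ∀ s : ℝ, Tendsto (fun N => charFun (μ N) s) atTop
      (𝓝 (Complex.exp (-(-(Complex.I * s)) ^ (α : ℂ)))) := fun s => by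
    have hre : 0 ≤ (-(Complex.I * s)).re := by simp
    refine (tendsto_sibuya_pow h0 hre).congr fun N => ?_
    rw [← (hμ N).integral_eq _ hre, charFun_apply_real]
    refine integral_congr_ae (ae_of_all _ fun x => ?_)
    simp only; congr 1; ring
  have hcont : ContinuousAt (fun s : ℝ => Complex.exp (-(-(Complex.I * s)) ^ (α : ℂ))) 0 := by
    refine ContinuousAt.cexp (ContinuousAt.neg ?_)
    have hc : ContinuousAt (fun x : ℂ => x ^ (α : ℂ)) (-(Complex.I * ((0 : ℝ) : ℂ))) :=
      Complex.continuousAt_cpow_const_of_re_pos (Or.inl (by simp)) (by simpa)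
    exact ContinuousAt.comp (f := fun s : ℝ => -(Complex.I * (s : ℂ))) hc (by fun_prop)
  -- Lévy: a limit of characteristic functions that is continuous at `0` forces tightness. A cluster
  -- point along an ultrafilter suffices, because the Laplace transforms converge along the whole
  -- sequence.
  have htight := isTightMeasureSet_of_tendsto_charFun hcont hchar
  let ν : ℕ → ProbabilityMeasure ℝ := fun N => ⟨μ N, hp N⟩
  have hcomp : IsCompact (closure (Set.range ν)) := by
    refine isCompact_closure_of_isTightMeasureSet (htight.subset ?_)
    rintro _ ⟨_, ⟨N, rfl⟩, rfl⟩
    exact ⟨N, rfl⟩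
  obtain ⟨m, -, hm⟩ := hcomp.ultrafilter_le_nhds ((hyperfilter ℕ).map ν)
    (le_principal_iff.2 (mem_of_superset (Ultrafilter.mem_map.2 (Eventually.of_forall
      fun N => Set.mem_range_self N)) subset_closure))
  have hm' : Tendsto ν (hyperfilter ℕ) (𝓝 m) := hm
  rw [ProbabilityMeasure.tendsto_iff_forall_integral_rclike_tendsto ℂ] at hm'
  have hnn : ∀ᵐ x ∂(m : Measure ℝ), 0 ≤ x := by
    -- A bounded continuous function that is positive exactly on `(-∞, 0)`: its vanishing integral
    -- passes to the limit.
    let f : BoundedContinuousFunction ℝ ℂ := BoundedContinuousFunction.ofNormedAddCommGroup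
      (fun x : ℝ => ((min 1 (max (-x) 0) : ℝ) : ℂ)) (by fun_prop) 1 (fun x => by
        rw [Complex.norm_real, Real.norm_of_nonneg (by positivity)]; exact min_le_left _ _)
    have hf0 : ∀ N, ∫ x, f x ∂(ν N : Measure ℝ) = 0 := fun N => by
      refine integral_eq_zero_of_ae ?_
      filter_upwards [(hμ N).nonneg] with x hx
      simp [f, hx]
    have h := hm' f
    simp only [hf0] at h
    have h3 : ∫ x, ((min 1 (max (-x) 0) : ℝ) : ℂ) ∂(m : Measure ℝ) = 0 :=
      (tendsto_nhds_unique tendsto_const_nhds h).symm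
    rw [integral_complex_ofReal, Complex.ofReal_eq_zero, integral_eq_zero_iff_of_nonneg
      (fun x => by positivity)] at h3
    · filter_upwards [h3] with x hx
      by_contra hneg
      have : 0 < min 1 (max (-x) 0) := lt_min one_pos (lt_max_of_lt_left (by linarith))
      exact this.ne' hx
    · refine Integrable.of_bound (C := 1) (Continuous.aestronglyMeasurable (by fun_prop))
        (ae_of_all _ fun x => ?_)
      rw [Real.norm_of_nonneg (by positivity)]; exact min_le_left _ _
  refine ⟨m, inferInstance, hnn, fun z hz => ?_⟩
  -- Replacing `x` by `max x 0` makes the exponential bounded on the line and changes nothing on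
  -- `[0, ∞)`.
  let f : BoundedContinuousFunction ℝ ℂ := BoundedContinuousFunction.ofNormedAddCommGroup
    (fun x : ℝ => Complex.exp (-(z * (max x 0 : ℝ)))) (by fun_prop) 1 (fun x => by
      rw [Complex.norm_exp, Real.exp_le_one_iff, Complex.neg_re, Complex.re_mul_ofReal]
      have := le_max_right x 0
      nlinarith)
  have hf : ∀ ρ : Measure ℝ, (∀ᵐ x ∂ρ, 0 ≤ x) →
      ∫ x, f x ∂ρ = ∫ x, Complex.exp (-(z * x)) ∂ρ := fun ρ hρ => by
    refine integral_congr_ae ?_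
    filter_upwards [hρ] with x hx
    simp [f, hx]
  have h := hm' f
  rw [hf _ hnn] at h
  refine tendsto_nhds_unique h (((tendsto_sibuya_pow h0 hz).congr fun N => ?_).mono_left
    Nat.hyperfilter_le_atTop)
  rw [← (hμ N).integral_eq z hz]
  exact (hf _ (hμ N).nonneg).symm

/-! ### Densities from integrable characteristic functions -/

/-- The Gaussian `exp(-(x-a)²/(2δ²))` is at least `e^(-1/2)` on the ball, and it is the
characteristic function at `x - a` of the normal law of variance `δ⁻²`. By Fubini its `μ`-integral
becomes an integral of `charFun μ`, up to a unimodular factor, against that law, whose density is at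
most `δ`. -/
theorem measure_closedBall_le_of_integrable_charFun {μ : Measure ℝ} [IsProbabilityMeasure μ]
    (hμ : Integrable (charFun μ)) (a : ℝ) {δ : ℝ} (hδ : 0 < δ) :
    μ.real (Metric.closedBall a δ) ≤ Real.exp (1 / 2) * (∫ s, ‖charFun μ s‖) * δ := by
  set v : NNReal := ⟨(δ ^ 2)⁻¹, by positivity⟩ with hv
  have hv0 : v ≠ 0 := by
    rw [← NNReal.coe_ne_zero]; change (δ ^ 2)⁻¹ ≠ 0; positivity
  have hvv : (v : ℝ) = (δ ^ 2)⁻¹ := rfl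
  set G := ProbabilityTheory.gaussianReal 0 v
  have h1 : ∀ x : ℝ, ((Real.exp (-((x - a) ^ 2 / δ ^ 2 / 2)) : ℝ) : ℂ) =
      ∫ g, Complex.exp ((x - a) * g * Complex.I) ∂G := fun x => by
    have h := ProbabilityTheory.charFun_gaussianReal (μ := 0) (v := v) (x - a)
    rw [charFun_apply_real] at h
    push_cast at h
    rw [h]
    push_cast
    congr 1
    rw [show ((v : ℝ) : ℂ) = (((δ ^ 2)⁻¹ : ℝ) : ℂ) by rw [hvv]]
    push_cast
    ring
  have hint : Integrable (fun x : ℝ => Real.exp (-((x - a) ^ 2 / δ ^ 2 / 2))) μ := by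
    refine Integrable.of_bound (C := 1) (Continuous.aestronglyMeasurable (by fun_prop))
      (ae_of_all _ fun x => ?_)
    rw [Real.norm_of_nonneg (Real.exp_pos _).le, Real.exp_le_one_iff]
    have : 0 ≤ (x - a) ^ 2 / δ ^ 2 / 2 := by positivity
    linarith
  have h2 : ((∫ x, Real.exp (-((x - a) ^ 2 / δ ^ 2 / 2)) ∂μ : ℝ) : ℂ) =
      ∫ g, Complex.exp (-(a * g * Complex.I)) * charFun μ g ∂G := by
    rw [← integral_complex_ofReal]
    simp only [h1]
    rw [integral_integral_swap]
    · refine integral_congr_ae (ae_of_all _ fun g => ?_)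
      simp only [charFun_apply_real, ← integral_const_mul]
      refine integral_congr_ae (ae_of_all _ fun x => ?_)
      simp only
      rw [← Complex.exp_add]; ring_nf
    · refine Integrable.of_bound (C := 1) (Continuous.aestronglyMeasurable (by
        simp only [Function.uncurry_def]; fun_prop)) (ae_of_all _ fun p => ?_)
      rw [Function.uncurry_def, Complex.norm_exp]
      simp
  have h3 : ∫ x, Real.exp (-((x - a) ^ 2 / δ ^ 2 / 2)) ∂μ ≤ (∫ s, ‖charFun μ s‖) * δ := by
    have e0 : 0 ≤ ∫ x, Real.exp (-((x - a) ^ 2 / δ ^ 2 / 2)) ∂μ :=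
      integral_nonneg fun x => (Real.exp_pos _).le
    rw [← abs_of_nonneg e0, ← Real.norm_eq_abs, ← Complex.norm_real, h2,
      ProbabilityTheory.integral_gaussianReal_eq_integral_smul hv0, ← integral_mul_const]
    refine norm_integral_le_of_norm_le (hμ.norm.mul_const _) (ae_of_all _ fun g => ?_)
    rw [norm_smul, norm_mul, Complex.norm_exp]
    have e1 : (-(a * g * Complex.I : ℂ)).re = 0 := by simp
    have e2 : ‖ProbabilityTheory.gaussianPDFReal 0 v g‖ ≤ δ := by
      rw [Real.norm_of_nonneg (ProbabilityTheory.gaussianPDFReal_nonneg _ _ _),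
        ProbabilityTheory.gaussianPDFReal, hvv]
      have e3 : Real.exp (-(g - 0) ^ 2 / (2 * (δ ^ 2)⁻¹)) ≤ 1 := by
        rw [Real.exp_le_one_iff]
        have : 0 ≤ (g - 0) ^ 2 / (2 * (δ ^ 2)⁻¹) := by positivity
        rw [neg_div]; linarith
      have e4 : (√(2 * Real.pi * (δ ^ 2)⁻¹))⁻¹ ≤ δ := by
        rw [inv_le_comm₀ (by positivity) hδ]
        refine Real.le_sqrt_of_sq_le ?_
        rw [inv_pow]
        refine le_mul_of_one_le_left (by positivity) ?_
        linarith [Real.pi_gt_three]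
      calc _ ≤ δ * 1 := mul_le_mul e4 e3 (Real.exp_pos _).le hδ.le
        _ = δ := mul_one δ
    rw [e1, Real.exp_zero, one_mul, mul_comm]
    gcongr
  have h4 : Real.exp (-(1 / 2)) * μ.real (Metric.closedBall a δ) ≤
      ∫ x, Real.exp (-((x - a) ^ 2 / δ ^ 2 / 2)) ∂μ := by
    calc _ = ∫ x in Metric.closedBall a δ, Real.exp (-(1 / 2)) ∂μ := by
          rw [setIntegral_const, smul_eq_mul, mul_comm]
      _ ≤ ∫ x in Metric.closedBall a δ, Real.exp (-((x - a) ^ 2 / δ ^ 2 / 2)) ∂μ := by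
          refine setIntegral_mono_on (integrable_const _) hint.integrableOn
            Metric.isClosed_closedBall.measurableSet fun x hx => ?_
          rw [Metric.mem_closedBall, Real.dist_eq] at hx
          have : (x - a) ^ 2 ≤ δ ^ 2 := sq_le_sq' (by linarith [neg_abs_le (x - a)])
            (by linarith [le_abs_self (x - a)])
          refine Real.exp_le_exp.2 (neg_le_neg ?_)
          gcongr
          exact div_le_one_of_le₀ this (by positivity)
      _ ≤ _ := setIntegral_le_integral hint (ae_of_all _ fun x => (Real.exp_pos _).le)
  rw [mul_assoc]
  have h5 := h4.trans h3
  rw [Real.exp_neg, inv_mul_le_iff₀ (Real.exp_pos _)] at h5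
  exact h5

/-- The ball estimate compares `μ` with `K` times Lebesgue measure on small balls; the Vitali
covering theorem extends this to all measurable sets, so `μ` has a density that is at most `K`
almost everywhere. -/
theorem exists_density_of_integrable_charFun {μ : Measure ℝ} [IsProbabilityMeasure μ]
    (hμ : Integrable (charFun μ)) (hpos : ∀ᵐ x ∂μ, 0 ≤ x) :
    ∃ (f : ℝ → ℝ) (K : ℝ), Measurable f ∧ (∀ x, 0 ≤ f x) ∧ (∀ x, f x ≤ K) ∧ (∀ x ≤ 0, f x = 0) ∧
      μ = volume.withDensity fun x => ENNReal.ofReal (f x) := by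
  set K : ℝ := Real.exp (1 / 2) * (∫ s, ‖charFun μ s‖) with hK
  have hK0 : 0 ≤ K := by positivity
  have hle : μ ≤ ENNReal.ofReal K • volume := by
    have : IsLocallyFiniteMeasure (ENNReal.ofReal K • volume : Measure ℝ) :=
      inferInstanceAs (IsLocallyFiniteMeasure (K.toNNReal • volume : Measure ℝ))
    refine Measure.le_intro fun s _ _ => ?_
    refine (Besicovitch.vitaliFamily μ).measure_le_of_frequently_le (ENNReal.ofReal K • volume)
      Measure.AbsolutelyContinuous.rfl s fun x _ => ?_
    refine Frequently.filter_mono (f := map (Metric.closedBall x) (𝓝[>] 0)) ?_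
      (Besicovitch.tendsto_filterAt μ x)
    refine Eventually.frequently (eventually_map.2 ?_)
    filter_upwards [self_mem_nhdsWithin] with δ hδ
    have h := measure_closedBall_le_of_integrable_charFun hμ x (δ := δ) hδ
    rw [Measure.smul_apply, Real.volume_closedBall, smul_eq_mul, ← ENNReal.ofReal_mul hK0]
    rw [← ofReal_measureReal]
    refine ENNReal.ofReal_le_ofReal (h.trans ?_)
    have hδ' : (0 : ℝ) < δ := hδ
    rw [← hK]
    nlinarith
  have hac : μ ≪ volume := (Measure.absolutelyContinuous_of_le hle).trans
    Measure.smul_absolutelyContinuous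
  set f0 := μ.rnDeriv volume with hf0
  have hf0m : Measurable f0 := Measure.measurable_rnDeriv _ _
  have hd : volume.withDensity f0 = μ := Measure.withDensity_rnDeriv_eq _ _ hac
  have hbound : f0 ≤ᵐ[volume] fun _ => ENNReal.ofReal K := by
    refine ae_le_of_forall_setLIntegral_le_of_sigmaFinite hf0m fun s hs _ => ?_
    rw [← withDensity_apply _ hs, hd, setLIntegral_const]
    exact hle s
  have hsupp : ∀ᵐ x : ℝ, f0 x ≠ 0 → 0 ≤ x := by
    rw [← hd] at hpos
    exact (ae_withDensity_iff hf0m).1 hpos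
  -- A change on a null set makes the bound and the vanishing on `(-∞, 0]` hold everywhere.
  refine ⟨fun x => if 0 < x then min (f0 x).toReal K else 0, K, ?_, ?_, ?_, ?_, ?_⟩
  · exact Measurable.ite measurableSet_Ioi (hf0m.ennreal_toReal.min measurable_const)
      measurable_const
  · intro x; simp only; split_ifs <;> positivity
  · intro x; simp only; split_ifs
    · exact min_le_right _ _
    · exact hK0
  · intro x hx; simp [not_lt.2 hx]
  · conv_lhs => rw [← hd]
    refine withDensity_congr_ae ?_
    filter_upwards [hbound, hsupp, compl_mem_ae_iff.2 (measure_singleton (0 : ℝ))] with x h1 h2 h3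
    have hx0 : x ≠ 0 := h3
    rcases lt_or_gt_of_ne hx0 with hx | hx
    · have : f0 x = 0 := by
        by_contra h
        exact absurd (h2 h) (not_le.2 hx)
      simp [this, not_lt.2 hx.le]
    · rw [if_pos hx, min_eq_left (ENNReal.toReal_le_of_le_ofReal hK0 h1),
        ENNReal.ofReal_toReal (ne_top_of_le_ne_top ENNReal.ofReal_ne_top h1)]

theorem cpow_neg_I_mul {α : ℝ} (h0 : 0 < α) (s : ℝ) :
    (-(Complex.I * s)) ^ (α : ℂ) = ((|s| ^ α : ℝ) : ℂ) *
      (((Real.cos (Real.pi * α / 2) : ℝ) : ℂ) -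
        Complex.I * (Real.sign s : ℝ) * (Real.sin (Real.pi * α / 2) : ℝ)) := by
  have hα : (α : ℂ) ≠ 0 := by exact_mod_cast h0.ne'
  rcases lt_trichotomy s 0 with hs | rfl | hs
  · have h1 : -(Complex.I * s) = ((|s| : ℝ) : ℂ) * Complex.I := by
      rw [abs_of_neg hs]; push_cast; ring
    rw [h1, Complex.ofReal_mul_cpow (abs_pos.2 hs.ne) _ hα, Complex.ofReal_cpow (abs_nonneg s),
      Complex.cpow_def_of_ne_zero Complex.I_ne_zero, Complex.log_I, Real.sign_of_neg hs,
      show (Real.pi / 2 * Complex.I * α : ℂ) = ((Real.pi * α / 2 : ℝ) : ℂ) * Complex.I by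
        push_cast; ring, Complex.exp_mul_I]
    push_cast; ring
  · simp [Complex.zero_cpow hα, Real.zero_rpow h0.ne']
  · have h1 : -(Complex.I * s) = ((|s| : ℝ) : ℂ) * -Complex.I := by
      rw [abs_of_pos hs]; ring
    rw [h1, Complex.ofReal_mul_cpow (abs_pos.2 hs.ne') _ hα, Complex.ofReal_cpow (abs_nonneg s),
      Complex.cpow_def_of_ne_zero (neg_ne_zero.2 Complex.I_ne_zero), Complex.log_neg_I,
      Real.sign_of_pos hs,
      show (-(Real.pi / 2) * Complex.I * α : ℂ) = ((-(Real.pi * α / 2) : ℝ) : ℂ) * Complex.I by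
        push_cast; ring, Complex.exp_mul_I]
    push_cast
    rw [Complex.cos_neg, Complex.sin_neg]; ring

theorem cos_pi_mul_div_two_pos {α : ℝ} (h0 : 0 < α) (h1 : α < 1) :
    0 < Real.cos (Real.pi * α / 2) := by
  refine Real.cos_pos_of_mem_Ioo ⟨?_, ?_⟩ <;> nlinarith [Real.pi_pos]

/-- On the imaginary axis `z^α` has real part `|s|^α cos(πα/2)`, which the scale absorbs, and the
ratio of imaginary to real part is the skewness term with `β = 1`. -/
theorem stableCharFun_stableScale {α : ℝ} (h0 : 0 < α) (h1 : α < 1) {u : ℝ} (hu : 0 < u) (s : ℝ) :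
    stableCharFun α (stableScale α u) 1 0 s =
      Complex.exp (-(u * (-(Complex.I * s)) ^ (α : ℂ))) := by
  have hc := cos_pi_mul_div_two_pos h0 h1
  have hσ : stableScale α u ^ α = u * Real.cos (Real.pi * α / 2) := by
    rw [stableScale, ← Real.rpow_mul (by positivity), one_div_mul_cancel h0.ne', Real.rpow_one]
  have hct : ((Real.cos (Real.pi * α / 2) : ℝ) : ℂ) * ((Real.tan (Real.pi * α / 2) : ℝ) : ℂ) =
      ((Real.sin (Real.pi * α / 2) : ℝ) : ℂ) := by
    rw [← Complex.ofReal_mul, mul_comm, Real.tan_mul_cos hc.ne']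
  rw [stableCharFun, hσ, cpow_neg_I_mul h0]
  congr 1
  simp only [Complex.ofReal_mul, Complex.ofReal_one, Complex.ofReal_zero]
  linear_combination (u * ((|s| ^ α : ℝ) : ℂ) * Complex.I * ((Real.sign s : ℝ) : ℂ)) * hct

theorem integrable_exp_neg_mul_abs_rpow {α c : ℝ} (h0 : 0 < α) (hc : 0 < c) :
    Integrable fun s : ℝ => Real.exp (-c * |s| ^ α) := by
  have hI : IntegrableOn (fun s : ℝ => Real.exp (-c * |s| ^ α)) (Set.Ioi 0) := by
    have := integrableOn_rpow_mul_exp_neg_mul_rpow (s := 0) (p := α) (b := c) (by norm_num) h0 hc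
    refine this.congr_fun (fun s hs => ?_) measurableSet_Ioi
    simp only
    rw [Real.rpow_zero, one_mul, abs_of_pos hs]
  rw [← integrableOn_univ, ← Set.Iic_union_Ioi (a := (0 : ℝ)), integrableOn_union]
  refine ⟨?_, hI⟩
  have h2 := (integrableOn_Ici_iff_integrableOn_Ioi).2 hI
  have h3 := (Measure.measurePreserving_neg (volume : Measure ℝ)).integrableOn_comp_preimage
    (Homeomorph.neg ℝ).measurableEmbedding (f := fun s : ℝ => Real.exp (-c * |s| ^ α))
    (s := Set.Ici 0)
  have h4 := h3.2 h2
  simpa [Function.comp_def] using h4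

/-- The law with Laplace transform `exp (-z^α)` has a bounded density on `(0, ∞)`. -/
theorem exists_stable_density {α : ℝ} (h0 : 0 < α) (h1 : α < 1) :
    ∃ (f : ℝ → ℝ) (K : ℝ), Measurable f ∧ (∀ x, 0 ≤ f x) ∧ (∀ x, f x ≤ K) ∧ (∀ x ≤ 0, f x = 0) ∧
      HasLaplaceTransform (volume.withDensity fun x => ENNReal.ofReal (f x))
        fun z => Complex.exp (-z ^ (α : ℂ)) := by
  obtain ⟨μ, hμ⟩ := exists_hasLaplaceTransform_stable h0 h1
  have := hμ.isProbabilityMeasure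
  have hchar : ∀ s : ℝ, charFun μ s = Complex.exp (-(-(Complex.I * s)) ^ (α : ℂ)) := fun s => by
    rw [← hμ.integral_eq _ (by simp), charFun_apply_real]
    refine integral_congr_ae (ae_of_all _ fun x => ?_)
    simp only; congr 1; ring
  have hint : Integrable (charFun μ) := by
    refine (integrable_exp_neg_mul_abs_rpow h0 (cos_pi_mul_div_two_pos h0 h1)).mono'
      measurable_charFun.aestronglyMeasurable (ae_of_all _ fun s => ?_)
    rw [hchar, Complex.norm_exp, cpow_neg_I_mul h0, Complex.neg_re, Complex.re_ofReal_mul]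
    refine le_of_eq (congrArg Real.exp ?_)
    rw [Complex.sub_re, Complex.ofReal_re, mul_assoc Complex.I, ← Complex.ofReal_mul,
      Complex.I_mul_re, Complex.ofReal_im]
    ring
  obtain ⟨f, K, h2, h3, h4, h5, h6⟩ := exists_density_of_integrable_charFun hint hμ.nonneg
  exact ⟨f, K, h2, h3, h4, h5, h6 ▸ hμ⟩

/-! ### Moments of the inverse stable subordinator -/

/-- A bounded density on `(0, ∞)` of the law with Laplace transform `exp (-z^α)`. -/
structure IsUnitStableDensity (α : ℝ) (f : ℝ → ℝ) : Prop where
  measurable : Measurable f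
  nonneg : ∀ x, 0 ≤ f x
  bounded : ∃ K, ∀ x, f x ≤ K
  eq_zero : ∀ x ≤ 0, f x = 0
  laplace : HasLaplaceTransform (volume.withDensity fun x => ENNReal.ofReal (f x))
        fun z => Complex.exp (-z ^ (α : ℂ))

/-- The density at `w` of `u^(1/α) X`, when `X` has density `f`. -/
noncomputable def scaledDensity (α : ℝ) (f : ℝ → ℝ) (u w : ℝ) : ℝ :=
  u ^ (-(1 / α)) * f (w * u ^ (-(1 / α)))

theorem integral_withDensity_ofReal {f : ℝ → ℝ} (hf : Measurable f) (h0 : ∀ x, 0 ≤ f x)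
    (g : ℝ → ℂ) :
    ∫ x, g x ∂(volume.withDensity fun x => ENNReal.ofReal (f x)) = ∫ x, (f x : ℂ) * g x := by
  rw [integral_withDensity_eq_integral_toReal_smul (by fun_prop)
    (ae_of_all _ fun x => ENNReal.ofReal_lt_top)]
  refine integral_congr_ae (ae_of_all _ fun x => ?_)
  simp only [ENNReal.toReal_ofReal (h0 x), Complex.real_smul]

namespace IsUnitStableDensity

variable {α : ℝ} {f : ℝ → ℝ}

theorem lintegral_eq_one (hf : IsUnitStableDensity α f) :
    ∫⁻ x, ENNReal.ofReal (f x) = 1 := by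
  have := hf.laplace.isProbabilityMeasure.measure_univ
  rwa [withDensity_apply _ MeasurableSet.univ, Measure.restrict_univ] at this

theorem integrable (hf : IsUnitStableDensity α f) : Integrable f := by
  refine ⟨hf.measurable.aestronglyMeasurable, ?_⟩
  rw [hasFiniteIntegral_iff_ofReal (ae_of_all _ hf.nonneg), hf.lintegral_eq_one]
  exact ENNReal.one_lt_top

theorem integral_eq_one (hf : IsUnitStableDensity α f) : ∫ x, f x = 1 := by
  rw [integral_eq_lintegral_of_nonneg_ae (ae_of_all _ hf.nonneg)
    hf.measurable.aestronglyMeasurable, hf.lintegral_eq_one]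
  simp

theorem charFun_eq (hf : IsUnitStableDensity α f) (s : ℝ) :
    ∫ x, (f x : ℂ) * Complex.exp (s * x * Complex.I) =
      Complex.exp (-(-(Complex.I * s)) ^ (α : ℂ)) := by
  rw [← hf.laplace.integral_eq _ (by simp), integral_withDensity_ofReal hf.measurable hf.nonneg]
  refine integral_congr_ae (ae_of_all _ fun x => ?_)
  simp only; congr 2; ring

theorem lintegral_exp (hf : IsUnitStableDensity α f) {l : ℝ} (hl : 0 < l) :
    ∫⁻ y in Set.Ioi 0, ENNReal.ofReal (f y * Real.exp (-(l * y))) =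
      ENNReal.ofReal (Real.exp (-l ^ α)) := by
  have h1 := hf.laplace.integral_eq (l : ℂ) (by simpa using hl.le)
  rw [integral_withDensity_ofReal hf.measurable hf.nonneg] at h1
  have h2 : ∫ y, f y * Real.exp (-(l * y)) = Real.exp (-l ^ α) := by
    have : ((∫ y, f y * Real.exp (-(l * y)) : ℝ) : ℂ) = ((Real.exp (-l ^ α) : ℝ) : ℂ) := by
      rw [← integral_complex_ofReal]
      push_cast
      rw [h1, Complex.ofReal_cpow hl.le]
    exact_mod_cast this
  have hnn : ∀ y, 0 ≤ f y * Real.exp (-(l * y)) := fun y =>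
    mul_nonneg (hf.nonneg y) (Real.exp_pos _).le
  have hi : Integrable fun y => f y * Real.exp (-(l * y)) := by
    by_contra h
    rw [integral_undef h] at h2
    exact (Real.exp_pos _).ne h2
  rw [← h2, ofReal_integral_eq_lintegral_ofReal hi (ae_of_all _ hnn),
    ← lintegral_indicator measurableSet_Ioi]
  refine lintegral_congr fun y => ?_
  by_cases hy : y ∈ Set.Ioi (0 : ℝ)
  · rw [Set.indicator_of_mem hy]
  · rw [Set.indicator_of_notMem hy, hf.eq_zero y (not_lt.1 hy)]; simp

/-- Multiplying the variable by `u^(1/α)` multiplies the exponent `z^α` by `u`. -/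
theorem isStableDensity_scaledDensity (hf : IsUnitStableDensity α f) (h0 : 0 < α) (h1 : α < 1)
    {u : ℝ} (hu : 0 < u) : IsStableDensity α (stableScale α u) 1 0 (scaledDensity α f u) := by
  set c : ℝ := u ^ (-(1 / α)) with hc
  have hc0 : 0 < c := Real.rpow_pos_of_pos hu _
  have hcα : (c⁻¹) ^ α = u := by
    rw [hc, ← Real.rpow_neg_one, ← Real.rpow_mul hu.le, ← Real.rpow_mul hu.le]
    rw [show -(1 / α) * -1 * α = 1 by field_simp, Real.rpow_one]
  have hα : (α : ℂ) ≠ 0 := by exact_mod_cast h0.ne'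
  have hm : Measurable (scaledDensity α f u) := by
    have := hf.measurable
    unfold scaledDensity; fun_prop
  have hn : ∀ w, 0 ≤ scaledDensity α f u w := fun w => mul_nonneg hc0.le (hf.nonneg _)
  have hi : Integrable (scaledDensity α f u) :=
    (hf.integrable.comp_mul_right' hc0.ne').const_mul _
  have hI : ∀ g : ℝ → ℂ, ∫ w, (scaledDensity α f u w : ℂ) * g (w * c) = ∫ w, (f w : ℂ) * g w := by
    intro g
    have := Measure.integral_comp_mul_right (fun w => (f w : ℂ) * g w) c
    simp only [scaledDensity, Complex.ofReal_mul, mul_assoc, integral_const_mul, ← hc]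
    rw [this, abs_of_pos (inv_pos.2 hc0), Complex.real_smul, ← mul_assoc, ← Complex.ofReal_mul,
      mul_inv_cancel₀ hc0.ne', Complex.ofReal_one, one_mul]
  refine ⟨hm, hn, ⟨?_⟩, fun s => ?_⟩
  · rw [withDensity_apply _ MeasurableSet.univ, Measure.restrict_univ,
      ← ofReal_integral_eq_lintegral_ofReal hi (ae_of_all _ hn)]
    have := hI fun _ => 1
    simp only [mul_one, integral_complex_ofReal, hf.integral_eq_one] at this
    rw [Complex.ofReal_inj.1 this, ENNReal.ofReal_one]
  · rw [charFun_apply_real, integral_withDensity_ofReal hm hn, stableCharFun_stableScale h0 h1 hu]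
    have := hI fun w => Complex.exp (((s * c⁻¹ : ℝ) : ℂ) * w * Complex.I)
    rw [hf.charFun_eq] at this
    have e : -(Complex.I * ((s * c⁻¹ : ℝ) : ℂ)) = ((c⁻¹ : ℝ) : ℂ) * -(Complex.I * s) := by
      push_cast; ring
    rw [e, Complex.ofReal_mul_cpow (inv_pos.2 hc0) _ hα, ← Complex.ofReal_cpow (inv_pos.2 hc0).le,
      hcα] at this
    rw [← this]
    refine integral_congr_ae (ae_of_all _ fun w => ?_)
    have hcc : (c : ℂ) ≠ 0 := by exact_mod_cast hc0.ne'
    simp only; congr 2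
    push_cast
    field_simp

end IsUnitStableDensity

/-- The characteristic function determines the law, and the law its density almost everywhere. The
final formula only integrates the density, so any family `pbar` may be replaced by `scaledDensity`.
-/
theorem IsStableDensity.ae_eq {α σ β μ : ℝ} {p q : ℝ → ℝ} (hp : IsStableDensity α σ β μ p)
    (hq : IsStableDensity α σ β μ q) : p =ᵐ[volume] q := by
  have := hp.isProbabilityMeasure
  have := hq.isProbabilityMeasure
  have h : (volume.withDensity fun w => ENNReal.ofReal (p w)) =
      volume.withDensity fun w => ENNReal.ofReal (q w) :=
    Measure.ext_of_charFun (funext fun s => by rw [hp.charFun_eq, hq.charFun_eq])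
  have hfin : ∫⁻ w, ENNReal.ofReal (p w) ≠ ⊤ := by
    have := hp.isProbabilityMeasure.measure_univ
    rw [withDensity_apply _ MeasurableSet.univ, Measure.restrict_univ] at this
    rw [this]; exact ENNReal.one_ne_top
  rw [withDensity_eq_iff hp.measurable.ennreal_ofReal.aemeasurable
    hq.measurable.ennreal_ofReal.aemeasurable hfin] at h
  filter_upwards [h] with w hw
  exact (ENNReal.ofReal_eq_ofReal_iff (hp.nonneg w) (hq.nonneg w)).1 hw

/-! ### Beta integrals and power moments. -/

theorem integral_beta {a b t : ℝ} (ha : 0 < a) (hb : 0 < b) (ht : 0 < t) :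
    ∫ w in (0 : ℝ)..t, w ^ (a - 1) * (t - w) ^ (b - 1) =
      t ^ (a + b - 1) * (Real.Gamma a * Real.Gamma b / Real.Gamma (a + b)) := by
  have h := Complex.betaIntegral_scaled (a : ℂ) (b : ℂ) ht
  rw [Complex.betaIntegral_eq_Gamma_mul_div _ _ (by simpa) (by simpa)] at h
  rw [← Complex.ofReal_inj, ← intervalIntegral.integral_ofReal]
  push_cast
  rw [Complex.ofReal_cpow ht.le, ← Complex.Gamma_ofReal, ← Complex.Gamma_ofReal,
    ← Complex.Gamma_ofReal]
  push_cast
  rw [← h]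
  refine intervalIntegral.integral_congr_ae (ae_of_all _ fun w hw => ?_)
  rw [Set.uIoc_of_le ht.le] at hw
  rw [Complex.ofReal_cpow hw.1.le, Complex.ofReal_cpow (by linarith [hw.2])]
  push_cast
  rfl

/-- The integral is positive, whereas a non-integrable function has integral `0` by convention. -/
theorem intervalIntegrable_beta {a b t : ℝ} (ha : 0 < a) (hb : 0 < b) (ht : 0 < t) :
    IntervalIntegrable (fun w => w ^ (a - 1) * (t - w) ^ (b - 1)) volume 0 t := by
  by_contra h
  have h1 := integral_beta ha hb ht
  rw [intervalIntegral.integral_undef h] at h1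
  have := Real.Gamma_pos_of_pos ha
  have := Real.Gamma_pos_of_pos hb
  have := Real.Gamma_pos_of_pos (add_pos ha hb)
  have := Real.rpow_pos_of_pos ht (a + b - 1)
  exact (by positivity : 0 < t ^ (a + b - 1) *
    (Real.Gamma a * Real.Gamma b / Real.Gamma (a + b))).ne h1

theorem lintegral_beta {a b t : ℝ} (ha : 0 < a) (hb : 0 < b) (ht : 0 < t) :
    ∫⁻ w in Set.Ioc 0 t, ENNReal.ofReal (w ^ (a - 1) * (t - w) ^ (b - 1)) =
      ENNReal.ofReal (t ^ (a + b - 1) *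
        (Real.Gamma a * Real.Gamma b / Real.Gamma (a + b))) := by
  rw [← integral_beta ha hb ht, intervalIntegral.integral_of_le ht.le,
    ofReal_integral_eq_lintegral_ofReal ((intervalIntegrable_iff_integrableOn_Ioc_of_le ht.le).1
      (intervalIntegrable_beta ha hb ht))]
  filter_upwards [ae_restrict_mem measurableSet_Ioc] with w hw
  exact mul_nonneg (Real.rpow_nonneg hw.1.le _) (Real.rpow_nonneg (by linarith [hw.2]) _)

namespace IsUnitStableDensity

variable {α : ℝ} {f : ℝ → ℝ}

/-- Write `Γ(s) y^(-s) = ∫ l^(s-1) e^(-ly) dl`, exchange by Tonelli, insert the Laplace transform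
`e^(-l^α)` and recognise a Gamma integral. -/
theorem lintegral_rpow_neg (hf : IsUnitStableDensity α f) (h0 : 0 < α) {s : ℝ} (hs : 0 < s) :
    ∫⁻ y in Set.Ioi 0, ENNReal.ofReal (y ^ (-s) * f y) =
      ENNReal.ofReal (Real.Gamma (s / α) / (α * Real.Gamma s)) := by
  have hG := Real.Gamma_pos_of_pos hs
  have key : ENNReal.ofReal (Real.Gamma s) * ∫⁻ y in Set.Ioi 0, ENNReal.ofReal (y ^ (-s) * f y) =
      ENNReal.ofReal (1 / α * Real.Gamma (s / α)) := by
    have hfm := hf.measurable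
    rw [← lintegral_const_mul _ (by fun_prop)]
    calc ∫⁻ y in Set.Ioi 0, ENNReal.ofReal (Real.Gamma s) * ENNReal.ofReal (y ^ (-s) * f y)
        = ∫⁻ y in Set.Ioi 0, ∫⁻ l in Set.Ioi 0,
            ENNReal.ofReal (l ^ (s - 1)) * ENNReal.ofReal (f y * Real.exp (-(l * y))) := by
          refine setLIntegral_congr_fun measurableSet_Ioi fun y (hy : 0 < y) => ?_
          have e1 := Real.integral_rpow_mul_exp_neg_mul_Ioi hs hy
          have e2 : Integrable (fun l : ℝ => l ^ (s - 1) * Real.exp (-(y * l)))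
              (volume.restrict (Set.Ioi 0)) := by
            by_contra h
            rw [integral_undef h] at e1
            exact (by positivity : 0 < (1 / y) ^ s * Real.Gamma s).ne e1
          have e3 := ofReal_integral_eq_lintegral_ofReal e2 (by
            filter_upwards [ae_restrict_mem measurableSet_Ioi] with l (hl : 0 < l)
            positivity)
          rw [e1] at e3
          rw [← ENNReal.ofReal_mul hG.le, show Real.Gamma s * (y ^ (-s) * f y) =
            f y * ((1 / y) ^ s * Real.Gamma s) by
              rw [one_div, Real.inv_rpow hy.le, Real.rpow_neg hy.le]; ring,
            ENNReal.ofReal_mul (hf.nonneg y), e3, ← lintegral_const_mul _ (by fun_prop)]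
          refine setLIntegral_congr_fun measurableSet_Ioi fun l (hl : 0 < l) => ?_
          rw [← ENNReal.ofReal_mul (hf.nonneg y), ← ENNReal.ofReal_mul (by positivity)]
          congr 1; rw [mul_comm y l]; ring
      _ = ∫⁻ l in Set.Ioi 0, ∫⁻ y in Set.Ioi 0,
            ENNReal.ofReal (l ^ (s - 1)) * ENNReal.ofReal (f y * Real.exp (-(l * y))) := by
          refine lintegral_lintegral_swap (Measurable.aemeasurable ?_)
          simp only [Function.uncurry_def]; fun_prop
      _ = ∫⁻ l in Set.Ioi 0, ENNReal.ofReal (l ^ (s - 1) * Real.exp (-l ^ α)) := by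
          refine setLIntegral_congr_fun measurableSet_Ioi fun l (hl : 0 < l) => ?_
          rw [lintegral_const_mul _ (by fun_prop), hf.lintegral_exp hl,
            ← ENNReal.ofReal_mul (by positivity)]
      _ = _ := by
          have e1 := integral_rpow_mul_exp_neg_rpow (p := α) (q := s - 1) h0 (by linarith)
          have e2 : Integrable (fun l : ℝ => l ^ (s - 1) * Real.exp (-l ^ α))
              (volume.restrict (Set.Ioi 0)) := by
            have := integrableOn_rpow_mul_exp_neg_mul_rpow (s := s - 1) (p := α) (b := 1)
              (by linarith) h0 one_pos
            simpa [IntegrableOn] using this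
          rw [← ofReal_integral_eq_lintegral_ofReal e2, e1, sub_add_cancel]
          filter_upwards [ae_restrict_mem measurableSet_Ioi] with l (hl : 0 < l)
          positivity
  have e : Real.Gamma (s / α) / (α * Real.Gamma s) =
      (1 / α * Real.Gamma (s / α)) / Real.Gamma s := by field_simp
  rw [e, ENNReal.ofReal_div_of_pos hG, ← key, mul_comm, ENNReal.mul_div_cancel_right
    (by simpa using hG) ENNReal.ofReal_ne_top]

/-- For fixed `w`, the substitution `u = (w/y)^α` turns this into the moment of order `-α(q+1)` of
the unit stable law. -/
theorem lintegral_rpow_mul_scaledDensity (hf : IsUnitStableDensity α f) (h0 : 0 < α) {q : ℝ}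
    (hq : -1 < q) {w : ℝ} (hw : 0 < w) :
    ∫⁻ u in Set.Ioi 0, ENNReal.ofReal (u ^ q * scaledDensity α f u w) =
      ENNReal.ofReal (w ^ (α * (q + 1) - 1) * (Real.Gamma (q + 1) / Real.Gamma (α * (q + 1)))) := by
  have hs : 0 < α * (q + 1) := mul_pos h0 (by linarith)
  have himg : (fun y : ℝ => (w / y) ^ α) '' Set.Ioi 0 = Set.Ioi 0 := by
    ext u
    constructor
    · rintro ⟨y, hy, rfl⟩
      exact Real.rpow_pos_of_pos (div_pos hw hy) _
    · intro (hu : 0 < u)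
      refine ⟨w / u ^ (1 / α), div_pos hw (Real.rpow_pos_of_pos hu _), ?_⟩
      simp only
      rw [div_div_cancel₀ hw.ne', ← Real.rpow_mul hu.le, one_div_mul_cancel h0.ne', Real.rpow_one]
  have hinj : Set.InjOn (fun y : ℝ => (w / y) ^ α) (Set.Ioi 0) := by
    intro y (hy : 0 < y) z (hz : 0 < z) h
    have h2 := Real.rpow_left_injOn h0.ne' (div_pos hw hy).le (div_pos hw hz).le h
    field_simp at h2
    exact h2.symm
  have hd : ∀ y ∈ Set.Ioi (0 : ℝ), HasDerivWithinAt (fun y : ℝ => (w / y) ^ α)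
      (-(w / y ^ 2) * α * (w / y) ^ (α - 1)) (Set.Ioi 0) y := fun y hy => by
    have hy : 0 < y := hy
    have e1 : HasDerivAt (fun y : ℝ => w / y) (-(w / y ^ 2)) y := by
      have := (hasDerivAt_inv hy.ne').const_mul w
      refine (this.congr_deriv (by ring)).congr_of_eventuallyEq ?_
      exact Eventually.of_forall fun y => div_eq_mul_inv _ _
    exact (e1.rpow_const (Or.inl (div_pos hw hy).ne')).hasDerivWithinAt
  have hfm := hf.measurable
  have hcv := lintegral_image_eq_lintegral_abs_deriv_mul measurableSet_Ioi hd hinj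
    (fun u => ENNReal.ofReal (u ^ q * scaledDensity α f u w))
  rw [himg] at hcv
  rw [hcv]
  calc _ = ∫⁻ y in Set.Ioi 0, ENNReal.ofReal (α * w ^ (α * (q + 1) - 1)) *
        ENNReal.ofReal (y ^ (-(α * (q + 1))) * f y) := by
        refine setLIntegral_congr_fun measurableSet_Ioi fun y (hy : 0 < y) => ?_
        have hwy := div_pos hw hy
        have hfy := hf.nonneg y
        rw [← ENNReal.ofReal_mul (abs_nonneg _), ← ENNReal.ofReal_mul (by positivity)]
        congr 1
        have e1 : ((w / y) ^ α) ^ (-(1 / α)) = y / w := by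
          rw [← Real.rpow_mul hwy.le, show α * -(1 / α) = -1 by field_simp, Real.rpow_neg_one,
            inv_div]
        rw [scaledDensity, e1, mul_div_cancel₀ _ hw.ne', abs_mul, abs_mul, abs_neg,
          abs_of_pos (div_pos hw (pow_pos hy 2)), abs_of_pos h0,
          abs_of_pos (Real.rpow_pos_of_pos hwy _), ← Real.rpow_mul hwy.le]
        have e2 : (w / y) ^ (α - 1) * (w / y) ^ (α * q) * (w / y) =
            w ^ (α * (q + 1) - 1) * w * y ^ (-(α * (q + 1))) := by
          rw [← Real.rpow_add hwy, Real.rpow_neg hy.le]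
          nth_rewrite 2 [← Real.rpow_one (w / y)]
          rw [← Real.rpow_add hwy, show α - 1 + α * q + 1 = α * (q + 1) by ring,
            Real.div_rpow hw.le hy.le, Real.rpow_sub_one hw.ne']
          field_simp
        have e3 : w / y ^ 2 * (y / w) = 1 / w * (w / y) := by field_simp
        calc _ = α * f y * ((w / y ^ 2 * (y / w)) * (w / y) ^ (α - 1) * (w / y) ^ (α * q)) := by
              ring
          _ = α * f y * (1 / w) * ((w / y) ^ (α - 1) * (w / y) ^ (α * q) * (w / y)) := by
              rw [e3]; ring
          _ = _ := by rw [e2]; field_simp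
    _ = _ := by
        rw [lintegral_const_mul _ (by fun_prop), hf.lintegral_rpow_neg h0 hs,
          ← ENNReal.ofReal_mul (by positivity)]
        congr 1
        rw [mul_div_cancel_left₀ _ h0.ne']
        field_simp

end IsUnitStableDensity

theorem intervalIntegrable_sub_rpow {α : ℝ} (h1 : α < 1) {t : ℝ} (ht : 0 < t) :
    IntervalIntegrable (fun w => (t - w) ^ (1 - α - 1)) volume 0 t := by
  have := intervalIntegrable_beta (a := 1) (b := 1 - α) one_pos (by linarith) ht
  simpa using this

/-- The density at `u` of the inverse stable subordinator at time `t`. -/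
noncomputable def invDensity (α : ℝ) (f : ℝ → ℝ) (u t : ℝ) : ℝ :=
  rlIntegral (1 - α) (scaledDensity α f u) t

/-- The law of the inverse stable subordinator at time `t`. -/
noncomputable def invLaw (α : ℝ) (f : ℝ → ℝ) (t : ℝ) : Measure ℝ :=
  (volume.restrict (Set.Ioi 0)).withDensity fun u => ENNReal.ofReal (invDensity α f u t)

theorem summable_mittagLeffler {α : ℝ} (h0 : 0 < α) {x : ℝ} (hx : 0 ≤ x) :
    Summable fun m : ℕ => x ^ m / Real.Gamma (α * m + 1) := by
  -- Restricting the Gamma integral to `(A, ∞)` gives `Γ(s+1) ≥ A^s e^(-A)`. With `A^α = 2x + 1` the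
  -- series is dominated by a geometric one of ratio `x/(2x+1) < 1`.
  set A : ℝ := (2 * x + 1) ^ (1 / α) with hA
  have hA0 : 0 < A := Real.rpow_pos_of_pos (by linarith) _
  have hAα : A ^ α = 2 * x + 1 := by
    rw [hA, ← Real.rpow_mul (by linarith), one_div_mul_cancel h0.ne', Real.rpow_one]
  have hG : ∀ s : ℝ, 0 ≤ s → A ^ s * Real.exp (-A) ≤ Real.Gamma (s + 1) := by
    intro s hs
    rw [Real.Gamma_eq_integral (by linarith)]
    have hi := Real.GammaIntegral_convergent (s := s + 1) (by linarith)
    simp only [add_sub_cancel_right] at hi ⊢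
    have e : ∫ y in Set.Ioi A, A ^ s * Real.exp (-y) = A ^ s * Real.exp (-A) := by
      rw [integral_const_mul, integral_exp_neg_Ioi]
    rw [← e]
    have hsub : Set.Ioi A ⊆ Set.Ioi 0 := Set.Ioi_subset_Ioi hA0.le
    refine (setIntegral_mono_on ((integrableOn_exp_neg_Ioi A).const_mul _) (hi.mono_set hsub)
      measurableSet_Ioi fun y (hy : A < y) => ?_).trans
      (setIntegral_mono_set hi ?_ hsub.eventuallyLE)
    · rw [mul_comm]
      gcongr
    · filter_upwards [ae_restrict_mem measurableSet_Ioi] with y (hy : 0 < y)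
      simp only [Pi.zero_apply]; positivity
  have hgeo : Summable fun m : ℕ => Real.exp A * (x / (2 * x + 1)) ^ m :=
    (summable_geometric_of_lt_one (by positivity)
      ((div_lt_one (by positivity)).2 (by linarith))).mul_left _
  refine Summable.of_nonneg_of_le (fun m => ?_) (fun m => ?_) hgeo
  · have := Real.Gamma_pos_of_pos (by positivity : 0 < α * m + 1)
    positivity
  · have h := hG (α * m) (by positivity)
    rw [Real.rpow_mul hA0.le, hAα, Real.rpow_natCast] at h
    have hp : 0 < (2 * x + 1) ^ m * Real.exp (-A) := by positivity
    calc x ^ m / Real.Gamma (α * m + 1) ≤ x ^ m / ((2 * x + 1) ^ m * Real.exp (-A)) := by gcongr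
      _ = _ := by rw [Real.exp_neg, div_pow]; field_simp

namespace IsUnitStableDensity

variable {α : ℝ} {f : ℝ → ℝ}

theorem intervalIntegrable (hf : IsUnitStableDensity α f) (h1 : α < 1) {u t : ℝ} (hu : 0 < u)
    (ht : 0 < t) :
    IntervalIntegrable (fun w => (t - w) ^ (1 - α - 1) * scaledDensity α f u w) volume 0 t := by
  obtain ⟨K, hK⟩ := hf.bounded
  have hfm := hf.measurable
  have hc : 0 < u ^ (-(1 / α)) := Real.rpow_pos_of_pos hu _
  refine (intervalIntegrable_iff.1 (intervalIntegrable_sub_rpow h1 ht)).mul_bdd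
    (c := u ^ (-(1 / α)) * K) ?_ (ae_of_all _ fun w => ?_) |> intervalIntegrable_iff.2
  · exact Measurable.aestronglyMeasurable (by unfold scaledDensity; fun_prop)
  · rw [scaledDensity, Real.norm_of_nonneg (mul_nonneg hc.le (hf.nonneg _))]
    gcongr
    exact hK _

theorem scaledDensity_nonneg (hf : IsUnitStableDensity α f) {u : ℝ} (hu : 0 < u) (w : ℝ) :
    0 ≤ scaledDensity α f u w :=
  mul_nonneg (Real.rpow_pos_of_pos hu _).le (hf.nonneg _)

theorem invDensity_nonneg (hf : IsUnitStableDensity α f) (h1 : α < 1) {u t : ℝ} (hu : 0 < u)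
    (ht : 0 < t) : 0 ≤ invDensity α f u t := by
  have := Real.Gamma_pos_of_pos (by linarith : 0 < 1 - α)
  refine mul_nonneg (by positivity) (intervalIntegral.integral_nonneg ht.le fun w hw => ?_)
  exact mul_nonneg (Real.rpow_nonneg (by linarith [hw.2]) _) (hf.scaledDensity_nonneg hu w)

theorem ofReal_invDensity (hf : IsUnitStableDensity α f) (h1 : α < 1) {u t : ℝ} (hu : 0 < u)
    (ht : 0 < t) :
    ENNReal.ofReal (invDensity α f u t) = ENNReal.ofReal (1 / Real.Gamma (1 - α)) *
      ∫⁻ w in Set.Ioc 0 t, ENNReal.ofReal ((t - w) ^ (1 - α - 1) * scaledDensity α f u w) := by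
  have := Real.Gamma_pos_of_pos (by linarith : 0 < 1 - α)
  rw [invDensity, rlIntegral, ENNReal.ofReal_mul (by positivity),
    intervalIntegral.integral_of_le ht.le, ofReal_integral_eq_lintegral_ofReal
      ((intervalIntegrable_iff_integrableOn_Ioc_of_le ht.le).1 (hf.intervalIntegrable h1 hu ht))]
  filter_upwards [ae_restrict_mem measurableSet_Ioc] with w hw
  exact mul_nonneg (Real.rpow_nonneg (by linarith [hw.2]) _) (hf.scaledDensity_nonneg hu w)

theorem measurable_scaledDensity (hf : IsUnitStableDensity α f) :
    Measurable fun p : ℝ × ℝ => scaledDensity α f p.1 p.2 := by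
  have hfm := hf.measurable
  unfold scaledDensity; fun_prop

theorem measurable_invDensity (hf : IsUnitStableDensity α f) {t : ℝ} (ht : 0 < t) :
    Measurable fun u => invDensity α f u t := by
  have hfm := hf.measurable_scaledDensity
  simp only [invDensity, rlIntegral, intervalIntegral.integral_of_le ht.le]
  refine Measurable.const_mul (StronglyMeasurable.measurable ?_) _
  refine StronglyMeasurable.integral_prod_right (f := fun u w =>
    (t - w) ^ (1 - α - 1) * scaledDensity α f u w) (Measurable.stronglyMeasurable ?_)
  simp only [Function.uncurry_def]
  exact Measurable.mul (by fun_prop) hfm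

/-- Integrating in `u` first leaves a power of `w`, and the fractional integral becomes a Beta
integral. Real `q` is needed: `0` gives total mass one, naturals give the Mittag-Leffler series, and
`-1/n` controls the heat kernel. -/
theorem lintegral_rpow_invLaw (hf : IsUnitStableDensity α f) (h0 : 0 < α) (h1 : α < 1) {q t : ℝ}
    (hq : -1 < q) (ht : 0 < t) :
    ∫⁻ u, ENNReal.ofReal (u ^ q) ∂(invLaw α f t) =
      ENNReal.ofReal (Real.Gamma (q + 1) * t ^ (α * q) / Real.Gamma (α * q + 1)) := by
  have hG1 := Real.Gamma_pos_of_pos (by linarith : 0 < 1 - α)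
  have hs : 0 < α * (q + 1) := mul_pos h0 (by linarith)
  have hG2 := Real.Gamma_pos_of_pos hs
  have hG3 := Real.Gamma_pos_of_pos (by linarith : 0 < q + 1)
  have hG4 := Real.Gamma_pos_of_pos (by nlinarith : 0 < α * q + 1)
  have hsm := hf.measurable_scaledDensity
  rw [invLaw, lintegral_withDensity_eq_lintegral_mul _ (hf.measurable_invDensity ht).ennreal_ofReal
    (by fun_prop)]
  calc _ = ∫⁻ u in Set.Ioi 0, ∫⁻ w in Set.Ioc 0 t, ENNReal.ofReal (1 / Real.Gamma (1 - α)) *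
        (ENNReal.ofReal ((t - w) ^ (1 - α - 1)) * ENNReal.ofReal (u ^ q * scaledDensity α f u w)) := by
        refine setLIntegral_congr_fun measurableSet_Ioi fun u (hu : 0 < u) => ?_
        rw [Pi.mul_apply, hf.ofReal_invDensity h1 hu ht, mul_assoc, mul_comm (∫⁻ _ in _, _),
          ← lintegral_const_mul' _ _ ENNReal.ofReal_ne_top,
          ← lintegral_const_mul' _ _ ENNReal.ofReal_ne_top]
        refine setLIntegral_congr_fun measurableSet_Ioc fun w hw => ?_
        have h2 := hf.scaledDensity_nonneg hu w
        have h3 : 0 ≤ (t - w) ^ (1 - α - 1) := Real.rpow_nonneg (by linarith [hw.2]) _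
        rw [← ENNReal.ofReal_mul (by positivity), ← ENNReal.ofReal_mul h3]
        congr 2; ring
    _ = ∫⁻ w in Set.Ioc 0 t, ∫⁻ u in Set.Ioi 0, ENNReal.ofReal (1 / Real.Gamma (1 - α)) *
        (ENNReal.ofReal ((t - w) ^ (1 - α - 1)) *
          ENNReal.ofReal (u ^ q * scaledDensity α f u w)) := by
        refine lintegral_lintegral_swap (Measurable.aemeasurable ?_)
        simp only [Function.uncurry_def]
        have hm1 : Measurable fun p : ℝ × ℝ => ENNReal.ofReal ((t - p.2) ^ (1 - α - 1)) := by
          fun_prop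
        have hm2 : Measurable fun p : ℝ × ℝ => p.1 ^ q := by fun_prop
        exact (hm1.mul (hm2.mul hsm).ennreal_ofReal).const_mul _
    _ = ∫⁻ w in Set.Ioc 0 t, ENNReal.ofReal (1 / Real.Gamma (1 - α) *
          (Real.Gamma (q + 1) / Real.Gamma (α * (q + 1)))) *
          ENNReal.ofReal (w ^ (α * (q + 1) - 1) * (t - w) ^ (1 - α - 1)) := by
        refine setLIntegral_congr_fun measurableSet_Ioc fun w hw => ?_
        have h3 : 0 ≤ (t - w) ^ (1 - α - 1) := Real.rpow_nonneg (by linarith [hw.2]) _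
        rw [lintegral_const_mul' _ _ ENNReal.ofReal_ne_top,
          lintegral_const_mul' _ _ ENNReal.ofReal_ne_top,
          hf.lintegral_rpow_mul_scaledDensity h0 hq hw.1, ← ENNReal.ofReal_mul h3,
          ← ENNReal.ofReal_mul (by positivity), ← ENNReal.ofReal_mul (by positivity)]
        congr 1; ring
    _ = _ := by
        rw [lintegral_const_mul' _ _ ENNReal.ofReal_ne_top,
          lintegral_beta hs (by linarith : 0 < 1 - α) ht, ← ENNReal.ofReal_mul (by positivity)]
        congr 1
        rw [show α * (q + 1) + (1 - α) - 1 = α * q by ring,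
          show α * (q + 1) + (1 - α) = α * q + 1 by ring]
        field_simp

theorem ae_pos_invLaw (t : ℝ) : ∀ᵐ u ∂(invLaw α f t), 0 < u :=
  (withDensity_absolutelyContinuous _ _).ae_le (ae_restrict_mem measurableSet_Ioi)

theorem isProbabilityMeasure_invLaw (hf : IsUnitStableDensity α f) (h0 : 0 < α) (h1 : α < 1)
    {t : ℝ} (ht : 0 < t) : IsProbabilityMeasure (invLaw α f t) := by
  have := hf.lintegral_rpow_invLaw h0 h1 (q := 0) (by norm_num) ht
  exact ⟨by simpa using this⟩

theorem integrable_rpow_invLaw (hf : IsUnitStableDensity α f) (h0 : 0 < α) (h1 : α < 1) {q t : ℝ}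
    (hq : -1 < q) (ht : 0 < t) : Integrable (fun u => u ^ q) (invLaw α f t) := by
  refine ⟨Measurable.aestronglyMeasurable (by fun_prop), ?_⟩
  rw [hasFiniteIntegral_iff_ofReal, hf.lintegral_rpow_invLaw h0 h1 hq ht]
  · exact ENNReal.ofReal_lt_top
  · filter_upwards [ae_pos_invLaw t] with u hu
    exact Real.rpow_nonneg hu.le _

theorem integral_pow_invLaw (hf : IsUnitStableDensity α f) (h0 : 0 < α) (h1 : α < 1) {t : ℝ}
    (ht : 0 < t) (m : ℕ) : ∫ u, u ^ m ∂(invLaw α f t) =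
      m.factorial * (t ^ α) ^ m / Real.Gamma (α * m + 1) := by
  have hm : (-1 : ℝ) < m := by linarith [Nat.cast_nonneg (α := ℝ) m]
  have h := hf.lintegral_rpow_invLaw h0 h1 hm ht
  simp only [Real.rpow_natCast] at h
  have := Real.Gamma_pos_of_pos (by positivity : 0 < α * m + 1)
  have := Real.Gamma_pos_of_pos (by positivity : 0 < (m + 1 : ℝ))
  rw [integral_eq_lintegral_of_nonneg_ae, h, ENNReal.toReal_ofReal (by positivity),
    Real.Gamma_nat_eq_factorial, Real.rpow_mul ht.le, Real.rpow_natCast]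
  · filter_upwards [ae_pos_invLaw t] with u hu
    exact pow_nonneg hu.le _
  · exact Continuous.aestronglyMeasurable (by fun_prop)

theorem integrable_pow_invLaw (hf : IsUnitStableDensity α f) (h0 : 0 < α) (h1 : α < 1) {t : ℝ}
    (ht : 0 < t) (m : ℕ) : Integrable (fun u => u ^ m) (invLaw α f t) := by
  have := hf.integrable_rpow_invLaw h0 h1 (q := m) (t := t)
    (by linarith [Nat.cast_nonneg (α := ℝ) m]) ht
  simpa using this

/-- Termwise integration of the exponential series; `p = 0` gives the generating function and `p =
1` its derivative. Since `(m+p)! ≤ 2^m m!`, the norms are dominated by a Mittag-Leffler series at an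
enlarged argument. -/
theorem hasSum_integral_pow_mul_exp_invLaw (hf : IsUnitStableDensity α f) (h0 : 0 < α) (h1 : α < 1)
    {t : ℝ} (ht : 0 < t) {p : ℕ} (hp : p ≤ 1) (w : ℂ) :
    HasSum (fun m : ℕ => w ^ m / m.factorial * (((m + p).factorial * (t ^ α) ^ (m + p) /
      Real.Gamma (α * (m + p : ℕ) + 1) : ℝ) : ℂ))
      (∫ u, (u : ℂ) ^ p * Complex.exp (w * u) ∂(invLaw α f t)) := by
  have hmom := hf.integral_pow_invLaw h0 h1 ht
  have hint := hf.integrable_pow_invLaw h0 h1 ht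
  have hF : ∀ m : ℕ, Integrable (fun u : ℝ => w ^ m / m.factorial * ((u ^ (m + p) : ℝ) : ℂ))
      (invLaw α f t) := fun m => ((hint (m + p)).ofReal (𝕜 := ℂ)).const_mul _
  have hnorm : ∀ m : ℕ, ∫ u : ℝ, ‖w ^ m / m.factorial * ((u ^ (m + p) : ℝ) : ℂ)‖ ∂(invLaw α f t) =
      ‖w‖ ^ m / m.factorial * ((m + p).factorial * (t ^ α) ^ (m + p) /
        Real.Gamma (α * (m + p : ℕ) + 1)) := fun m => by
    rw [← hmom, ← integral_const_mul]
    refine integral_congr_ae ?_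
    filter_upwards [ae_pos_invLaw t] with u hu
    rw [norm_mul, norm_div, norm_pow, Complex.norm_natCast, Complex.norm_real,
      Real.norm_of_nonneg (pow_nonneg hu.le _)]
  have hsum : Summable fun m : ℕ =>
      ∫ u : ℝ, ‖w ^ m / m.factorial * ((u ^ (m + p) : ℝ) : ℂ)‖ ∂(invLaw α f t) := by
    simp only [hnorm]
    have htα : 0 < t ^ α := Real.rpow_pos_of_pos ht _
    set y : ℝ := (2 * ‖w‖ + 1) * t ^ α with hy
    have hs := (summable_nat_add_iff p).2 (summable_mittagLeffler h0 (x := y) (by positivity))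
    refine Summable.of_nonneg_of_le (fun m => ?_) (fun m => ?_) hs
    · have := Real.Gamma_pos_of_pos (by positivity : 0 < α * (m + p : ℕ) + 1)
      positivity
    · have := Real.Gamma_pos_of_pos (by positivity : 0 < α * (m + p : ℕ) + 1)
      have hfac : ((m + p).factorial : ℝ) ≤ 2 ^ m * m.factorial := by
        interval_cases p
        · have : (1 : ℝ) ≤ 2 ^ m := one_le_pow₀ (by norm_num)
          simp only [add_zero]
          exact le_mul_of_one_le_left (by positivity) this
        · rw [Nat.factorial_succ]; push_cast
          gcongr
          exact_mod_cast Nat.lt_two_pow_self (n := m)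
      have hpow : (2 * ‖w‖) ^ m ≤ (2 * ‖w‖ + 1) ^ (m + p) := by
        calc (2 * ‖w‖) ^ m ≤ (2 * ‖w‖ + 1) ^ m := by gcongr; linarith
          _ ≤ _ := pow_le_pow_right₀ (by linarith [norm_nonneg w]) (by omega)
      rw [← mul_div_assoc]
      gcongr
      rw [hy, mul_pow]
      calc ‖w‖ ^ m / m.factorial * ((m + p).factorial * (t ^ α) ^ (m + p))
          ≤ ‖w‖ ^ m / m.factorial * (2 ^ m * m.factorial * (t ^ α) ^ (m + p)) := by gcongr
        _ = (2 * ‖w‖) ^ m * (t ^ α) ^ (m + p) := by rw [mul_pow]; field_simp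
        _ ≤ _ := by gcongr
  have h := hasSum_integral_of_summable_integral_norm hF hsum
  have he : ∫ u, (u : ℂ) ^ p * Complex.exp (w * u) ∂(invLaw α f t) =
      ∫ u : ℝ, ∑' m : ℕ, w ^ m / m.factorial * ((u ^ (m + p) : ℝ) : ℂ) ∂(invLaw α f t) := by
    refine integral_congr_ae (ae_of_all _ fun u => ?_)
    simp only
    have hexp := (NormedSpace.expSeries_div_hasSum_exp (w * (u : ℂ))).mul_left ((u : ℂ) ^ p)
    rw [← Complex.exp_eq_exp_ℂ] at hexp
    rw [← hexp.tsum_eq]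
    refine tsum_congr fun m => ?_
    push_cast
    rw [mul_pow, pow_add]; ring
  rw [he]
  refine h.congr_fun fun m => ?_
  rw [integral_const_mul, integral_complex_ofReal, hmom]

end IsUnitStableDensity

/-! ### The Mittag-Leffler function -/

/-- The Mittag-Leffler function `∑ wᵐ / Γ(α m + 1)`, as the moment generating function of the inverse
stable subordinator at time `1`. -/
noncomputable def mittagLeffler (α : ℝ) (f : ℝ → ℝ) (w : ℂ) : ℂ :=
  ∫ u, Complex.exp (w * u) ∂(invLaw α f 1)

/-- The derivative of the Mittag-Leffler function. -/
noncomputable def mittagLefflerDeriv (α : ℝ) (f : ℝ → ℝ) (w : ℂ) : ℂ :=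
  ∫ u, (u : ℂ) * Complex.exp (w * u) ∂(invLaw α f 1)

namespace IsUnitStableDensity

variable {α : ℝ} {f : ℝ → ℝ}

theorem hasSum_mittagLeffler (hf : IsUnitStableDensity α f) (h0 : 0 < α) (h1 : α < 1) (w : ℂ) :
    HasSum (fun m : ℕ => w ^ m / (Real.Gamma (α * m + 1) : ℂ)) (mittagLeffler α f w) := by
  have h := hf.hasSum_integral_pow_mul_exp_invLaw h0 h1 one_pos (p := 0) (by norm_num) w
  simp only [pow_zero, one_mul] at h
  refine h.congr_fun fun m => ?_
  have : (m.factorial : ℂ) ≠ 0 := by exact_mod_cast m.factorial_ne_zero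
  simp only [add_zero, Real.one_rpow, one_pow, mul_one]
  push_cast
  field_simp

theorem hasSum_mittagLefflerDeriv (hf : IsUnitStableDensity α f) (h0 : 0 < α) (h1 : α < 1) (w : ℂ) :
    HasSum (fun m : ℕ => (m + 1) * w ^ m / (Real.Gamma (α * (m + 1) + 1) : ℂ))
      (mittagLefflerDeriv α f w) := by
  have h := hf.hasSum_integral_pow_mul_exp_invLaw h0 h1 one_pos (p := 1) le_rfl w
  simp only [pow_one] at h
  refine h.congr_fun fun m => ?_
  have : (m.factorial : ℂ) ≠ 0 := by exact_mod_cast m.factorial_ne_zero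
  simp only [Real.one_rpow, one_pow, mul_one, Nat.factorial_succ]
  push_cast
  field_simp

theorem integral_exp_invLaw (hf : IsUnitStableDensity α f) (h0 : 0 < α) (h1 : α < 1) {t : ℝ}
    (ht : 0 < t) (w : ℂ) :
    ∫ u, Complex.exp (w * u) ∂(invLaw α f t) = mittagLeffler α f (w * (t ^ α : ℝ)) := by
  have h := hf.hasSum_integral_pow_mul_exp_invLaw h0 h1 ht (p := 0) (by norm_num) w
  simp only [pow_zero, one_mul] at h
  refine h.unique ((hf.hasSum_mittagLeffler h0 h1 _).congr_fun fun m => ?_)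
  have : (m.factorial : ℂ) ≠ 0 := by exact_mod_cast m.factorial_ne_zero
  simp only [add_zero]
  push_cast
  rw [mul_pow]
  field_simp

/-- For `v ≥ 0` the integral equals a series of nonnegative terms beginning with `1`, so it cannot
be the default value `0`. -/
theorem integrable_exp_invLaw (hf : IsUnitStableDensity α f) (h0 : 0 < α) (h1 : α < 1) (v : ℝ) :
    Integrable (fun u => Real.exp (v * u)) (invLaw α f 1) := by
  have := hf.isProbabilityMeasure_invLaw h0 h1 one_pos
  rcases le_total v 0 with hv | hv
  · refine Integrable.of_bound (C := 1) (Continuous.aestronglyMeasurable (by fun_prop)) ?_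
    filter_upwards [ae_pos_invLaw 1] with u hu
    rw [Real.norm_of_nonneg (Real.exp_pos _).le, Real.exp_le_one_iff]
    exact mul_nonpos_of_nonpos_of_nonneg hv hu.le
  · have h := Complex.hasSum_re (hf.hasSum_mittagLeffler h0 h1 v)
    have hre : ∀ m : ℕ, ((v : ℂ) ^ m / (Real.Gamma (α * m + 1) : ℂ)).re =
        v ^ m / Real.Gamma (α * m + 1) := fun m => by
      rw [← Complex.ofReal_pow, ← Complex.ofReal_div, Complex.ofReal_re]
    simp only [hre] at h
    have hle := le_hasSum h 0 (fun m _ => div_nonneg (pow_nonneg hv _)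
      (Real.Gamma_pos_of_pos (by positivity)).le)
    simp only [pow_zero, Nat.cast_zero, mul_zero, zero_add, Real.Gamma_one, div_one] at hle
    by_contra hi
    have hz : mittagLeffler α f v = 0 := by
      refine integral_undef fun hc => hi ?_
      refine hc.norm.congr (ae_of_all _ fun u => ?_)
      simp only [Complex.norm_exp]
      simp
    rw [hz] at hle
    norm_num at hle

theorem hasDerivAt_mittagLeffler (hf : IsUnitStableDensity α f) (h0 : 0 < α) (h1 : α < 1) (w : ℂ) :
    HasDerivAt (mittagLeffler α f) (mittagLefflerDeriv α f w) w := by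
  have hset : ProbabilityTheory.integrableExpSet id (invLaw α f 1) = Set.univ :=
    Set.eq_univ_of_forall fun v => hf.integrable_exp_invLaw h0 h1 v
  exact ProbabilityTheory.hasDerivAt_complexMGF (X := id) (μ := invLaw α f 1) (z := w)
    (by rw [hset, interior_univ]; trivial)

theorem continuous_mittagLeffler (hf : IsUnitStableDensity α f) (h0 : 0 < α) (h1 : α < 1) :
    Continuous (mittagLeffler α f) :=
  continuous_iff_continuousAt.2 fun w => (hf.hasDerivAt_mittagLeffler h0 h1 w).continuousAt

theorem continuous_mittagLefflerDeriv (hf : IsUnitStableDensity α f) (h0 : 0 < α) (h1 : α < 1) :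
    Continuous (mittagLefflerDeriv α f) := by
  have hd : Differentiable ℂ (mittagLeffler α f) := fun w =>
    (hf.hasDerivAt_mittagLeffler h0 h1 w).differentiableAt
  have e : mittagLefflerDeriv α f = deriv (mittagLeffler α f) :=
    funext fun w => (hf.hasDerivAt_mittagLeffler h0 h1 w).deriv.symm
  rw [e]
  exact (hd.contDiff (n := 1)).continuous_deriv le_rfl

/-- Immediate from the probabilistic definition but invisible in the power series. The imaginary
axis must be included, as it carries the odd-order symbols. -/
theorem norm_mittagLeffler_le (hf : IsUnitStableDensity α f) (h0 : 0 < α) (h1 : α < 1) {w : ℂ}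
    (hw : w.re ≤ 0) : ‖mittagLeffler α f w‖ ≤ 1 := by
  have := hf.isProbabilityMeasure_invLaw h0 h1 one_pos
  refine (norm_integral_le_of_norm_le_const (C := 1) ?_).trans_eq (by simp)
  filter_upwards [ae_pos_invLaw 1] with u hu
  rw [Complex.norm_exp, Real.exp_le_one_iff, Complex.re_mul_ofReal]
  exact mul_nonpos_of_nonpos_of_nonneg hw hu.le

theorem norm_mittagLefflerDeriv_le (hf : IsUnitStableDensity α f) (h0 : 0 < α) (h1 : α < 1) {w : ℂ}
    (hw : w.re ≤ 0) : ‖mittagLefflerDeriv α f w‖ ≤ 1 / Real.Gamma (α + 1) := by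
  have hm := hf.integral_pow_invLaw h0 h1 one_pos 1
  simp only [pow_one, Nat.factorial_one, Nat.cast_one, Real.one_rpow, mul_one] at hm
  rw [← hm]
  have hi := hf.integrable_pow_invLaw h0 h1 one_pos 1
  simp only [pow_one] at hi
  refine norm_integral_le_of_norm_le hi ?_
  filter_upwards [ae_pos_invLaw 1] with u hu
  rw [norm_mul, Complex.norm_real, Real.norm_of_nonneg hu.le]
  refine mul_le_of_le_one_right hu.le ?_
  rw [Complex.norm_exp, Real.exp_le_one_iff, Complex.re_mul_ofReal]
  exact mul_nonpos_of_nonpos_of_nonneg hw hu.le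

theorem mittagLeffler_zero (hf : IsUnitStableDensity α f) (h0 : 0 < α) (h1 : α < 1) :
    mittagLeffler α f 0 = 1 := by
  have := hf.isProbabilityMeasure_invLaw h0 h1 one_pos
  simp [mittagLeffler]

theorem hasDerivAt_mittagLeffler_rpow (hf : IsUnitStableDensity α f) (h0 : 0 < α) (h1 : α < 1)
    (c : ℂ) {t : ℝ} (ht : 0 < t) :
    HasDerivAt (fun s : ℝ => mittagLeffler α f (c * (s ^ α : ℝ)))
      (c * (α * t ^ (α - 1) : ℝ) * mittagLefflerDeriv α f (c * (t ^ α : ℝ))) t := by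
  have h2 : HasDerivAt (fun s : ℝ => c * ((s ^ α : ℝ) : ℂ)) (c * (α * t ^ (α - 1) : ℝ)) t :=
    ((Real.hasDerivAt_rpow_const (Or.inl ht.ne')).ofReal_comp).const_mul c
  have := (hf.hasDerivAt_mittagLeffler h0 h1 (c * (t ^ α : ℝ))).comp t h2
  exact this.congr_deriv (mul_comm _ _)

/-- The Caputo equation for `t ↦ E_α(c t^α)`. -/
theorem integral_caputo_mittagLeffler (hf : IsUnitStableDensity α f) (h0 : 0 < α) (h1 : α < 1)
    (c : ℂ) {t : ℝ} (ht : 0 < t) :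
    ∫ s in (0 : ℝ)..t, ((t - s) ^ (-α) : ℝ) *
        (c * (α * s ^ (α - 1) : ℝ) * mittagLefflerDeriv α f (c * (s ^ α : ℝ))) =
      Real.Gamma (1 - α) * (c * mittagLeffler α f (c * (t ^ α : ℝ))) := by
  have hG1 := Real.Gamma_pos_of_pos (by linarith : 0 < 1 - α)
  have hΓ : ∀ m : ℕ, 0 < Real.Gamma (α * (m + 1)) := fun m =>
    Real.Gamma_pos_of_pos (by positivity)
  have hΓ' : ∀ m : ℕ, 0 < Real.Gamma (α * m + 1) := fun m => Real.Gamma_pos_of_pos (by positivity)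
  -- The terms of the integrand, after cancelling `α(m+1)` by `Γ(α(m+1)+1) = α(m+1) Γ(α(m+1))`. The
  -- Beta integral replaces `Γ(α(m+1))` by `Γ(αm+1)`, which reproduces the original series times
  -- `c`.
  set F : ℕ → ℝ → ℂ := fun m s => c ^ (m + 1) / (Real.Gamma (α * (m + 1)) : ℂ) *
    ((s ^ (α * (m + 1) - 1) * (t - s) ^ (1 - α - 1) : ℝ) : ℂ) with hF
  have hbeta : ∀ m : ℕ, ∫ s in Set.Ioc 0 t, s ^ (α * (m + 1 : ℝ) - 1) * (t - s) ^ (1 - α - 1) =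
      (t ^ α) ^ m * (Real.Gamma (α * (m + 1)) * Real.Gamma (1 - α) / Real.Gamma (α * m + 1)) := by
    intro m
    have := integral_beta (a := α * (m + 1)) (b := 1 - α) (by positivity) (by linarith) ht
    rw [intervalIntegral.integral_of_le ht.le,
      show α * ((m : ℝ) + 1) + (1 - α) - 1 = α * m by ring,
      show α * ((m : ℝ) + 1) + (1 - α) = α * m + 1 by ring, Real.rpow_mul ht.le,
      Real.rpow_natCast] at this
    exact this
  have hint : ∀ m : ℕ, Integrable (fun s => s ^ (α * (m + 1 : ℝ) - 1) * (t - s) ^ (1 - α - 1))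
      (volume.restrict (Set.Ioc 0 t)) := fun m =>
    (intervalIntegrable_iff_integrableOn_Ioc_of_le ht.le).1
      (intervalIntegrable_beta (by positivity) (by linarith) ht)
  have hFi : ∀ m, Integrable (F m) (volume.restrict (Set.Ioc 0 t)) := fun m =>
    ((hint m).ofReal (𝕜 := ℂ)).const_mul _
  have hFn : ∀ m : ℕ, ∫ s in Set.Ioc 0 t, ‖F m s‖ =
      ‖c‖ * Real.Gamma (1 - α) * ((‖c‖ * t ^ α) ^ m / Real.Gamma (α * m + 1)) := fun m => by
    have : ∫ s in Set.Ioc 0 t, ‖F m s‖ = ∫ s in Set.Ioc 0 t,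
        ‖c‖ ^ (m + 1) / Real.Gamma (α * (m + 1)) *
          (s ^ (α * (m + 1 : ℝ) - 1) * (t - s) ^ (1 - α - 1)) := by
      refine setIntegral_congr_fun measurableSet_Ioc fun s hs => ?_
      have h2 : 0 ≤ s ^ (α * (m + 1 : ℝ) - 1) * (t - s) ^ (1 - α - 1) :=
        mul_nonneg (Real.rpow_nonneg hs.1.le _) (Real.rpow_nonneg (by linarith [hs.2]) _)
      simp only [hF]
      rw [norm_mul, norm_div, norm_pow, Complex.norm_real, Complex.norm_real,
        Real.norm_of_nonneg h2, Real.norm_of_nonneg (hΓ m).le]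
    rw [this, integral_const_mul, hbeta]
    have := (hΓ m).ne'
    have := (hΓ' m).ne'
    rw [mul_pow]
    field_simp
    ring
  have hsum : Summable fun m => ∫ s in Set.Ioc 0 t, ‖F m s‖ := by
    simp only [hFn]
    exact (summable_mittagLeffler h0 (by positivity)).mul_left _
  have key := hasSum_integral_of_summable_integral_norm hFi hsum
  have hL : ∫ s in (0 : ℝ)..t, ((t - s) ^ (-α) : ℝ) *
        (c * (α * s ^ (α - 1) : ℝ) * mittagLefflerDeriv α f (c * (s ^ α : ℝ))) =
      ∫ s in Set.Ioc 0 t, ∑' m, F m s := by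
    rw [intervalIntegral.integral_of_le ht.le]
    refine setIntegral_congr_fun measurableSet_Ioc fun s hs => ?_
    have hs0 : 0 < s := hs.1
    have h2 := ((hf.hasSum_mittagLefflerDeriv h0 h1 (c * (s ^ α : ℝ))).mul_left
      (c * (α * s ^ (α - 1) : ℝ))).mul_left (((t - s) ^ (-α) : ℝ) : ℂ)
    rw [← h2.tsum_eq]
    refine tsum_congr fun m => ?_
    have e1 : Real.Gamma (α * (m + 1) + 1) = α * (m + 1) * Real.Gamma (α * (m + 1)) :=
      Real.Gamma_add_one (by positivity)
    have e2 : s ^ (α * ((m : ℝ) + 1) - 1) = s ^ (α - 1) * (s ^ α) ^ m := by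
      rw [← Real.rpow_natCast, ← Real.rpow_mul hs0.le, ← Real.rpow_add hs0]; ring_nf
    simp only [hF]
    rw [e1, e2, show 1 - α - 1 = -α by ring]
    have h3 : (Real.Gamma (α * (m + 1)) : ℂ) ≠ 0 := by exact_mod_cast (hΓ m).ne'
    have h4 : (α : ℂ) ≠ 0 := by exact_mod_cast h0.ne'
    have h5 : ((m : ℂ) + 1) ≠ 0 := by exact_mod_cast Nat.succ_ne_zero m
    push_cast
    rw [mul_pow]
    field_simp
    ring
  rw [hL]
  refine key.unique ?_
  refine (((hf.hasSum_mittagLeffler h0 h1 (c * (t ^ α : ℝ))).mul_left c).mul_left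
    (Real.Gamma (1 - α) : ℂ)).congr_fun fun m => ?_
  simp only [hF]
  rw [integral_const_mul, integral_complex_ofReal, hbeta]
  have h3 : (Real.Gamma (α * (m + 1)) : ℂ) ≠ 0 := by exact_mod_cast (hΓ m).ne'
  have h4 : (Real.Gamma (α * m + 1) : ℂ) ≠ 0 := by exact_mod_cast (hΓ' m).ne'
  push_cast
  rw [mul_pow]
  field_simp
  ring

end IsUnitStableDensity

/-! ### The subordinated kernel -/

namespace IsUnitStableDensity

variable {α : ℝ} {f : ℝ → ℝ}

theorem integral_invLaw (hf : IsUnitStableDensity α f) (h1 : α < 1) {t : ℝ} (ht : 0 < t)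
    (g : ℝ → ℂ) :
    ∫ u, g u ∂(invLaw α f t) = ∫ u in Set.Ioi 0, g u * (invDensity α f u t : ℝ) := by
  rw [invLaw, integral_withDensity_eq_integral_toReal_smul
    (hf.measurable_invDensity ht).ennreal_ofReal (ae_of_all _ fun _ => ENNReal.ofReal_lt_top)]
  refine setIntegral_congr_fun measurableSet_Ioi fun u (hu : 0 < u) => ?_
  rw [ENNReal.toReal_ofReal (hf.invDensity_nonneg h1 hu ht), Complex.real_smul, mul_comm]

theorem integrable_invLaw_iff (hf : IsUnitStableDensity α f) (h1 : α < 1) {t : ℝ} (ht : 0 < t)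
    (g : ℝ → ℂ) :
    Integrable g (invLaw α f t) ↔
      IntegrableOn (fun u => g u * (invDensity α f u t : ℝ)) (Set.Ioi 0) := by
  rw [invLaw, integrable_withDensity_iff_integrable_smul'
    (hf.measurable_invDensity ht).ennreal_ofReal (ae_of_all _ fun _ => ENNReal.ofReal_lt_top),
    IntegrableOn]
  refine integrable_congr ?_
  filter_upwards [ae_restrict_mem measurableSet_Ioi] with u (hu : 0 < u)
  rw [ENNReal.toReal_ofReal (hf.invDensity_nonneg h1 hu ht), Complex.real_smul, mul_comm]

theorem subordinatedKernel_eq (hf : IsUnitStableDensity α f) (h1 : α < 1) (n : ℕ) (k x : ℝ) {t : ℝ}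
    (ht : 0 < t) : subordinatedKernel α n k (scaledDensity α f) x t =
      ∫ u, heatKernel n k x u ∂(invLaw α f t) := by
  rw [hf.integral_invLaw h1 ht]; rfl

theorem integrable_rpow_invLaw_order (hf : IsUnitStableDensity α f) (h0 : 0 < α) (h1 : α < 1)
    {n : ℕ} (hn : 2 ≤ n) {t : ℝ} (ht : 0 < t) :
    Integrable (fun u => u ^ (-(1 / (n : ℝ)))) (invLaw α f t) := by
  refine hf.integrable_rpow_invLaw h0 h1 ?_ ht
  have : (2 : ℝ) ≤ n := by exact_mod_cast hn
  rw [neg_lt_neg_iff, div_lt_one (by linarith)]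
  linarith

theorem invLaw_absolutelyContinuous (t : ℝ) :
    invLaw α f t ≪ volume.restrict (Set.Ioi 0) := withDensity_absolutelyContinuous _ _

theorem integrable_heatKernel_invLaw (hf : IsUnitStableDensity α f) (h0 : 0 < α) (h1 : α < 1)
    {n : ℕ} (hn : 2 ≤ n) {k : ℝ} (hk : IsHeatCoeff n k) (x : ℝ) {t : ℝ} (ht : 0 < t) :
    Integrable (fun u => heatKernel n k x u) (invLaw α f t) := by
  obtain ⟨C, hC, -, hb⟩ := exists_norm_heatKernelTrunc_le hn hk
  refine ((hf.integrable_rpow_invLaw_order h0 h1 hn ht).const_mul C).mono'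
    ((aestronglyMeasurable_heatKernel_right hn hk x).mono_ac (invLaw_absolutelyContinuous t)) ?_
  filter_upwards [ae_pos_invLaw t] with u hu
  exact hb x u hu

theorem continuous_subordinatedKernel (hf : IsUnitStableDensity α f) (h0 : 0 < α) (h1 : α < 1)
    {n : ℕ} (hn : 2 ≤ n) {k : ℝ} (hk : IsHeatCoeff n k) {t : ℝ} (ht : 0 < t) :
    Continuous fun x => subordinatedKernel α n k (scaledDensity α f) x t := by
  obtain ⟨C, hC, -, hb⟩ := exists_norm_heatKernelTrunc_le hn hk
  simp only [hf.subordinatedKernel_eq h1 n k _ ht]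
  refine continuous_of_dominated (bound := fun u => C * u ^ (-(1 / (n : ℝ))))
    (fun x => (hf.integrable_heatKernel_invLaw h0 h1 hn hk x ht).aestronglyMeasurable)
    (fun x => ?_) ((hf.integrable_rpow_invLaw_order h0 h1 hn ht).const_mul C) ?_
  · filter_upwards [ae_pos_invLaw t] with u hu
    exact hb x u hu
  · filter_upwards [ae_pos_invLaw t] with u hu
    exact continuous_heatKernel hn hk hu

theorem exists_norm_subordinatedKernel_le (hf : IsUnitStableDensity α f) (h0 : 0 < α) (h1 : α < 1)
    {n : ℕ} (hn : 2 ≤ n) {k : ℝ} (hk : IsHeatCoeff n k) {t : ℝ} (ht : 0 < t) :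
    ∃ C : ℝ, ∀ x, ‖subordinatedKernel α n k (scaledDensity α f) x t‖ ≤ C := by
  obtain ⟨C, hC, -, hb⟩ := exists_norm_heatKernelTrunc_le hn hk
  refine ⟨∫ u, C * u ^ (-(1 / (n : ℝ))) ∂(invLaw α f t), fun x => ?_⟩
  rw [hf.subordinatedKernel_eq h1 n k _ ht]
  refine norm_integral_le_of_norm_le ((hf.integrable_rpow_invLaw_order h0 h1 hn ht).const_mul C) ?_
  filter_upwards [ae_pos_invLaw t] with u hu
  exact hb x u hu

/-- The pairing of the subordinated kernel with a test function, on the Fourier side. -/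
theorem pairing_subordinatedKernel (hf : IsUnitStableDensity α f) (h0 : 0 < α) (h1 : α < 1)
    {n : ℕ} (hn : 2 ≤ n) {k : ℝ} (hk : IsHeatCoeff n k) {φ : ℝ → ℂ} (hφ : Integrable φ)
    (hφ' : Integrable (fourierPlus φ)) {t : ℝ} (ht : 0 < t) :
    pairing (subordinatedKernel α n k (scaledDensity α f)) φ t = (1 / (2 * Real.pi) : ℂ) *
      ∫ z : ℝ, fourierPlus φ z *
        mittagLeffler α f (k * (Complex.I * z) ^ n * (t ^ α : ℝ)) := by
  have := hf.isProbabilityMeasure_invLaw h0 h1 ht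
  obtain ⟨C, hC, -, hb⟩ := exists_norm_heatKernelTrunc_le hn hk
  -- The majorant here is `C u^(-1/n) |φ(x)|`. In the later exchange of `u` and `z` it is
  -- `|fourierPlus φ z|`, because the symbol has nonpositive real part.
  have hswap : ∫ x, (∫ u, heatKernel n k x u * φ x ∂(invLaw α f t)) =
      ∫ u, (∫ x, heatKernel n k x u * φ x) ∂(invLaw α f t) := by
    refine integral_integral_swap ?_
    have hi : Integrable (fun p : ℝ × ℝ => φ p.1 * ((C * p.2 ^ (-(1 / (n : ℝ))) : ℝ) : ℂ))
        (volume.prod (invLaw α f t)) :=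
      hφ.mul_prod (((hf.integrable_rpow_invLaw_order h0 h1 hn ht).const_mul C).ofReal (𝕜 := ℂ))
    refine hi.mono ?_ ?_
    · refine AEStronglyMeasurable.mul ?_ hφ.aestronglyMeasurable.comp_fst
      exact (aestronglyMeasurable_heatKernel hn hk volume).mono_ac
        (Measure.AbsolutelyContinuous.prod Measure.AbsolutelyContinuous.rfl
          (invLaw_absolutelyContinuous t))
    · have : ∀ᵐ p : ℝ × ℝ ∂(volume.prod (invLaw α f t)), 0 < p.2 :=
        Measure.quasiMeasurePreserving_snd.ae (ae_pos_invLaw t)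
      filter_upwards [this] with p hp
      simp only [Function.uncurry_def]
      rw [norm_mul, norm_mul, mul_comm, Complex.norm_real]
      gcongr
      exact (hb p.1 p.2 hp).trans (le_abs_self _)
  have hE : ∀ᵐ u ∂(invLaw α f t), ∫ x, heatKernel n k x u * φ x = (1 / (2 * Real.pi) : ℂ) *
      ∫ z : ℝ, Complex.exp (k * u * (Complex.I * z) ^ n) * fourierPlus φ z := by
    filter_upwards [ae_pos_invLaw t] with u hu
    exact integral_heatKernel_mul hn hk hφ hφ' hu
  rw [pairing]
  simp only [hf.subordinatedKernel_eq h1 n k _ ht, ← integral_mul_const]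
  rw [hswap, integral_congr_ae hE, integral_const_mul, integral_integral_swap]
  · congr 1
    refine integral_congr_ae (ae_of_all _ fun z => ?_)
    simp only
    rw [integral_mul_const, mul_comm, ← hf.integral_exp_invLaw h0 h1 ht]
    congr 1
    refine integral_congr_ae (ae_of_all _ fun u => ?_)
    simp only
    congr 1; ring
  · have hi : Integrable (fun p : ℝ × ℝ => (1 : ℂ) * fourierPlus φ p.2)
        ((invLaw α f t).prod volume) := (integrable_const (1 : ℂ)).mul_prod hφ'
    refine hi.mono ?_ ?_
    · refine AEStronglyMeasurable.mul (Continuous.aestronglyMeasurable (by fun_prop))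
        hφ'.aestronglyMeasurable.comp_snd
    · have : ∀ᵐ p : ℝ × ℝ ∂((invLaw α f t).prod volume), 0 < p.1 :=
        Measure.quasiMeasurePreserving_fst.ae (ae_pos_invLaw t)
      filter_upwards [this] with p hp
      simp only [Function.uncurry_def]
      rw [norm_mul, norm_mul]
      gcongr
      simpa [heatPhase] using norm_exp_heatPhase_le hk 0 hp.le p.2

/-! ### Superpositions of Mittag-Leffler functions -/

section Superposition

variable {c ψ : ℝ → ℂ}

/-- The only singularity in time is `t^(α-1)`, which is locally bounded on `(0, ∞)` and integrable
at `0`, even against the Caputo kernel, by the Beta integral. -/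
theorem norm_superposition_deriv_le (hf : IsUnitStableDensity α f) (h0 : 0 < α) (h1 : α < 1)
    (hcr : ∀ z, (c z).re ≤ 0) {t : ℝ} (ht : 0 < t) (z : ℝ) :
    ‖c z * (α * t ^ (α - 1) : ℝ) * mittagLefflerDeriv α f (c z * (t ^ α : ℝ)) * ψ z‖ ≤
      α * t ^ (α - 1) * (1 / Real.Gamma (α + 1)) * ‖c z * ψ z‖ := by
  have hr : (c z * (t ^ α : ℝ)).re ≤ 0 := by
    rw [Complex.re_mul_ofReal]
    exact mul_nonpos_of_nonpos_of_nonneg (hcr z) (Real.rpow_pos_of_pos ht _).le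
  have hb := hf.norm_mittagLefflerDeriv_le h0 h1 hr
  have hp : 0 < t ^ (α - 1) := Real.rpow_pos_of_pos ht _
  rw [norm_mul, norm_mul, norm_mul, norm_mul, Complex.norm_real, Real.norm_of_nonneg (by positivity)]
  calc _ = α * t ^ (α - 1) * ‖mittagLefflerDeriv α f (c z * (t ^ α : ℝ))‖ * (‖c z‖ * ‖ψ z‖) := by
        ring
    _ ≤ _ := by gcongr

theorem hasDerivAt_superposition (hf : IsUnitStableDensity α f) (h0 : 0 < α) (h1 : α < 1)
    (hc : Continuous c) (hcr : ∀ z, (c z).re ≤ 0) (hψ : Integrable ψ)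
    (hcψ : Integrable fun z => c z * ψ z) {t : ℝ} (ht : 0 < t) :
    HasDerivAt (fun s : ℝ => ∫ z, mittagLeffler α f (c z * (s ^ α : ℝ)) * ψ z)
      (∫ z, c z * (α * t ^ (α - 1) : ℝ) * mittagLefflerDeriv α f (c z * (t ^ α : ℝ)) * ψ z) t := by
  have hG := hf.continuous_mittagLeffler h0 h1
  have hG' := hf.continuous_mittagLefflerDeriv h0 h1
  refine (hasDerivAt_integral_of_dominated_loc_of_deriv_le (s := Set.Ioi (t / 2))
    (bound := fun z => α * (t / 2) ^ (α - 1) * (1 / Real.Gamma (α + 1)) * ‖c z * ψ z‖)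
    (F' := fun s z => c z * (α * s ^ (α - 1) : ℝ) * mittagLefflerDeriv α f (c z * (s ^ α : ℝ)) * ψ z)
    (Ioi_mem_nhds (by linarith)) ?_ ?_ ?_ ?_ ?_ ?_).2
  · exact Eventually.of_forall fun s => AEStronglyMeasurable.mul
      (Continuous.aestronglyMeasurable (by fun_prop)) hψ.aestronglyMeasurable
  · refine hψ.bdd_mul (c := 1) (Continuous.aestronglyMeasurable (by fun_prop))
      (ae_of_all _ fun z => hf.norm_mittagLeffler_le h0 h1 ?_)
    rw [Complex.re_mul_ofReal]
    exact mul_nonpos_of_nonpos_of_nonneg (hcr z) (Real.rpow_pos_of_pos ht _).le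
  · exact AEStronglyMeasurable.mul
      (Continuous.aestronglyMeasurable (by fun_prop)) hψ.aestronglyMeasurable
  · refine ae_of_all _ fun z s (hs : t / 2 < s) => ?_
    have hG2 := Real.Gamma_pos_of_pos (by linarith : 0 < α + 1)
    refine (hf.norm_superposition_deriv_le h0 h1 hcr (by linarith) z).trans ?_
    have : s ^ (α - 1) ≤ (t / 2) ^ (α - 1) :=
      Real.rpow_le_rpow_of_nonpos (by linarith) hs.le (by linarith)
    gcongr
  · exact hcψ.norm.const_mul _
  · refine ae_of_all _ fun z s (hs : t / 2 < s) => ?_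
    exact (hf.hasDerivAt_mittagLeffler_rpow h0 h1 (c z) (by linarith)).mul_const _

theorem continuousOn_superposition_deriv (hf : IsUnitStableDensity α f) (h0 : 0 < α) (h1 : α < 1)
    (hc : Continuous c) (hcr : ∀ z, (c z).re ≤ 0) (hψ : Integrable ψ)
    (hcψ : Integrable fun z => c z * ψ z) :
    ContinuousOn (fun t : ℝ => ∫ z, c z * (α * t ^ (α - 1) : ℝ) *
      mittagLefflerDeriv α f (c z * (t ^ α : ℝ)) * ψ z) (Set.Ioi 0) := by
  have hG' := hf.continuous_mittagLefflerDeriv h0 h1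
  intro t (ht : 0 < t)
  refine ContinuousAt.continuousWithinAt ?_
  refine continuousAt_of_dominated
    (bound := fun z => α * (t / 2) ^ (α - 1) * (1 / Real.Gamma (α + 1)) * ‖c z * ψ z‖) ?_ ?_
    (hcψ.norm.const_mul _) ?_
  · exact Eventually.of_forall fun s => AEStronglyMeasurable.mul
      (Continuous.aestronglyMeasurable (by fun_prop)) hψ.aestronglyMeasurable
  · filter_upwards [Ioi_mem_nhds (by linarith : t / 2 < t)] with s (hs : t / 2 < s)
    refine ae_of_all _ fun z => ?_
    have hG2 := Real.Gamma_pos_of_pos (by linarith : 0 < α + 1)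
    refine (hf.norm_superposition_deriv_le h0 h1 hcr (by linarith) z).trans ?_
    have : s ^ (α - 1) ≤ (t / 2) ^ (α - 1) :=
      Real.rpow_le_rpow_of_nonpos (by linarith) hs.le (by linarith)
    gcongr
  · refine ae_of_all _ fun z => ?_
    have e1 : ContinuousAt (fun s : ℝ => s ^ (α - 1)) t :=
      Real.continuousAt_rpow_const _ _ (Or.inl ht.ne')
    have e2 : ContinuousAt (fun s : ℝ => s ^ α) t :=
      Real.continuousAt_rpow_const _ _ (Or.inl ht.ne')
    have e3 : ContinuousAt (fun s : ℝ => c z * ((s ^ α : ℝ) : ℂ)) t :=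
      continuousAt_const.mul (Complex.continuous_ofReal.continuousAt.comp e2)
    have e4 : ContinuousAt (fun s : ℝ => ((α * s ^ (α - 1) : ℝ) : ℂ)) t :=
      Complex.continuous_ofReal.continuousAt.comp (continuousAt_const.mul e1)
    have e5 : ContinuousAt (fun s : ℝ => mittagLefflerDeriv α f (c z * ((s ^ α : ℝ) : ℂ))) t :=
      hG'.continuousAt.comp e3
    exact ((continuousAt_const.mul e4).mul e5).mul continuousAt_const

theorem tendsto_superposition_zero (hf : IsUnitStableDensity α f) (h0 : 0 < α) (h1 : α < 1)
    (hc : Continuous c) (hcr : ∀ z, (c z).re ≤ 0) (hψ : Integrable ψ) :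
    Tendsto (fun s : ℝ => ∫ z, mittagLeffler α f (c z * (s ^ α : ℝ)) * ψ z) (𝓝[>] 0)
      (𝓝 (∫ z, ψ z)) := by
  have hG := hf.continuous_mittagLeffler h0 h1
  refine tendsto_integral_filter_of_dominated_convergence (fun z => ‖ψ z‖) ?_ ?_ hψ.norm ?_
  · exact Eventually.of_forall fun s => AEStronglyMeasurable.mul
      (Continuous.aestronglyMeasurable (by fun_prop)) hψ.aestronglyMeasurable
  · filter_upwards [self_mem_nhdsWithin] with s (hs : 0 < s)
    refine ae_of_all _ fun z => ?_
    rw [norm_mul]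
    refine mul_le_of_le_one_left (norm_nonneg _) (hf.norm_mittagLeffler_le h0 h1 ?_)
    rw [Complex.re_mul_ofReal]
    exact mul_nonpos_of_nonpos_of_nonneg (hcr z) (Real.rpow_pos_of_pos hs _).le
  · refine ae_of_all _ fun z => ?_
    have e2 : ContinuousAt (fun s : ℝ => s ^ α) 0 := Real.continuousAt_rpow_const _ _ (Or.inr h0.le)
    have e3 : ContinuousAt (fun s : ℝ => c z * ((s ^ α : ℝ) : ℂ)) 0 :=
      continuousAt_const.mul (Complex.continuous_ofReal.continuousAt.comp e2)
    have e5 : ContinuousAt (fun s : ℝ => mittagLeffler α f (c z * ((s ^ α : ℝ) : ℂ)) * ψ z) 0 :=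
      (ContinuousAt.comp (f := fun s : ℝ => c z * ((s ^ α : ℝ) : ℂ)) hG.continuousAt e3).mul
        continuousAt_const
    have e6 := e5.tendsto.mono_left (nhdsWithin_le_nhds (s := Set.Ioi 0))
    simpa [Real.zero_rpow h0.ne', hf.mittagLeffler_zero h0 h1] using e6

theorem integral_caputo_superposition (hf : IsUnitStableDensity α f) (h0 : 0 < α) (h1 : α < 1)
    (hc : Continuous c) (hcr : ∀ z, (c z).re ≤ 0) (hψ : Integrable ψ)
    (hcψ : Integrable fun z => c z * ψ z) {t : ℝ} (ht : 0 < t) :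
    ∫ s in (0 : ℝ)..t, ((t - s) ^ (-α) : ℝ) * ∫ z, c z * (α * s ^ (α - 1) : ℝ) *
        mittagLefflerDeriv α f (c z * (s ^ α : ℝ)) * ψ z =
      Real.Gamma (1 - α) * ∫ z, mittagLeffler α f (c z * (t ^ α : ℝ)) * (c z * ψ z) := by
  have hG' := (hf.continuous_mittagLefflerDeriv h0 h1).measurable
  rw [intervalIntegral.integral_of_le ht.le]
  simp only [← integral_const_mul]
  rw [integral_integral_swap]
  · refine integral_congr_ae (ae_of_all _ fun z => ?_)
    have h2 := hf.integral_caputo_mittagLeffler h0 h1 (c z) ht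
    rw [intervalIntegral.integral_of_le ht.le] at h2
    simp only [← mul_assoc] at h2 ⊢
    rw [integral_mul_const, h2]
    ring
  · have hbeta := (intervalIntegrable_iff_integrableOn_Ioc_of_le ht.le).1
      (intervalIntegrable_beta (a := α) (b := 1 - α) h0 (by linarith) ht)
    have hi : Integrable (fun p : ℝ × ℝ => ((α * (1 / Real.Gamma (α + 1)) *
        (p.1 ^ (α - 1) * (t - p.1) ^ (1 - α - 1)) : ℝ) : ℂ) * (c p.2 * ψ p.2))
        ((volume.restrict (Set.Ioc 0 t)).prod volume) :=
      ((hbeta.const_mul (α * (1 / Real.Gamma (α + 1)))).ofReal (𝕜 := ℂ)).mul_prod hcψ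
    refine hi.mono ?_ ?_
    · have hcm := hc.measurable
      simp only [Function.uncurry_def]
      refine AEStronglyMeasurable.mul (Measurable.aestronglyMeasurable (by fun_prop)) ?_
      refine AEStronglyMeasurable.mul (Measurable.aestronglyMeasurable (by fun_prop))
        hψ.aestronglyMeasurable.comp_snd
    · have : ∀ᵐ p : ℝ × ℝ ∂((volume.restrict (Set.Ioc 0 t)).prod volume), p.1 ∈ Set.Ioc 0 t :=
        Measure.quasiMeasurePreserving_fst.ae (ae_restrict_mem measurableSet_Ioc)
      filter_upwards [this] with p hp
      have hnn : 0 ≤ (t - p.1) ^ (-α) := Real.rpow_nonneg (by linarith [hp.2]) _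
      have hs0 : 0 ≤ p.1 ^ (α - 1) := Real.rpow_nonneg hp.1.le _
      have hG2 := Real.Gamma_pos_of_pos (by linarith : 0 < α + 1)
      have hb := hf.norm_superposition_deriv_le (ψ := ψ) h0 h1 hcr hp.1 p.2
      simp only [Function.uncurry_def]
      rw [norm_mul, Complex.norm_real, Real.norm_of_nonneg hnn]
      refine (mul_le_mul_of_nonneg_left hb hnn).trans_eq ?_
      rw [norm_mul (_ : ℂ) (c p.2 * ψ p.2), Complex.norm_real, show 1 - α - 1 = -α by ring,
        Real.norm_of_nonneg (by positivity)]
      ring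

end Superposition

end IsUnitStableDensity

/-! ### The subordinated kernel is a fundamental solution -/

theorem SchwartzMap.coe_iterate_derivCLM (m : ℕ) (φ : 𝓢(ℝ, ℂ)) :
    ⇑((SchwartzMap.derivCLM ℂ ℂ)^[m] φ) = iteratedDeriv m φ := by
  induction m with
  | zero => simp
  | succ m ih =>
    rw [Function.iterate_succ_apply', iteratedDeriv_succ, ← ih]
    rfl

theorem SchwartzMap.fourier_iteratedDeriv (m : ℕ) (φ : 𝓢(ℝ, ℂ)) (ξ : ℝ) :
    FourierTransform.fourier (iteratedDeriv m φ) ξ =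
      (2 * Real.pi * Complex.I * ξ) ^ m * FourierTransform.fourier (φ : ℝ → ℂ) ξ := by
  rw [Real.fourier_iteratedDeriv (N := ⊤) (φ.smooth ⊤) (fun j _ => ?_) le_top]
  · rfl
  rw [← SchwartzMap.coe_iterate_derivCLM]
  exact SchwartzMap.integrable _

theorem fourierPlus_iteratedDeriv (m : ℕ) (φ : 𝓢(ℝ, ℂ)) (z : ℝ) :
    fourierPlus (iteratedDeriv m φ) z = (-(Complex.I * z)) ^ m * fourierPlus φ z := by
  rw [fourierPlus_eq, fourierPlus_eq, SchwartzMap.fourier_iteratedDeriv]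
  congr 2
  have : (Real.pi : ℂ) ≠ 0 := by exact_mod_cast Real.pi_ne_zero
  push_cast
  field_simp

theorem SchwartzMap.integrable_fourierPlus (φ : 𝓢(ℝ, ℂ)) : Integrable (fourierPlus φ) := by
  have h : Integrable (FourierTransform.fourier (φ : ℝ → ℂ)) := by
    rw [← SchwartzMap.fourier_coe]
    exact SchwartzMap.integrable _
  have h2 := h.comp_mul_right' (R := -(1 / (2 * Real.pi)))
    (neg_ne_zero.2 (one_div_ne_zero (by positivity)))
  refine h2.congr (ae_of_all _ fun z => ?_)
  rw [fourierPlus_eq, show -(z / (2 * Real.pi)) = z * -(1 / (2 * Real.pi)) by ring]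

theorem SchwartzMap.integral_fourierPlus (φ : 𝓢(ℝ, ℂ)) :
    (1 / (2 * Real.pi) : ℂ) * ∫ z, fourierPlus φ z = φ 0 := by
  have h : FourierTransformInv.fourierInv (FourierTransform.fourier (φ : ℝ → ℂ)) 0 = φ 0 := by
    rw [φ.continuous.fourierInv_fourier_eq φ.integrable]
    rw [← SchwartzMap.fourier_coe]
    exact SchwartzMap.integrable _
  have h2 : FourierTransformInv.fourierInv (FourierTransform.fourier (φ : ℝ → ℂ)) 0 =
      ∫ ξ, FourierTransform.fourier (φ : ℝ → ℂ) ξ := by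
    rw [Real.fourierInv_eq]
    simp
  have h3 := Measure.integral_comp_mul_right (FourierTransform.fourier (φ : ℝ → ℂ))
    (-(1 / (2 * Real.pi)))
  rw [← h, h2]
  have h4 : ∫ z, fourierPlus φ z =
      ∫ z : ℝ, FourierTransform.fourier (φ : ℝ → ℂ) (z * -(1 / (2 * Real.pi))) := by
    congr 1
    ext z
    rw [fourierPlus_eq, show -(z / (2 * Real.pi)) = z * -(1 / (2 * Real.pi)) by ring]
  have hpi : (Real.pi : ℂ) ≠ 0 := by exact_mod_cast Real.pi_ne_zero
  rw [h4, h3, Complex.real_smul, abs_inv, abs_neg, abs_of_pos (by positivity)]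
  push_cast
  field_simp

namespace IsUnitStableDensity

variable {α : ℝ} {f : ℝ → ℝ}

section

variable {n : ℕ} {k : ℝ}

theorem pairing_subordinatedKernel_schwartz (hf : IsUnitStableDensity α f) (h0 : 0 < α) (h1 : α < 1)
    (hn : 2 ≤ n) (hk : IsHeatCoeff n k) (φ : 𝓢(ℝ, ℂ)) {t : ℝ} (ht : 0 < t) :
    pairing (subordinatedKernel α n k (scaledDensity α f)) φ t = (1 / (2 * Real.pi) : ℂ) *
      ∫ z : ℝ, mittagLeffler α f (k * (Complex.I * z) ^ n * (t ^ α : ℝ)) * fourierPlus φ z := by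
  rw [hf.pairing_subordinatedKernel h0 h1 hn hk φ.integrable φ.integrable_fourierPlus ht]
  simp only [mul_comm]

/-- The pairing is a superposition over `z` of `E_α(c(z) t^α)` with weight `fourierPlus φ`.
Multiplying the weight by `c` amounts to replacing `φ` by `k (-1)^n φ^(n)`, again Schwartz, so the
superposition lemmas apply and their output is the pairing with that function. -/
theorem isFundamentalSolution_subordinatedKernel (hf : IsUnitStableDensity α f) (h0 : 0 < α)
    (h1 : α < 1) (hn : 2 ≤ n) (hk : IsHeatCoeff n k) :
    IsFundamentalSolution α n k (subordinatedKernel α n k (scaledDensity α f)) := by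
  set c : ℝ → ℂ := fun z => k * (Complex.I * z) ^ n with hcdef
  have hc : Continuous c := by fun_prop
  have hcr : ∀ z, (c z).re ≤ 0 := hk.re_nonpos
  have hcψ : ∀ (φ : 𝓢(ℝ, ℂ)) z, c z * fourierPlus φ z =
      fourierPlus (fun x => k * ((-1) ^ n * iteratedDeriv n φ x)) z := by
    intro φ z
    have : fourierPlus (fun x => k * ((-1) ^ n * iteratedDeriv n φ x)) z =
        k * ((-1) ^ n * fourierPlus (iteratedDeriv n φ) z) := by
      simp only [fourierPlus, ← integral_const_mul]
      congr 1
      ext x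
      ring
    rw [this, fourierPlus_iteratedDeriv, neg_pow, hcdef]
    linear_combination (-(k : ℂ) * (Complex.I * z) ^ n * fourierPlus φ z) *
      (Even.neg_one_pow (α := ℂ) ⟨n, rfl⟩ : (-1 : ℂ) ^ (n + n) = 1)
  have hcoe : ∀ φ : 𝓢(ℝ, ℂ), ∃ χ : 𝓢(ℝ, ℂ),
      (χ : ℝ → ℂ) = fun x => k * ((-1) ^ n * iteratedDeriv n φ x) := by
    intro φ
    refine ⟨((k : ℂ) * (-1) ^ n) • (SchwartzMap.derivCLM ℂ ℂ)^[n] φ, ?_⟩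
    ext x
    rw [_root_.smul_apply, SchwartzMap.coe_iterate_derivCLM, smul_eq_mul, mul_assoc]
  have hint : ∀ φ : 𝓢(ℝ, ℂ), Integrable fun z => c z * fourierPlus φ z := by
    intro φ
    obtain ⟨χ, hχ⟩ := hcoe φ
    simp only [hcψ, ← hχ]
    exact χ.integrable_fourierPlus
  have hpair : ∀ (φ : 𝓢(ℝ, ℂ)) {t : ℝ}, 0 < t →
      pairing (subordinatedKernel α n k (scaledDensity α f)) φ t = (1 / (2 * Real.pi) : ℂ) *
        ∫ z : ℝ, mittagLeffler α f (c z * (t ^ α : ℝ)) * fourierPlus φ z :=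
    fun φ t ht => hf.pairing_subordinatedKernel_schwartz h0 h1 hn hk φ ht
  have hder : ∀ (φ : 𝓢(ℝ, ℂ)) {t : ℝ}, 0 < t →
      HasDerivAt (pairing (subordinatedKernel α n k (scaledDensity α f)) φ)
        ((1 / (2 * Real.pi) : ℂ) * ∫ z, c z * (α * t ^ (α - 1) : ℝ) *
          mittagLefflerDeriv α f (c z * (t ^ α : ℝ)) * fourierPlus φ z) t := by
    intro φ t ht
    refine ((hf.hasDerivAt_superposition h0 h1 hc hcr φ.integrable_fourierPlus (hint φ)
      ht).const_mul _).congr_of_eventuallyEq ?_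
    filter_upwards [Ioi_mem_nhds ht] with s hs using hpair φ hs
  refine ⟨?_, ?_, ?_, ?_, ?_, ?_⟩
  · exact fun t ht => hf.continuous_subordinatedKernel h0 h1 hn hk ht
  · exact fun t ht => hf.exists_norm_subordinatedKernel_le h0 h1 hn hk ht
  · intro φ
    have := (hf.tendsto_superposition_zero h0 h1 hc hcr φ.integrable_fourierPlus).const_mul
      (1 / (2 * Real.pi) : ℂ)
    rw [φ.integral_fourierPlus] at this
    refine this.congr' ?_
    filter_upwards [self_mem_nhdsWithin] with s hs using (hpair φ hs).symm
  · intro φ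
    rw [show (1 : WithTop ℕ∞) = 0 + 1 by norm_num, contDiffOn_succ_iff_deriv_of_isOpen isOpen_Ioi]
    refine ⟨fun t ht => (hder φ ht).differentiableAt.differentiableWithinAt, by simp, ?_⟩
    rw [contDiffOn_zero]
    refine ((hf.continuousOn_superposition_deriv h0 h1 hc hcr φ.integrable_fourierPlus
      (hint φ)).const_smul (1 / (2 * Real.pi) : ℂ)).congr ?_
    exact fun t ht => (hder φ ht).deriv
  · intro φ t ht
    have hbeta := (intervalIntegrable_beta (a := α) (b := 1 - α) h0 (by linarith) ht).const_mul
      (1 / (2 * Real.pi) * (α * (1 / Real.Gamma (α + 1)) * ∫ z, ‖c z * fourierPlus φ z‖))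
    refine hbeta.mono_fun ?_ ?_
    · refine AEStronglyMeasurable.mul (Measurable.aestronglyMeasurable (by fun_prop))
        (aestronglyMeasurable_deriv _ _)
    · rw [Set.uIoc_of_le ht.le]
      filter_upwards [ae_restrict_mem measurableSet_Ioc] with s hs
      have hnn : 0 ≤ (t - s) ^ (-α) := Real.rpow_nonneg (by linarith [hs.2]) _
      have hs0 : 0 ≤ s ^ (α - 1) := Real.rpow_nonneg hs.1.le _
      have hG2 := Real.Gamma_pos_of_pos (by linarith : 0 < α + 1)
      have hI : 0 ≤ ∫ z, ‖c z * fourierPlus φ z‖ := integral_nonneg fun _ => norm_nonneg _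
      have h2 := norm_integral_le_of_norm_le
        ((hint φ).norm.const_mul (α * s ^ (α - 1) * (1 / Real.Gamma (α + 1))))
        (ae_of_all _ (hf.norm_superposition_deriv_le (ψ := fourierPlus φ) h0 h1 hcr hs.1))
      rw [integral_const_mul] at h2
      have h3 : ‖(1 / (2 * Real.pi) : ℂ)‖ = 1 / (2 * Real.pi) := by
        rw [show (1 / (2 * Real.pi) : ℂ) = ((1 / (2 * Real.pi) : ℝ) : ℂ) by push_cast; rfl,
          Complex.norm_real, Real.norm_of_nonneg (by positivity)]
      rw [(hder φ hs.1).deriv, norm_mul, norm_mul, h3, Complex.norm_real, Real.norm_of_nonneg hnn,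
        show 1 - α - 1 = -α by ring, Real.norm_of_nonneg (by positivity)]
      calc _ ≤ (t - s) ^ (-α) * (1 / (2 * Real.pi) *
            (α * s ^ (α - 1) * (1 / Real.Gamma (α + 1)) * ∫ z, ‖c z * fourierPlus φ z‖)) := by
            gcongr
        _ = _ := by ring
  · intro φ t ht
    obtain ⟨χ, hχ⟩ := hcoe φ
    have h2 : (k : ℂ) * pairing (subordinatedKernel α n k (scaledDensity α f))
        (fun x => (-1) ^ n * iteratedDeriv n φ x) t =
        pairing (subordinatedKernel α n k (scaledDensity α f)) χ t := by
      simp only [pairing, ← integral_const_mul, hχ]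
      congr 1
      ext x
      ring
    have h3 : ∫ s in (0 : ℝ)..t, ((t - s) ^ (-α) : ℝ) *
          deriv (pairing (subordinatedKernel α n k (scaledDensity α f)) φ) s =
        ∫ s in (0 : ℝ)..t, (1 / (2 * Real.pi) : ℂ) * (((t - s) ^ (-α) : ℝ) *
          ∫ z, c z * (α * s ^ (α - 1) : ℝ) *
          mittagLefflerDeriv α f (c z * (s ^ α : ℝ)) * fourierPlus φ z) := by
      rw [intervalIntegral.integral_of_le ht.le, intervalIntegral.integral_of_le ht.le]
      refine setIntegral_congr_fun measurableSet_Ioc fun s hs => ?_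
      simp only [(hder φ hs.1).deriv]
      ring
    have hG : (Real.Gamma (1 - α) : ℂ) ≠ 0 := by
      exact_mod_cast (Real.Gamma_pos_of_pos (by linarith : 0 < 1 - α)).ne'
    rw [h2, hpair χ ht, caputoDeriv, h3, intervalIntegral.integral_const_mul,
      hf.integral_caputo_superposition h0 h1 hc hcr φ.integrable_fourierPlus (hint φ) ht]
    simp only [hcψ, hχ]
    rw [Complex.ofReal_div, Complex.ofReal_one]
    generalize (∫ z : ℝ, (_ : ℂ)) = J
    field_simp

end

end IsUnitStableDensity

/-! ### Inverting the Caputo derivative -/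

/-- Abel's kernel computation: the value is independent of `z` and `t`. Since `0 ^ (-α) = 0`, the
`max` encodes the restriction `z < s`, so that Fubini can be applied on a fixed square. -/
theorem intervalIntegrable_max_rpow {α : ℝ} (h0 : 0 < α) (h1 : α < 1) {t z : ℝ} (hz : 0 ≤ z)
    (hzt : z < t) :
    IntervalIntegrable (fun s => (t - s) ^ (α - 1) * (max (s - z) 0) ^ (-α)) volume 0 t ∧
      ∫ s in (0 : ℝ)..t, (t - s) ^ (α - 1) * (max (s - z) 0) ^ (-α) =
        Real.Gamma α * Real.Gamma (1 - α) := by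
  have hzero : Set.EqOn (fun _ => (0 : ℝ)) (fun s => (t - s) ^ (α - 1) * (max (s - z) 0) ^ (-α))
      (Set.uIoc 0 z) := by
    intro s hs
    rw [Set.uIoc_of_le hz] at hs
    simp only
    rw [max_eq_right (by linarith [hs.2]), Real.zero_rpow (by linarith), mul_zero]
  have hshift : Set.EqOn (fun s => (s - z) ^ (1 - α - 1) * ((t - z) - (s - z)) ^ (α - 1))
      (fun s => (t - s) ^ (α - 1) * (max (s - z) 0) ^ (-α)) (Set.uIoc z t) := by
    intro s hs
    rw [Set.uIoc_of_le hzt.le] at hs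
    simp only
    rw [max_eq_left (by linarith [hs.1]), show 1 - α - 1 = -α by ring,
      show t - z - (s - z) = t - s by ring, mul_comm]
  have hi1 : IntervalIntegrable (fun s => (t - s) ^ (α - 1) * (max (s - z) 0) ^ (-α)) volume 0 z :=
    (intervalIntegrable_const (c := (0 : ℝ))).congr hzero
  have hb := (intervalIntegrable_beta (a := 1 - α) (b := α) (by linarith) h0
    (by linarith : 0 < t - z)).comp_sub_right z
  rw [zero_add, sub_add_cancel] at hb
  have hi2 := hb.congr hshift
  refine ⟨hi1.trans hi2, ?_⟩
  rw [← intervalIntegral.integral_add_adjacent_intervals hi1 hi2,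
    ← intervalIntegral.integral_congr_ae (ae_of_all _ fun _ h => hzero h),
    ← intervalIntegral.integral_congr_ae (ae_of_all _ fun _ h => hshift h),
    intervalIntegral.integral_comp_sub_right
      (fun r => r ^ (1 - α - 1) * (t - z - r) ^ (α - 1)) z, sub_self,
    integral_beta (by linarith) h0 (by linarith)]
  simp [mul_comm]

/-- Abel inversion: after exchanging the integrals the inner one is the constant `Γ(α)Γ(1-α)`, and
what remains is `∫ b' = b(t)` since `b(0+) = 0`. -/
theorem rlIntegral_caputoDeriv {α : ℝ} (h0 : 0 < α) (h1 : α < 1) {b : ℝ → ℂ}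
    (hb : ContDiffOn ℝ 1 b (Set.Ioi 0)) (hb0 : Tendsto b (𝓝[>] 0) (𝓝 0)) {t : ℝ} (ht : 0 < t)
    (hi : IntervalIntegrable (fun z => ((t - z) ^ (-α) : ℝ) * deriv b z) volume 0 t) :
    b t = (1 / Real.Gamma α : ℝ) *
      ∫ s in (0 : ℝ)..t, ((t - s) ^ (α - 1) : ℝ) * caputoDeriv α b s := by
  have hder : ∀ z, 0 < z → HasDerivAt b (deriv b z) z := fun z hz =>
    ((hb.differentiableOn one_ne_zero z hz).differentiableAt (Ioi_mem_nhds hz)).hasDerivAt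
  have hGα := Real.Gamma_pos_of_pos h0
  have hG1 := Real.Gamma_pos_of_pos (by linarith : 0 < 1 - α)
  -- The Caputo weight satisfies `(t-z)^(-α) ≥ t^(-α)` on `(0, t)`, so `b'` itself is integrable.
  have hb' : IntervalIntegrable (deriv b) volume 0 t := by
    refine (hi.norm.const_mul (t ^ α)).mono_fun (aestronglyMeasurable_deriv _ _) ?_
    rw [Set.uIoc_of_le ht.le]
    filter_upwards [ae_restrict_mem measurableSet_Ioc, ae_restrict_of_ae (Measure.ae_ne volume t)]
      with z hz hzt
    have hz2 : z < t := lt_of_le_of_ne hz.2 hzt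
    have h2 : t ^ (-α) ≤ (t - z) ^ (-α) :=
      Real.rpow_le_rpow_of_nonpos (by linarith) (by linarith [hz.1]) (by linarith)
    have h3 : t ^ α * t ^ (-α) = 1 := by rw [← Real.rpow_add ht]; simp
    have hp : 0 ≤ t ^ α := Real.rpow_nonneg ht.le _
    rw [norm_mul, norm_norm, norm_mul, Complex.norm_real, Real.norm_of_nonneg hp,
      Real.norm_of_nonneg (Real.rpow_nonneg (by linarith) _), ← mul_assoc]
    refine le_mul_of_one_le_left (norm_nonneg _) ?_
    rw [← h3]
    gcongr
  have hftc : ∫ z in (0 : ℝ)..t, deriv b z = b t := by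
    rw [intervalIntegral.integral_eq_sub_of_hasDerivAt_of_tendsto ht (fun z hz => hder z hz.1) hb'
      hb0 ((hder t ht).continuousAt.tendsto.mono_left nhdsWithin_le_nhds), sub_zero]
  have hinner : ∀ s ∈ Set.Ioc 0 t, caputoDeriv α b s = (1 / Real.Gamma (1 - α) : ℝ) *
      ∫ z in Set.Ioc 0 t, ((max (s - z) 0) ^ (-α) : ℝ) * deriv b z := by
    intro s hs
    rw [caputoDeriv, intervalIntegral.integral_of_le hs.1.le]
    congr 1
    symm
    rw [setIntegral_eq_of_subset_of_forall_sdiff_eq_zero measurableSet_Ioc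
      (Set.Ioc_subset_Ioc_right hs.2)]
    · refine setIntegral_congr_fun measurableSet_Ioc fun z hz => ?_
      rw [max_eq_left (by linarith [hz.2])]
    · intro z hz
      have : s < z := by
        by_contra h
        exact hz.2 ⟨hz.1.1, not_lt.1 h⟩
      rw [max_eq_right (by linarith), Real.zero_rpow (by linarith)]
      simp
  have hker : ∀ z ∈ Set.Ioo 0 t, Integrable
      (fun s => (t - s) ^ (α - 1) * (max (s - z) 0) ^ (-α)) (volume.restrict (Set.Ioc 0 t)) ∧
      ∫ s in Set.Ioc 0 t, (t - s) ^ (α - 1) * (max (s - z) 0) ^ (-α) =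
        Real.Gamma α * Real.Gamma (1 - α) := by
    intro z hz
    have h := intervalIntegrable_max_rpow h0 h1 hz.1.le hz.2
    rwa [intervalIntegrable_iff_integrableOn_Ioc_of_le ht.le,
      intervalIntegral.integral_of_le ht.le] at h
  have hmem : ∀ᵐ z ∂(volume.restrict (Set.Ioc 0 t)), z ∈ Set.Ioo 0 t := by
    filter_upwards [ae_restrict_mem measurableSet_Ioc, ae_restrict_of_ae (Measure.ae_ne volume t)]
      with z hz hzt using ⟨hz.1, lt_of_le_of_ne hz.2 hzt⟩
  rw [intervalIntegrable_iff_integrableOn_Ioc_of_le ht.le] at hb'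
  have hprod : Integrable (Function.uncurry fun s z => (((t - s) ^ (α - 1) *
      (max (s - z) 0) ^ (-α) : ℝ) : ℂ) * deriv b z)
      ((volume.restrict (Set.Ioc 0 t)).prod (volume.restrict (Set.Ioc 0 t))) := by
    rw [integrable_prod_iff']
    · refine ⟨?_, ?_⟩
      · filter_upwards [hmem] with z hz
        exact ((hker z hz).1.ofReal (𝕜 := ℂ)).mul_const (deriv b z)
      · refine (hb'.norm.const_mul (Real.Gamma α * Real.Gamma (1 - α))).congr ?_
        filter_upwards [hmem] with z hz
        rw [← (hker z hz).2, ← integral_mul_const]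
        refine setIntegral_congr_fun measurableSet_Ioc fun s hs => ?_
        have h3 : 0 ≤ (t - s) ^ (α - 1) := Real.rpow_nonneg (by linarith [hs.2]) _
        have h4 : 0 ≤ (max (s - z) 0) ^ (-α) := Real.rpow_nonneg (le_max_right _ _) _
        simp only [Function.uncurry_def]
        rw [norm_mul, Complex.norm_real, Real.norm_of_nonneg (by positivity)]
    · refine AEStronglyMeasurable.mul (Measurable.aestronglyMeasurable (by fun_prop)) ?_
      exact hb'.aestronglyMeasurable.comp_snd
  have hswap : ∫ s in Set.Ioc 0 t, ((t - s) ^ (α - 1) : ℝ) *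
      (∫ z in Set.Ioc 0 t, ((max (s - z) 0) ^ (-α) : ℝ) * deriv b z) =
      (Real.Gamma α * Real.Gamma (1 - α) : ℝ) * b t := by
    calc _ = ∫ s in Set.Ioc 0 t, ∫ z in Set.Ioc 0 t, (((t - s) ^ (α - 1) *
          (max (s - z) 0) ^ (-α) : ℝ) : ℂ) * deriv b z := by
          simp only [← integral_const_mul, Complex.ofReal_mul, mul_assoc]
      _ = ∫ z in Set.Ioc 0 t, ∫ s in Set.Ioc 0 t, (((t - s) ^ (α - 1) *
          (max (s - z) 0) ^ (-α) : ℝ) : ℂ) * deriv b z := integral_integral_swap hprod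
      _ = ∫ z in Set.Ioc 0 t, (Real.Gamma α * Real.Gamma (1 - α) : ℝ) * deriv b z := by
          refine integral_congr_ae ?_
          filter_upwards [hmem] with z hz
          rw [integral_mul_const, integral_complex_ofReal, (hker z hz).2]
      _ = _ := by
          rw [integral_const_mul, ← intervalIntegral.integral_of_le ht.le, hftc]
  have hfin : ∫ s in (0 : ℝ)..t, ((t - s) ^ (α - 1) : ℝ) * caputoDeriv α b s =
      (1 / Real.Gamma (1 - α) : ℝ) * ∫ s in Set.Ioc 0 t, ((t - s) ^ (α - 1) : ℝ) *
        (∫ z in Set.Ioc 0 t, ((max (s - z) 0) ^ (-α) : ℝ) * deriv b z) := by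
    rw [intervalIntegral.integral_of_le ht.le, ← integral_const_mul]
    refine setIntegral_congr_fun measurableSet_Ioc fun s hs => ?_
    simp only [hinner s hs]
    ring
  have e1 : (Real.Gamma α : ℂ) ≠ 0 := by exact_mod_cast hGα.ne'
  have e2 : (Real.Gamma (1 - α) : ℂ) ≠ 0 := by exact_mod_cast hG1.ne'
  rw [hfin, hswap]
  push_cast
  field_simp

/-- A bounded chain `D^α b_m = A b_{m+1}` with zero initial values vanishes. -/
theorem eq_zero_of_caputoDeriv_chain {α : ℝ} (h0 : 0 < α) (h1 : α < 1) {b : ℕ → ℝ → ℂ}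
    {A C T : ℝ} (hA : 0 ≤ A) (hb : ∀ m, ContDiffOn ℝ 1 (b m) (Set.Ioi 0))
    (hb0 : ∀ m, Tendsto (b m) (𝓝[>] 0) (𝓝 0))
    (hi : ∀ m t, 0 < t →
      IntervalIntegrable (fun z => ((t - z) ^ (-α) : ℝ) * deriv (b m) z) volume 0 t)
    (heq : ∀ m t, 0 < t → caputoDeriv α (b m) t = A * b (m + 1) t)
    (hC : ∀ m, ∀ t ∈ Set.Ioc 0 T, ‖b m t‖ ≤ C) {t : ℝ} (ht : t ∈ Set.Ioc 0 T) : b 0 t = 0 := by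
  have hGα := Real.Gamma_pos_of_pos h0
  -- The induction on `j` treats all `m` at once, because one inversion step passes from `b m` to `b
  -- (m + 1)`. The Beta integral raises the exponent by `α`.
  have key : ∀ j m : ℕ, ∀ t ∈ Set.Ioc 0 T,
      ‖b m t‖ ≤ C * (A ^ j * t ^ (α * j) / Real.Gamma (α * j + 1)) := by
    intro j
    induction j with
    | zero => intro m t ht; simpa using hC m t ht
    | succ j ih =>
      intro m t ht
      have hj : 0 < α * j + 1 := by positivity
      have hGj := Real.Gamma_pos_of_pos hj
      have hbeta := intervalIntegrable_beta (a := α * j + 1) (b := α) hj h0 ht.1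
      have hbound : ‖∫ s in (0 : ℝ)..t, ((t - s) ^ (α - 1) : ℝ) * caputoDeriv α (b m) s‖ ≤
          ∫ s in (0 : ℝ)..t, (C * A ^ (j + 1) / Real.Gamma (α * j + 1)) *
            (s ^ (α * j + 1 - 1) * (t - s) ^ (α - 1)) := by
        refine intervalIntegral.norm_integral_le_of_norm_le ht.1.le ?_ (hbeta.const_mul _)
        refine ae_of_all _ fun s hs => ?_
        have hnn : 0 ≤ (t - s) ^ (α - 1) := Real.rpow_nonneg (by linarith [hs.2]) _
        rw [heq m s hs.1, norm_mul, norm_mul, Complex.norm_real, Complex.norm_real,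
          Real.norm_of_nonneg hnn, Real.norm_of_nonneg hA, add_sub_cancel_right]
        calc _ ≤ (t - s) ^ (α - 1) *
              (A * (C * (A ^ j * s ^ (α * j) / Real.Gamma (α * j + 1)))) := by
              gcongr
              exact ih (m + 1) s ⟨hs.1, hs.2.trans ht.2⟩
          _ = _ := by ring
      rw [intervalIntegral.integral_const_mul, integral_beta hj h0 ht.1] at hbound
      rw [rlIntegral_caputoDeriv h0 h1 (hb m) (hb0 m) ht.1 (hi m t ht.1), norm_mul,
        Complex.norm_real, Real.norm_of_nonneg (by positivity)]
      refine (mul_le_mul_of_nonneg_left hbound (by positivity)).trans_eq ?_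
      rw [show α * j + 1 + α = α * (j + 1 : ℕ) + 1 by push_cast; ring, add_sub_cancel_right]
      field_simp
  have hx : 0 ≤ A * t ^ α := mul_nonneg hA (Real.rpow_nonneg ht.1.le _)
  have hlim := ((summable_mittagLeffler h0 hx).tendsto_atTop_zero).const_mul C
  rw [mul_zero] at hlim
  rw [← norm_le_zero_iff]
  refine ge_of_tendsto' hlim fun j => (key j 0 t ht).trans_eq ?_
  rw [mul_pow, ← Real.rpow_natCast (t ^ α) j, ← Real.rpow_mul ht.1.le]

/-! ### A uniform bound along band-limited test functions -/

theorem lp.summable_norm_one (a : lp (fun _ : ℕ => ℂ) 1) : Summable fun m => ‖a m‖ := by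
  simpa using (memℓp_gen_iff (by simp)).1 (lp.memℓp a)

theorem lp.norm_eq_tsum_one (a : lp (fun _ : ℕ => ℂ) 1) : ‖a‖ = ∑' m, ‖a m‖ := by
  simpa using lp.norm_eq_tsum_rpow (by simp) a

/-- The function `g · ∑ a_m q^m`. -/
noncomputable def seriesMultiplier (g q : ℝ → ℂ) (a : lp (fun _ : ℕ => ℂ) 1) (ξ : ℝ) : ℂ :=
  g ξ * ∑' m, a m * q ξ ^ m

theorem summable_lp_mul_pow (a : lp (fun _ : ℕ => ℂ) 1) {w : ℂ} (hw : ‖w‖ ≤ 1) :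
    Summable fun m => ‖a m * w ^ m‖ := by
  refine (lp.summable_norm_one a).of_nonneg_of_le (fun _ => norm_nonneg _) fun m => ?_
  rw [norm_mul, norm_pow]
  exact mul_le_of_le_one_right (norm_nonneg _) (pow_le_one₀ (norm_nonneg _) hw)

section

variable {g q : ℝ → ℂ}

theorem seriesMultiplier_add (hq1 : ∀ ξ ∈ tsupport g, ‖q ξ‖ < 1)
    (a b : lp (fun _ : ℕ => ℂ) 1) (ξ : ℝ) :
    seriesMultiplier g q (a + b) ξ = seriesMultiplier g q a ξ + seriesMultiplier g q b ξ := by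
  by_cases h : ξ ∈ tsupport g
  · have hw := (hq1 ξ h).le
    rw [seriesMultiplier, seriesMultiplier, seriesMultiplier, ← mul_add,
      ← (summable_lp_mul_pow a hw).of_norm.tsum_add (summable_lp_mul_pow b hw).of_norm]
    simp only [lp.coeFn_add, Pi.add_apply, add_mul]
  · simp [seriesMultiplier, image_eq_zero_of_notMem_tsupport h]

theorem seriesMultiplier_smul (c : ℂ) (a : lp (fun _ : ℕ => ℂ) 1) (ξ : ℝ) :
    seriesMultiplier g q (c • a) ξ = c * seriesMultiplier g q a ξ := by
  simp only [seriesMultiplier, lp.coeFn_smul, Pi.smul_apply, smul_eq_mul, mul_assoc, tsum_mul_left]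
  ring

theorem seriesMultiplier_single (m : ℕ) (ξ : ℝ) :
    seriesMultiplier g q (lp.single 1 m 1) ξ = g ξ * q ξ ^ m := by
  rw [seriesMultiplier, tsum_eq_single m]
  · rw [lp.single_apply_self, one_mul]
  · intro j hj
    rw [lp.single_apply_ne _ _ _ hj, zero_mul]

theorem norm_seriesMultiplier_le (hq1 : ∀ ξ ∈ tsupport g, ‖q ξ‖ < 1)
    (a : lp (fun _ : ℕ => ℂ) 1) (ξ : ℝ) : ‖seriesMultiplier g q a ξ‖ ≤ ‖a‖ * ‖g ξ‖ := by
  by_cases h : ξ ∈ tsupport g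
  · have hw := (hq1 ξ h).le
    rw [seriesMultiplier, norm_mul, mul_comm]
    gcongr
    refine (norm_tsum_le_tsum_norm (summable_lp_mul_pow a hw)).trans ?_
    rw [lp.norm_eq_tsum_one]
    refine (summable_lp_mul_pow a hw).tsum_le_tsum (fun m => ?_) (lp.summable_norm_one a)
    rw [norm_mul, norm_pow]
    exact mul_le_of_le_one_right (norm_nonneg _) (pow_le_one₀ (norm_nonneg _) hw)
  · simp [seriesMultiplier, image_eq_zero_of_notMem_tsupport h]

theorem hasCompactSupport_seriesMultiplier (hgc : HasCompactSupport g)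
    (a : lp (fun _ : ℕ => ℂ) 1) : HasCompactSupport (seriesMultiplier g q a) :=
  hgc.mul_right

theorem contDiff_seriesMultiplier (hg : ContDiff ℝ (⊤ : ℕ∞) g) (hq : ContDiff ℝ (⊤ : ℕ∞) q)
    (hq1 : ∀ ξ ∈ tsupport g, ‖q ξ‖ < 1) (a : lp (fun _ : ℕ => ℂ) 1) :
    ContDiff ℝ (⊤ : ℕ∞) (seriesMultiplier g q a) := by
  rw [contDiff_iff_contDiffAt]
  intro ξ
  by_cases h : ξ ∈ tsupport g
  · have hF : DifferentiableOn ℂ (fun w : ℂ => ∑' m, a m * w ^ m) (Metric.ball 0 1) := by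
      refine Complex.differentiableOn_tsum_of_summable_norm (lp.summable_norm_one a)
        (fun m => by fun_prop) Metric.isOpen_ball fun m w hw => ?_
      rw [norm_mul, norm_pow]
      exact mul_le_of_le_one_right (norm_nonneg _)
        (pow_le_one₀ (norm_nonneg _) (mem_ball_zero_iff.1 hw).le)
    have hF2 : ContDiffAt ℝ (⊤ : ℕ∞) (fun w : ℂ => ∑' m, a m * w ^ m) (q ξ) :=
      ((hF.contDiffOn Metric.isOpen_ball).contDiffAt
        (Metric.isOpen_ball.mem_nhds (mem_ball_zero_iff.2 (hq1 ξ h)))).restrict_scalars ℝ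
    exact hg.contDiffAt.mul (hF2.comp ξ hq.contDiffAt)
  · have h0 : seriesMultiplier g q a =ᶠ[𝓝 ξ] fun _ => 0 := by
      filter_upwards [notMem_tsupport_iff_eventuallyEq.1 h] with η hη
      simp only [seriesMultiplier, hη, Pi.zero_apply, zero_mul]
    exact contDiffAt_const.congr_of_eventuallyEq h0

/-- All the functions with transform `g q^m` are images of unit vectors of the Banach space `ℓ¹`, so
an operator bound on `ℓ¹` is a bound uniform in `m`. -/
theorem exists_schwartz_seriesMultiplier (hg : ContDiff ℝ (⊤ : ℕ∞) g) (hgc : HasCompactSupport g)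
    (hq : ContDiff ℝ (⊤ : ℕ∞) q) (hq1 : ∀ ξ ∈ tsupport g, ‖q ξ‖ < 1) :
    ∃ (T : lp (fun _ : ℕ => ℂ) 1 →ₗ[ℂ] 𝓢(ℝ, ℂ)) (M : ℝ), (∀ a x, ‖T a x‖ ≤ M * ‖a‖) ∧
      ∀ m ξ, FourierTransform.fourier (T (lp.single 1 m 1)) ξ = g ξ * q ξ ^ m := by
  have hc := fun a => hasCompactSupport_seriesMultiplier (q := q) hgc a
  have hs := fun a => contDiff_seriesMultiplier hg hq hq1 a
  let G : lp (fun _ : ℕ => ℂ) 1 → 𝓢(ℝ, ℂ) := fun a => (hc a).toSchwartzMap (hs a)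
  have hG : ∀ a ξ, G a ξ = seriesMultiplier g q a ξ := fun a ξ => rfl
  let T : lp (fun _ : ℕ => ℂ) 1 →ₗ[ℂ] 𝓢(ℝ, ℂ) :=
    { toFun := fun a => FourierTransformInv.fourierInv (G a)
      map_add' := fun a b => by
        rw [← FourierTransform.fourierInv_add]
        congr 1
        ext ξ
        exact seriesMultiplier_add hq1 a b ξ
      map_smul' := fun c a => by
        rw [RingHom.id_apply, ← FourierTransform.fourierInv_smul]
        congr 1
        ext ξ
        exact seriesMultiplier_smul c a ξ }
  have hgi : Integrable g := hg.continuous.integrable_of_hasCompactSupport hgc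
  refine ⟨T, ∫ ξ, ‖g ξ‖, fun a x => ?_, fun m ξ => ?_⟩
  · have h1 : T a x = FourierTransformInv.fourierInv (G a : ℝ → ℂ) x := by
      rw [← SchwartzMap.fourierInv_coe]; rfl
    rw [h1, Real.fourierInv_eq', mul_comm (∫ ξ, ‖g ξ‖), ← integral_const_mul]
    refine norm_integral_le_of_norm_le (hgi.norm.const_mul _) (ae_of_all _ fun ξ => ?_)
    rw [smul_eq_mul, norm_mul, hG]
    have h2 : ‖Complex.exp (↑(2 * Real.pi * inner ℝ ξ x) * Complex.I)‖ = 1 :=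
      Complex.norm_exp_ofReal_mul_I _
    rw [h2, one_mul]
    exact norm_seriesMultiplier_le hq1 a ξ
  · have h1 : FourierTransform.fourier (T (lp.single 1 m 1)) = G (lp.single 1 m 1) :=
      FourierTransform.fourier_fourierInv_eq (G (lp.single 1 m 1))
    rw [h1, hG, seriesMultiplier_single]

end

theorem exists_bound_Ioc_of_tendsto {b : ℝ → ℂ} {L : ℂ} (hb : ContinuousOn b (Set.Ioi 0))
    (hb0 : Tendsto b (𝓝[>] 0) (𝓝 L)) (T : ℝ) : ∃ C, ∀ t ∈ Set.Ioc 0 T, ‖b t‖ ≤ C := by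
  have h1 : ∀ᶠ t in 𝓝[>] (0 : ℝ), ‖b t‖ < ‖L‖ + 1 := hb0.norm.eventually_lt_const (by linarith)
  obtain ⟨δ, hδ, h2⟩ := (mem_nhdsGT_iff_exists_Ioo_subset).1 h1
  have hδ : 0 < δ := hδ
  obtain ⟨C, hC⟩ := isCompact_Icc.exists_bound_of_continuousOn
    (hb.mono (fun t ht => lt_of_lt_of_le (half_pos hδ) ht.1 : Set.Icc (δ / 2) T ⊆ Set.Ioi 0))
  refine ⟨max (‖L‖ + 1) C, fun t ht => ?_⟩
  rcases lt_or_ge t δ with h | h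
  · exact le_max_of_le_left (le_of_lt (h2 ⟨ht.1, h⟩))
  · exact le_max_of_le_right (hC t ⟨by linarith, ht.2⟩)

/-- A sup bound on `T a` does not control an integral over the whole line, but it does over `[-N,
N]`. The pairing is a pointwise limit of these bounded functionals, hence bounded by
Banach–Steinhaus. -/
theorem exists_clm_pairing {E : Type*} [NormedAddCommGroup E] [NormedSpace ℂ E] [CompleteSpace E]
    {w : ℝ → ℂ} {B : ℝ} (hw : Continuous w) (hB : ∀ x, ‖w x‖ ≤ B) (T : E →ₗ[ℂ] 𝓢(ℝ, ℂ)) {M : ℝ}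
    (hT : ∀ a x, ‖T a x‖ ≤ M * ‖a‖) : ∃ Λ : E →L[ℂ] ℂ, ∀ a, Λ a = ∫ x, w x * T a x := by
  have hB0 : 0 ≤ B := (norm_nonneg _).trans (hB 0)
  have hcont : ∀ a, Continuous fun x => w x * T a x := fun a => hw.mul (T a).continuous
  let ΛN : ℕ → E →L[ℂ] ℂ := fun N => LinearMap.mkContinuous
    { toFun := fun a => ∫ x in (-N : ℝ)..N, w x * T a x
      map_add' := fun a b => by
        rw [← intervalIntegral.integral_add ((hcont a).intervalIntegrable _ _)
          ((hcont b).intervalIntegrable _ _)]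
        simp only [map_add, _root_.add_apply, mul_add]
      map_smul' := fun c a => by
        simp only [map_smul, _root_.smul_apply, smul_eq_mul, RingHom.id_apply,
          ← intervalIntegral.integral_const_mul]
        congr 1
        ext x
        ring } (B * M * |(N : ℝ) - (-N)|) fun a => by
      refine (intervalIntegral.norm_integral_le_of_norm_le_const
        (C := B * (M * ‖a‖)) fun x _ => ?_).trans_eq (by ring)
      rw [norm_mul]
      exact mul_le_mul (hB x) (hT a x) (norm_nonneg _) hB0
  have hlim : Tendsto (fun N a => ΛN N a) atTop (𝓝 fun a => ∫ x, w x * T a x) := by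
    rw [tendsto_pi_nhds]
    intro a
    exact intervalIntegral_tendsto_integral
      ((T a).integrable.bdd_mul hw.aestronglyMeasurable (ae_of_all _ hB))
      (tendsto_neg_atTop_atBot.comp tendsto_natCast_atTop_atTop) tendsto_natCast_atTop_atTop
  exact ⟨continuousLinearMapOfTendsto ΛN hlim, fun a => rfl⟩

/-- For each fixed `a` the pairing is bounded in time: near `0` by the initial condition, elsewhere
by continuity. Uniform boundedness over `t` supplies the constant, although the sup bound on
`v(·,t)` may depend on `t`. -/
theorem IsFundamentalSolution.exists_bound_pairing {α : ℝ} {n : ℕ} {k : ℝ} {v : ℝ → ℝ → ℂ}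
    (hv : IsFundamentalSolution α n k v) {E : Type*} [NormedAddCommGroup E] [NormedSpace ℂ E]
    [CompleteSpace E] (T : E →ₗ[ℂ] 𝓢(ℝ, ℂ)) {M : ℝ} (hT : ∀ a x, ‖T a x‖ ≤ M * ‖a‖) (t₀ : ℝ) :
    ∃ C, ∀ t ∈ Set.Ioc 0 t₀, ∀ a, ‖pairing v (T a) t‖ ≤ C * ‖a‖ := by
  have hΛ : ∀ t : Set.Ioc 0 t₀, ∃ Λ : E →L[ℂ] ℂ, ∀ a, Λ a = pairing v (T a) t := by
    rintro ⟨t, ht⟩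
    obtain ⟨B, hB⟩ := hv.bounded t ht.1
    exact exists_clm_pairing (hv.continuous t ht.1) hB T hT
  choose Λ hΛ using hΛ
  obtain ⟨C, hC⟩ := banach_steinhaus (g := Λ) fun a => by
    obtain ⟨C, hC⟩ := exists_bound_Ioc_of_tendsto (hv.contDiffOn (T a)).continuousOn
      (hv.initial (T a)) t₀
    exact ⟨C, fun t => by rw [hΛ]; exact hC t t.2⟩
  exact ⟨C, fun t ht a => by rw [← hΛ ⟨t, ht⟩]; exact (Λ ⟨t, ht⟩).le_of_opNorm_le (hC _) a⟩

/-! ### Uniqueness -/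

/-- Take `ρ` with transform a bump `β`, so that `∫ ρ = β(0) = 1`, and set `φ_N(x) = R ρ(R(x - x₀))`
with `R = N + 1`. Dilation keeps the transform compactly supported, and integrability of `ρ` makes
this an approximate identity. -/
theorem exists_bandLimited_approx (x₀ : ℝ) : ∃ φ : ℕ → 𝓢(ℝ, ℂ),
    (∀ N, HasCompactSupport (FourierTransform.fourier (φ N))) ∧
    ∀ (w : ℝ → ℂ) (B : ℝ), Continuous w → (∀ x, ‖w x‖ ≤ B) →
      Tendsto (fun N => ∫ x, w x * φ N x) atTop (𝓝 (w x₀)) := by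
  let β : ContDiffBump (0 : ℝ) := ⟨1, 2, one_pos, one_lt_two⟩
  have hβc : HasCompactSupport fun ξ : ℝ => ((β ξ : ℝ) : ℂ) :=
    β.hasCompactSupport.comp_left (g := fun r : ℝ => (r : ℂ)) Complex.ofReal_zero
  have hβs : ContDiff ℝ (⊤ : ℕ∞) fun ξ : ℝ => ((β ξ : ℝ) : ℂ) :=
    Complex.ofRealCLM.contDiff.comp β.contDiff
  let ρ : 𝓢(ℝ, ℂ) := FourierTransformInv.fourierInv (hβc.toSchwartzMap hβs)
  have hρ : ∀ x, ρ x = ∫ η : ℝ, Complex.exp (↑(2 * Real.pi * (η * x)) * Complex.I) * β η := by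
    intro x
    have : ρ x = FourierTransformInv.fourierInv (fun ξ : ℝ => ((β ξ : ℝ) : ℂ)) x := by
      change (FourierTransformInv.fourierInv (hβc.toSchwartzMap hβs) : 𝓢(ℝ, ℂ)) x = _
      rw [SchwartzMap.fourierInv_coe]
      rfl
    rw [this, Real.fourierInv_eq']
    simp only [smul_eq_mul, RCLike.inner_apply, conj_trivial, mul_comm]
  have hρ1 : ∫ y, ρ y = 1 := by
    have h1 : FourierTransform.fourier ρ = hβc.toSchwartzMap hβs :=
      FourierTransform.fourier_fourierInv_eq _
    have h2 : FourierTransform.fourier (ρ : ℝ → ℂ) 0 = β 0 := by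
      rw [← SchwartzMap.fourier_coe, h1]
      rfl
    rw [Real.fourier_eq] at h2
    have h3 : β 0 = 1 := β.one_of_mem_closedBall (Metric.mem_closedBall_self zero_le_one)
    simpa [h3] using h2
  let g : ℕ → ℝ → ℂ := fun N ξ =>
    Complex.exp (-(2 * Real.pi * x₀ * ξ : ℝ) * Complex.I) * β (ξ * ((N : ℝ) + 1)⁻¹)
  have hR : ∀ N : ℕ, (0 : ℝ) < (N : ℝ) + 1 := fun N => by positivity
  have hgc : ∀ N, HasCompactSupport (g N) := by
    intro N
    refine HasCompactSupport.mul_left ?_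
    exact hβc.comp_homeomorph (Homeomorph.mulRight₀ ((N : ℝ) + 1)⁻¹ (inv_ne_zero (hR N).ne'))
  have hgs : ∀ N, ContDiff ℝ (⊤ : ℕ∞) (g N) := by
    intro N
    refine ContDiff.mul ?_ (hβs.comp (contDiff_id.mul contDiff_const))
    refine ContDiff.cexp (ContDiff.mul (ContDiff.neg ?_) contDiff_const)
    exact Complex.ofRealCLM.contDiff.comp (contDiff_const.mul contDiff_id)
  let φ : ℕ → 𝓢(ℝ, ℂ) := fun N =>
    FourierTransformInv.fourierInv ((hgc N).toSchwartzMap (hgs N))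
  have hφ : ∀ (N : ℕ) x, φ N x = ((N : ℝ) + 1 : ℝ) * ρ (((N : ℝ) + 1) * (x - x₀)) := by
    intro N x
    have h1 : φ N x = FourierTransformInv.fourierInv (g N) x := by
      change (FourierTransformInv.fourierInv ((hgc N).toSchwartzMap (hgs N)) : 𝓢(ℝ, ℂ)) x = _
      rw [SchwartzMap.fourierInv_coe]
      rfl
    have h2 := Measure.integral_comp_mul_right (fun η : ℝ => Complex.exp
      (↑(2 * Real.pi * (η * (((N : ℝ) + 1) * (x - x₀)))) * Complex.I) * β η) ((N : ℝ) + 1)⁻¹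
    rw [inv_inv, abs_of_pos (hR N), ← hρ, Complex.real_smul] at h2
    rw [h1, Real.fourierInv_eq', ← h2]
    refine integral_congr_ae (ae_of_all _ fun ξ => ?_)
    simp only [g, smul_eq_mul, RCLike.inner_apply, conj_trivial]
    rw [← mul_assoc, ← Complex.exp_add, ← add_mul, ← Complex.ofReal_neg, ← Complex.ofReal_add]
    congr 4
    have := (hR N).ne'
    field_simp
    ring
  refine ⟨φ, fun N => ?_, fun w B hw hB => ?_⟩
  · have h1 : FourierTransform.fourier (φ N) = (hgc N).toSchwartzMap (hgs N) :=
      FourierTransform.fourier_fourierInv_eq _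
    rw [h1]
    exact hgc N
  · have h1 : ∀ N : ℕ, ∫ x, w x * φ N x = ∫ y, w (x₀ + y / ((N : ℝ) + 1)) * ρ y := by
      intro N
      have h2 := Measure.integral_comp_mul_left
        (fun y => w (x₀ + y / ((N : ℝ) + 1)) * ρ y) ((N : ℝ) + 1)
      rw [← integral_sub_right_eq_self _ x₀, abs_of_pos (inv_pos.2 (hR N)),
        Complex.real_smul] at h2
      have hne : (((N : ℝ) + 1 : ℝ) : ℂ) ≠ 0 := by exact_mod_cast (hR N).ne'
      rw [Complex.ofReal_inv, eq_inv_mul_iff_mul_eq₀ hne, ← integral_const_mul] at h2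
      rw [← h2]
      refine integral_congr_ae (ae_of_all _ fun x => ?_)
      simp only [hφ]
      rw [mul_div_cancel_left₀ _ (hR N).ne', add_sub_cancel]
      ring
    simp only [h1]
    have h3 : w x₀ = ∫ y, w x₀ * ρ y := by rw [integral_const_mul, hρ1, mul_one]
    rw [h3]
    refine tendsto_integral_of_dominated_convergence (fun y => B * ‖ρ y‖) (fun N => ?_)
      (ρ.integrable.norm.const_mul B) (fun N => ae_of_all _ fun y => ?_) (ae_of_all _ fun y => ?_)
    · exact ((hw.comp (by fun_prop)).mul ρ.continuous).aestronglyMeasurable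
    · rw [norm_mul]
      gcongr
      exact hB _
    · refine Tendsto.mul_const _ ((hw.tendsto x₀).comp ?_)
      have h4 : Tendsto (fun N : ℕ => y / ((N : ℝ) + 1)) atTop (𝓝 0) :=
        tendsto_const_nhds.div_atTop (tendsto_atTop_add_const_right _ _ tendsto_natCast_atTop_atTop)
      simpa using h4.const_add x₀

theorem SchwartzMap.fourier_injective :
    Function.Injective (FourierTransform.fourier : 𝓢(ℝ, ℂ) → 𝓢(ℝ, ℂ)) :=
  Function.LeftInverse.injective FourierTransform.fourierInv_fourier_eq

theorem IsFundamentalSolution.pairing_eq {α : ℝ} (h0 : 0 < α) (h1 : α < 1) {n : ℕ} {k : ℝ}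
    {v v' : ℝ → ℝ → ℂ} (hv : IsFundamentalSolution α n k v) (hv' : IsFundamentalSolution α n k v')
    {φ : 𝓢(ℝ, ℂ)} (hφ : HasCompactSupport (FourierTransform.fourier φ)) {t : ℝ} (ht : 0 < t) :
    pairing v φ t = pairing v' φ t := by
  let p : ℝ → ℂ := fun ξ => k * ((-1) ^ n * (2 * Real.pi * Complex.I * ξ) ^ n)
  have hp : ContDiff ℝ (⊤ : ℕ∞) p := contDiff_const.mul (contDiff_const.mul
    ((contDiff_const.mul Complex.ofRealCLM.contDiff).pow n))
  obtain ⟨A₀, hA₀⟩ := hφ.isCompact.exists_bound_of_continuousOn hp.continuous.continuousOn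
  -- `A₀` bounds the symbol on the support; adding one makes `A` positive and `q = p/A` strictly
  -- smaller than one there.
  set A : ℝ := |A₀| + 1 with hAdef
  have hA : 0 < A := by positivity
  have hAC : (A : ℂ) ≠ 0 := by exact_mod_cast hA.ne'
  have hq1 : ∀ ξ ∈ tsupport (FourierTransform.fourier φ), ‖(A : ℂ)⁻¹ * p ξ‖ < 1 := by
    intro ξ hξ
    rw [norm_mul, norm_inv, Complex.norm_real, Real.norm_of_nonneg hA.le, inv_mul_lt_one₀ hA]
    exact (hA₀ ξ hξ).trans_lt (by linarith [le_abs_self A₀])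
  obtain ⟨T, M, hT, hTF⟩ := exists_schwartz_seriesMultiplier
    ((FourierTransform.fourier φ).smooth ⊤) hφ (contDiff_const.mul hp) hq1
  have hφT : φ = T (lp.single 1 0 1) := by
    refine SchwartzMap.fourier_injective ?_
    ext ξ
    rw [hTF, pow_zero, mul_one]
  -- The adjoint operator multiplies transforms by `p = A q`, so it shifts the family by one index
  -- and costs a factor `A`.
  have hstep : ∀ m, ((k : ℂ) * (-1) ^ n) •
      (SchwartzMap.derivCLM ℂ ℂ)^[n] (T (lp.single 1 m 1)) =
        (A : ℂ) • T (lp.single 1 (m + 1) 1) := by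
    intro m
    refine SchwartzMap.fourier_injective ?_
    rw [FourierTransform.fourier_smul, FourierTransform.fourier_smul]
    ext ξ
    rw [_root_.smul_apply, _root_.smul_apply, hTF, SchwartzMap.fourier_coe,
      SchwartzMap.coe_iterate_derivCLM, SchwartzMap.fourier_iteratedDeriv,
      ← SchwartzMap.fourier_coe, hTF, smul_eq_mul, smul_eq_mul, pow_succ]
    simp only [p]
    field_simp
  have hpair : ∀ (u : ℝ → ℝ → ℂ) m s,
      k * pairing u (fun x => (-1) ^ n * iteratedDeriv n (T (lp.single 1 m 1)) x) s =
        A * pairing u (T (lp.single 1 (m + 1) 1)) s := by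
    intro u m s
    simp only [pairing, ← integral_const_mul]
    refine integral_congr_ae (ae_of_all _ fun x => ?_)
    have h2 := congrArg (fun ψ : 𝓢(ℝ, ℂ) => ψ x) (hstep m)
    simp only [_root_.smul_apply, SchwartzMap.coe_iterate_derivCLM, smul_eq_mul] at h2
    linear_combination u x s * h2
  obtain ⟨C, hC⟩ := hv.exists_bound_pairing T hT t
  obtain ⟨C', hC'⟩ := hv'.exists_bound_pairing T hT t
  let b : ℕ → ℝ → ℂ := fun m s =>
    pairing v (T (lp.single 1 m 1)) s - pairing v' (T (lp.single 1 m 1)) s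
  have hderiv : ∀ m s, 0 < s → deriv (b m) s =
      deriv (pairing v (T (lp.single 1 m 1))) s - deriv (pairing v' (T (lp.single 1 m 1))) s := by
    intro m s hs
    exact deriv_sub
      (((hv.contDiffOn _).differentiableOn one_ne_zero s hs).differentiableAt (Ioi_mem_nhds hs))
      (((hv'.contDiffOn _).differentiableOn one_ne_zero s hs).differentiableAt (Ioi_mem_nhds hs))
  have hcongr : ∀ m s, 0 < s → Set.EqOn (fun z =>
      ((s - z) ^ (-α) : ℝ) * deriv (pairing v (T (lp.single 1 m 1))) z -
      ((s - z) ^ (-α) : ℝ) * deriv (pairing v' (T (lp.single 1 m 1))) z)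
      (fun z => ((s - z) ^ (-α) : ℝ) * deriv (b m) z) (Set.uIoc 0 s) := by
    intro m s hs z hz
    rw [Set.uIoc_of_le hs.le] at hz
    simp only [hderiv m z hz.1]
    ring
  have hzero : b 0 t = 0 := by
    refine eq_zero_of_caputoDeriv_chain h0 h1 (b := b) (C := C + C') (T := t) hA.le
      (fun m => (hv.contDiffOn _).sub (hv'.contDiffOn _)) (fun m => ?_) (fun m s hs => ?_)
      (fun m s hs => ?_) (fun m s hs => ?_) ⟨ht, le_rfl⟩
    · simpa using (hv.initial (T (lp.single 1 m 1))).sub (hv'.initial (T (lp.single 1 m 1)))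
    · exact ((hv.integrable _ s hs).sub (hv'.integrable _ s hs)).congr (hcongr m s hs)
    · rw [caputoDeriv, ← intervalIntegral.integral_congr_ae
        (ae_of_all _ fun _ h => hcongr m s hs h), intervalIntegral.integral_sub
        (hv.integrable _ s hs) (hv'.integrable _ s hs), mul_sub]
      have e1 := hv.equation (T (lp.single 1 m 1)) s hs
      have e2 := hv'.equation (T (lp.single 1 m 1)) s hs
      rw [hpair, caputoDeriv] at e1 e2
      rw [e1, e2, mul_sub]
    · refine (norm_sub_le _ _).trans ?_
      -- Basis vectors have norm one, so `C + C'` does not depend on `m`.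
      have e1 := hC s hs (lp.single 1 m 1)
      have e2 := hC' s hs (lp.single 1 m 1)
      rw [lp.norm_single one_pos, norm_one, mul_one] at e1 e2
      exact add_le_add e1 e2
  rw [hφT]
  exact sub_eq_zero.1 hzero

theorem IsFundamentalSolution.unique {α : ℝ} (h0 : 0 < α) (h1 : α < 1) {n : ℕ} {k : ℝ}
    {v v' : ℝ → ℝ → ℂ} (hv : IsFundamentalSolution α n k v) (hv' : IsFundamentalSolution α n k v')
    (x : ℝ) {t : ℝ} (ht : 0 < t) : v x t = v' x t := by
  obtain ⟨φ, hφ, hlim⟩ := exists_bandLimited_approx x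
  obtain ⟨B, hB⟩ := hv.bounded t ht
  obtain ⟨B', hB'⟩ := hv'.bounded t ht
  refine tendsto_nhds_unique (hlim (fun x => v x t) B (hv.continuous t ht) hB) ?_
  refine (hlim (fun x => v' x t) B' (hv'.continuous t ht) hB').congr fun N => ?_
  exact (hv.pairing_eq h0 h1 hv' (hφ N) ht).symm

/-! ### The main theorem -/

theorem exists_isUnitStableDensity {α : ℝ} (h0 : 0 < α) (h1 : α < 1) :
    ∃ f, IsUnitStableDensity α f := by
  obtain ⟨f, K, hm, hn, hK, hz, hl⟩ := exists_stable_density h0 h1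
  exact ⟨f, hm, hn, ⟨K, hK⟩, hz, hl⟩

theorem rlIntegral_congr_ae {f g : ℝ → ℝ} (h : f =ᵐ[volume] g) (γ t : ℝ) :
    rlIntegral γ f t = rlIntegral γ g t := by
  rw [rlIntegral, rlIntegral, intervalIntegral.integral_congr_ae]
  filter_upwards [h] with w hw _
  rw [hw]

theorem theorem2p2 (α : ℝ) (hα0 : 0 < α) (hα1 : α < 1) (n : ℕ) (hn : 2 ≤ n) (k : ℝ)
    (hk : IsHeatCoeff n k) :
    -- the kernel `p_n` is well defined
    (∀ x t : ℝ, 0 < t →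
      Tendsto (fun R : ℝ × ℝ => heatKernelTrunc n k x t R.1 R.2) (atBot ×ˢ atTop)
        (𝓝 (heatKernel n k x t))) ∧
    -- the stable laws `S_α((u cos (πα/2))^(1/α), 1, 0)` have densities
    (∃ pbar : ℝ → ℝ → ℝ, ∀ u, 0 < u → IsStableDensity α (stableScale α u) 1 0 (pbar u)) ∧
    ∀ pbar : ℝ → ℝ → ℝ,
      (∀ u, 0 < u → IsStableDensity α (stableScale α u) 1 0 (pbar u)) →
      -- the integrals in the formula converge
      (∀ u t : ℝ, 0 < u → 0 < t →
        IntervalIntegrable (fun w => (t - w) ^ (1 - α - 1) * pbar u w) volume 0 t) ∧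
      (∀ x t : ℝ, 0 < t →
        IntegrableOn (fun u => heatKernel n k x u * (rlIntegral (1 - α) (pbar u) t : ℝ))
          (Set.Ioi (0 : ℝ)) volume) ∧
      -- the formula gives the fundamental solution, and the only one
      IsFundamentalSolution α n k (subordinatedKernel α n k pbar) ∧
      ∀ v : ℝ → ℝ → ℂ, IsFundamentalSolution α n k v →
        ∀ x t : ℝ, 0 < t → v x t = subordinatedKernel α n k pbar x t := by
  obtain ⟨f, hf⟩ := exists_isUnitStableDensity hα0 hα1
  refine ⟨fun x t ht => tendsto_heatKernelTrunc hn hk x ht, ⟨scaledDensity α f, fun u hu =>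
    hf.isStableDensity_scaledDensity hα0 hα1 hu⟩, fun pbar hp => ?_⟩
  have hae : ∀ u, 0 < u → scaledDensity α f u =ᵐ[volume] pbar u := fun u hu =>
    (hf.isStableDensity_scaledDensity hα0 hα1 hu).ae_eq (hp u hu)
  have hkernel : subordinatedKernel α n k pbar =
      subordinatedKernel α n k (scaledDensity α f) := by
    ext x t
    refine setIntegral_congr_fun measurableSet_Ioi fun u hu => ?_
    simp only [rlIntegral_congr_ae (hae u hu)]
  have hS := hf.isFundamentalSolution_subordinatedKernel hα0 hα1 hn hk
  rw [hkernel]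
  refine ⟨fun u t hu ht => ?_, fun x t ht => ?_, hS, fun v hv x t ht => hv.unique hα0 hα1 hS x ht⟩
  · refine (hf.intervalIntegrable hα1 hu ht).congr_ae (ae_restrict_of_ae ?_)
    filter_upwards [hae u hu] with w hw
    rw [hw]
  · refine ((hf.integrable_invLaw_iff hα1 ht _).1
      (hf.integrable_heatKernel_invLaw hα0 hα1 hn hk x ht)).congr_fun (fun u hu => ?_)
      measurableSet_Ioi
    simp only [invDensity, rlIntegral_congr_ae (hae u hu)]
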